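/- **Setting.** Let $\mathbf k$ be a perfect field and fix one of three qualities of power series: formal; convergent (for a given absolute value $\mathbf k\to\mathbb R$; a series $\sum c_\alpha x^\alpha$ is convergent if $\sum|c_\alpha|s^{|\alpha|}<\infty$ for some $s>0$); algebraic (algebraic over the polynomial ring). Let $\mathcal A\subset\mathbf k[[t]]$ and $\mathcal B\subset \mathbf k[[t,y_1,\dots,y_m]]$ be the rings of series of this quality, $\mathcal A_\circ\subset\mathcal A$ the series without constant term. For $h\in\mathcal B$ and $y\in\mathcal A_\circ^m$ write $h(y)=h(t,y(t))$. Arquile closed subsets of $\mathcal A_\circ^m$ are the common zero sets $\{y: h(y)=0\ \forall h\in F\}$ with $F\subset\mathcal B$. A textile locally closed set is a difference of two subsets of $\mathcal A_\circ^m$ defined by polynomial equations in the coefficients of $y$. A map between sets of power series vectors is *textile* (resp. *rationally textile*) if each coefficient of the image is a polynomial (resp. a quotient of two polynomials, the denominator having no zero on the source) in finitely many coefficients of the argument; a (rationally) textile isomorphism is a bijection which together with its inverse is (rationally) textile. For $\mathbf d\in\mathbb N^m$ let $\mathcal V_{\mathbf d}=\prod_i t^{d_i}\mathcal A_\circ$,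 let $\mathcal R_{\mathbf d}\cong\mathbb A_{\mathbf k}^{d_1+\dots+d_m}$ be the space of vectors of polynomials in $t$ without constant term whose $i$-th component has degree $\le d_i$, and let $\pi_{\mathbf d}:\mathcal A_\circ^m=\mathcal R_{\mathbf d}\oplus\mathcal V_{\mathbf d}\to\mathcal R_{\mathbf d}$ be the projection. Let $f\in\mathcal B^k$, with relative Jacobian matrix $\partial_yf$, and $f_\infty:\mathcal A_\circ^m\to\mathcal A^k$, $y\mapsto f(y)$. **Theorem.** (1) Let $k\le m$ and let $g$ be a $k\times k$ minor of $\partial_y f$. For $d\in\mathbb N$ put $\mathcal S_d=\{y\in\mathcal A_\circ^m:\operatorname{ord} g(y)=d\}$, $\mathcal V_d=t^d\mathcal A_\circ^m$ and $\mathcal Z_d=\mathcal S_d\cap\mathcal R_{(d,\dots,d)}$. Then $\mathcal S_d$ is textile locally closed, $\mathcal Z_d$ is a quasi-affine (Zariski locally closed) subset of the affine space $\mathcal R_{(d,\dots,d)}$, $\mathcal V_d$ is a free $\mathcal A_\circ$-submodule of $\mathcal A_\circ^m$ (its elements are uniquely the combinations $\sum a_je_j$, $a_j\in\mathcal A_\circ$,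 of finitely many vectors $e_j\in \mathcal A^m$), and there is a rationally textile isomorphism $\chi_d:\mathcal Z_d\times\mathcal V_d\to\mathcal S_d$ over $\mathcal Z_d$, i.e. the remainder in $\mathcal R_{(d,\dots,d)}$ of $\chi_d(z,v)$ is $z$, such that $$(f_\infty\circ\chi_d)(z,v)=f(z)+\partial_yf(z)\cdot v\qquad\text{for all }(z,v).$$ The denominators of $\chi_d$ involve only the coefficients of $z$, those of $\chi_d^{-1}$ at $y$ only the coefficients of $y$ up to degree $d$; in particular $\chi_d$ is polynomial in the coefficients of $v$. (2) If moreover $g\neq0$, then $\mathcal S=\{y\in\mathcal A_\circ^m: g(y)\ne0\}$ is open and dense in $\mathcal A_\circ^m$ for the arquile topology, and it is the disjoint union of the $\mathcal S_d$, $d\in\mathbb N$. (3) (General case; here $k$ and $m$ are arbitrary.) Let $g_1,\dots,g_m\in\mathcal B$ be non-zero, $\Delta_g=\operatorname{diag}(g_1,\dots,g_m)$, $\mathcal G(z)=\prod_i g_i(z)\mathcal A_\circ$, and assume that $\langle g_1\rangle\times\dots\times\langle g_m\rangle$ is a division module for $f$: (i) $\mathcal G(z)=\mathcal G(z+v)$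 for all $z\in\mathcal A_\circ^m$, $v\in\mathcal G(z)$; (ii) there is a vector $p=p(t,z,a)$ of $m$ power series of the given quality in $t$, $z=(z_1,\dots,z_m)$, $a=(a_1,\dots,a_m)$, of order at least $2$ in $a$, such that for all $z,a\in\mathcal A_\circ^m$ $$f(z+\Delta_g(z)a)=f(z)+\partial_yf(z)\Delta_g(z)a+\partial_yf(z)\Delta_g(z)p(z,a).$$ Fix any such $p$, let $\mathbf d\in\mathbb N^m$, $\mathcal S_{\mathbf d}=\{y\in\mathcal A_\circ^m:\operatorname{ord}g_i(y)=d_i\ \forall i\}$ and $\mathcal Z_{\mathbf d}=\mathcal S_{\mathbf d}\cap\mathcal R_{\mathbf d}$. Then $\mathcal S_{\mathbf d}$ is textile locally closed, $\mathcal Z_{\mathbf d}$ is quasi-affine in $\mathcal R_{\mathbf d}$, $\mathcal V_{\mathbf d}$ is a free $\mathcal A_\circ$-submodule of $\mathcal A_\circ^m$, the map $\psi_{\mathbf d}:\mathcal S_{\mathbf d}\to\mathcal Z_{\mathbf d}\times\mathcal V_{\mathbf d}$, $y\mapsto(\pi_{\mathbf d}(y),y-\pi_{\mathbf d}(y))$,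 is a textile isomorphism, every $v\in\mathcal V_{\mathbf d}$ is, for $z\in\mathcal Z_{\mathbf d}$, uniquely of the form $v=\Delta_g(z)a$ with $a\in\mathcal A_\circ^m$, the map $\varphi_{\mathbf d}:\mathcal Z_{\mathbf d}\times\mathcal V_{\mathbf d}\to\mathcal Z_{\mathbf d}\times\mathcal V_{\mathbf d}$, $(z,\Delta_g(z)a)\mapsto(z,\Delta_g(z)(a+p(z,a)))$, is a rationally textile isomorphism, and $\chi_{\mathbf d}=(\varphi_{\mathbf d}\circ\psi_{\mathbf d})^{-1}:\mathcal Z_{\mathbf d}\times\mathcal V_{\mathbf d}\to\mathcal S_{\mathbf d}$ is a rationally textile isomorphism over $\mathcal Z_{\mathbf d}$ with $$(f_\infty\circ\chi_{\mathbf d})(z,v)=f(z)+\partial_yf(z)\cdot v\qquad\text{for all }(z,v).$$ The denominators of $\varphi_{\mathbf d}$, $\varphi_{\mathbf d}^{-1}$ and $\chi_{\mathbf d}$ involve only the coefficients of $z$, those of $\chi_{\mathbf d}^{-1}$ at $y$ only the coefficients of each $y_i$ up to degree $d_i$. -/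

import Mathlib

namespace Arquile

open MvPowerSeries

noncomputable section

/-- The three qualities of power series: formal, convergent (with respect to a real-valued
absolute value on the ground field), and algebraic. -/
inductive Quality (k : Type*) [Field k] where
  | formal : Quality k
  | convergent (v : AbsoluteValue k ℝ) : Quality k
  | algebraic : Quality k

/-- A power series has the given quality. Formal: no condition. Convergent: `∑ |c_α| s^|α| < ∞`
for some `s > 0`. Algebraic: algebraic over the polynomial ring in the same variables. -/
def Quality.Has {k : Type*} [Field k] {σ : Type*} (Q : Quality k) (h : MvPowerSeries σ k) : Prop :=
  match Q with
  | .formal => True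
  | .convergent v => ∃ s : ℝ, 0 < s ∧ Summable fun α : σ →₀ ℕ => v (coeff α h) * s ^ α.degree
  | .algebraic => IsAlgebraic (MvPolynomial σ k) h

variable {k : Type*} [Field k] {ι κ : Type*}

/-- Series in one variable `t`: an element of `k⟦t⟧`, regarded as a series in the variables
`Unit`, has quality `Q`, i.e. lies in the ring `𝒜`. -/
def Quality.HasArc (Q : Quality k) (a : PowerSeries k) : Prop :=
  Q.Has (σ := Unit) a

variable (k ι) in
/-- Power series in `t` and `y_i`, `i : ι`; the variable `none` is `t`, the variable `some i`
is `y_i`. The ring `ℬ` consists of those that have the chosen quality. -/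
abbrev Series : Type _ := MvPowerSeries (Option ι) k

/-- The non-unital ring `𝒜_∘`: univariate series of quality `Q` without constant term. -/
def arcs₁ (Q : Quality k) : Set (PowerSeries k) :=
  {a | Q.HasArc a ∧ PowerSeries.constantCoeff a = 0}

variable (ι) in
/-- The affine space `𝒜_∘^ι` of vectors of arcs centred at `0`. -/
def arcs (Q : Quality k) : Set (ι → PowerSeries k) :=
  {y | ∀ i, y i ∈ arcs₁ Q}

/-- The evaluation `f(y) = f(t, y(t))`. -/
def evalAt (f : Series k ι) (y : ι → PowerSeries k) : PowerSeries k :=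
  MvPowerSeries.subst (τ := Unit) (fun o : Option ι => o.elim PowerSeries.X y) f

/-- The relative Jacobian matrix `∂_y f`. -/
def jacobian (f : κ → Series k ι) : Matrix κ ι (Series k ι) :=
  Matrix.of fun i j => MvPowerSeries.pderiv k (some j) (f i)

/-- The evaluation `∂_y f(z)`. -/
def jacobianAt (f : κ → Series k ι) (z : ι → PowerSeries k) : Matrix κ ι (PowerSeries k) :=
  (jacobian f).map fun h => evalAt h z

/-- The `r × r` minor of `∂_y f` given by the columns `e`. -/
def minor {r : ℕ} (f : Fin r → Series k ι) (e : Fin r ↪ ι) : Series k ι :=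
  ((jacobian f).submatrix id e).det

/-! ### Arquile topology -/

/-- Arquile closed subsets of `𝒜_∘^ι`: common zero sets of elements of `ℬ`. -/
def IsArquileClosed (Q : Quality k) (Y : Set (ι → PowerSeries k)) : Prop :=
  ∃ F : Set (Series k ι), (∀ h ∈ F, Q.Has h) ∧ Y = {y ∈ arcs ι Q | ∀ h ∈ F, evalAt h y = 0}

/-- Arquile open subsets of `𝒜_∘^ι`. -/
def IsArquileOpen (Q : Quality k) (S : Set (ι → PowerSeries k)) : Prop :=
  S ⊆ arcs ι Q ∧ IsArquileClosed Q (arcs ι Q \ S)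

/-- Dense for the arquile topology: `𝒜_∘^ι` is the only arquile closed set containing `S`. -/
def IsArquileDense (Q : Quality k) (S : Set (ι → PowerSeries k)) : Prop :=
  ∀ Y, IsArquileClosed Q Y → S ⊆ Y → Y = arcs ι Q

/-! ### Textile sets and maps -/

/-- The coefficients `y_{ij}` of a vector of series. -/
def coords (y : ι → PowerSeries k) : ι × ℕ → k :=
  fun c => PowerSeries.coeff c.2 (y c.1)

/-- Textile locally closed: the difference of two subsets of `𝒜_∘^ι`, each defined by polynomial
equations in the coefficients. -/
def IsTextileLocallyClosed (Q : Quality k) (S : Set (ι → PowerSeries k)) : Prop :=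
  ∃ F G : Set (MvPolynomial (ι × ℕ) k),
    S = {y ∈ arcs ι Q | ∀ P ∈ F, MvPolynomial.eval (coords y) P = 0} \
      {y ∈ arcs ι Q | ∀ P ∈ G, MvPolynomial.eval (coords y) P = 0}

/-- A map is textile if every coefficient of the image is a polynomial in (finitely many of) the
coefficients of the argument. -/
def IsTextile {U : Set (ι → PowerSeries k)} (F : U → κ → PowerSeries k) : Prop :=
  ∀ (i : κ) (l : ℕ), ∃ P : MvPolynomial (ι × ℕ) k,
    ∀ u : U, PowerSeries.coeff l (F u i) = MvPolynomial.eval (coords u.1) P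

/-- A map on `U` is rationally textile, with denominators in the coordinates `J`, if every
coefficient of the image is a quotient of polynomials in (finitely many of) the coefficients of
the argument, where the denominator has no zero on `U` and involves only coordinates in `J`.
(For `J = univ` this is the notion of a rationally textile map.) -/
def IsRationallyTextile (J : Set (ι × ℕ)) {U : Set (ι → PowerSeries k)}
    (F : U → κ → PowerSeries k) : Prop :=
  ∀ (i : κ) (l : ℕ), ∃ P D : MvPolynomial (ι × ℕ) k, (∀ c ∈ D.vars, c ∈ J) ∧
    ∀ u : U, MvPolynomial.eval (coords u.1) D ≠ 0 ∧
      PowerSeries.coeff l (F u i) =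
        MvPolynomial.eval (coords u.1) P / MvPolynomial.eval (coords u.1) D

/-- A bijection that is textile together with its inverse. -/
def IsTextileIso {U : Set (ι → PowerSeries k)} {W : Set (κ → PowerSeries k)} (e : U ≃ W) : Prop :=
  IsTextile (fun u => (e u).1) ∧ IsTextile (fun w => (e.symm w).1)

/-- A bijection that is rationally textile together with its inverse; `J` and `J'` contain the
coordinates in the denominators of the map and of its inverse. -/
def IsRationallyTextileIso (J : Set (ι × ℕ)) (J' : Set (κ × ℕ)) {U : Set (ι → PowerSeries k)}
    {W : Set (κ → PowerSeries k)} (e : U ≃ W) : Prop :=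
  IsRationallyTextile J (fun u => (e u).1) ∧ IsRationallyTextile J' (fun w => (e.symm w).1)

/-- The cartesian product `Z × V` inside `𝒜_∘^ι × 𝒜_∘^ι = 𝒜_∘^(ι ⊕ ι)`. -/
def pairs (Z V : Set (ι → PowerSeries k)) : Set (ι ⊕ ι → PowerSeries k) :=
  {w | w ∘ Sum.inl ∈ Z ∧ w ∘ Sum.inr ∈ V}

/-- The first component `z` of `(z, v) ∈ Z × V`. -/
def fst {Z V : Set (ι → PowerSeries k)} (w : pairs Z V) : ι → PowerSeries k := w.1 ∘ Sum.inl

/-- The second component `v` of `(z, v) ∈ Z × V`. -/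
def snd {Z V : Set (ι → PowerSeries k)} (w : pairs Z V) : ι → PowerSeries k := w.1 ∘ Sum.inr

variable (ι) in
/-- The coordinates of the first factor of `𝒜_∘^ι × 𝒜_∘^ι`. -/
def fstCoords : Set ((ι ⊕ ι) × ℕ) := {c | c.1.isLeft = true}

/-- The coordinates `y_{ij}` with `j ≤ d_i`. -/
def lowCoords (d : ι → ℕ) : Set (ι × ℕ) := {c | c.2 ≤ d c.1}

/-! ### Strata, remainders, and the modules `𝒱_d` -/

/-- `𝒮_d = {y ∈ 𝒜_∘^ι : ord g(y) = d}` for a single series `g`. As `d` is finite, `g(y) ≠ 0`. -/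
def stratum (Q : Quality k) (g : Series k ι) (d : ℕ) : Set (ι → PowerSeries k) :=
  {y ∈ arcs ι Q | (evalAt g y).order = d}

/-- `𝒮_d = {y ∈ 𝒜_∘^ι : ord g_i(y) = d_i for all i}` for a vector `g` and a tuple `d`. -/
def multiStratum (Q : Quality k) (g : ι → Series k ι) (d : ι → ℕ) : Set (ι → PowerSeries k) :=
  {y ∈ arcs ι Q | ∀ i, (evalAt (g i) y).order = d i}

variable (k) in
/-- `ℛ_d`: vectors whose `i`-th component is a polynomial of degree `≤ d_i` without constant
term. -/
def polyVectors (d : ι → ℕ) : Set (ι → PowerSeries k) :=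
  {z | ∀ i, PowerSeries.constantCoeff (z i) = 0 ∧ ∀ j, d i < j → PowerSeries.coeff j (z i) = 0}

/-- `𝒵_d = 𝒮_d ∩ ℛ_d` for a single series `g`. -/
def polyStratum (Q : Quality k) (g : Series k ι) (d : ℕ) : Set (ι → PowerSeries k) :=
  stratum Q g d ∩ polyVectors k fun _ => d

/-- `𝒵_d = 𝒮_d ∩ ℛ_d` for a vector `g` and a tuple `d`. -/
def multiPolyStratum (Q : Quality k) (g : ι → Series k ι) (d : ι → ℕ) : Set (ι → PowerSeries k) :=
  multiStratum Q g d ∩ polyVectors k d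

/-- `𝒱_d`: vectors whose `i`-th component lies in `t^{d_i} · 𝒜_∘`. -/
def tailModule (Q : Quality k) (d : ι → ℕ) : Set (ι → PowerSeries k) :=
  {v | ∃ a ∈ arcs ι Q, v = fun i => PowerSeries.X ^ d i * a i}

/-- The remainder `z ∈ ℛ_d` of `y` in `𝒜_∘^ι = ℛ_d ⊕ 𝒱_d`: the truncation of `y_i` to degrees
`≤ d_i`. -/
def remainder (d : ι → ℕ) (y : ι → PowerSeries k) : ι → PowerSeries k :=
  fun i => ((PowerSeries.trunc (d i + 1) (y i) : Polynomial k) : PowerSeries k)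

/-- The coefficients of `t, …, t^{d_i}` in `z_i`: linear coordinates on `ℛ_d`, identifying it
with an affine space of dimension `∑ d_i`. -/
def affineCoords (d : ι → ℕ) (z : ι → PowerSeries k) : (Σ i, Fin (d i)) → k :=
  fun c => PowerSeries.coeff ((c.2 : ℕ) + 1) (z c.1)

/-- A subset of `ℛ_d` that is Zariski locally closed in the affine space `ℛ_d`. -/
def IsQuasiAffine (d : ι → ℕ) (Z : Set (ι → PowerSeries k)) : Prop :=
  Z ⊆ polyVectors k d ∧ ∃ F G : Set (MvPolynomial (Σ i, Fin (d i)) k),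
    affineCoords d '' Z = {x | ∀ P ∈ F, MvPolynomial.eval x P = 0} \
      {x | ∀ P ∈ G, MvPolynomial.eval x P = 0}

/-- A free `𝒜_∘`-submodule of `𝒜_∘^ι`: there are vectors `e_1, …, e_n` over `𝒜` such that the
elements of `V` are uniquely the combinations `∑ a_j e_j` with `a_j ∈ 𝒜_∘`. -/
def IsFreeSubmodule (Q : Quality k) (V : Set (ι → PowerSeries k)) : Prop :=
  V ⊆ arcs ι Q ∧ ∃ (n : ℕ) (e : Fin n → ι → PowerSeries k), (∀ j i, Q.HasArc (e j i)) ∧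
    Set.BijOn (fun a : Fin n → PowerSeries k => fun i => ∑ j, a j * e j i) (arcs (Fin n) Q) V

/-! ### Division modules -/

/-- The vector `Δ_g(z) · a = (g_1(z) a_1, …, g_m(z) a_m)`. -/
def diagMul (g : ι → Series k ι) (z a : ι → PowerSeries k) : ι → PowerSeries k :=
  fun i => evalAt (g i) z * a i

/-- The module `𝒢(z) = g_1(z) 𝒜_∘ × … × g_m(z) 𝒜_∘`. -/
def moduleAt (Q : Quality k) (g : ι → Series k ι) (z : ι → PowerSeries k) :
    Set (ι → PowerSeries k) :=
  {v | ∃ a ∈ arcs ι Q, v = diagMul g z a}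

/-- The evaluation `p(z, a)` of a vector `p` of series in `t`, `z_i`, `a_i`; the variables
`z_i`, `a_i` are indexed by `inl i`, `inr i`. -/
def substPair (p : ι → Series k (ι ⊕ ι)) (z a : ι → PowerSeries k) : ι → PowerSeries k :=
  fun i => evalAt (p i) (Sum.elim z a)

/-- Condition on the vector `p` in the definition of a division module: `p` has quality `Q`, is
of order at least `2` in the variables `a`, and
`f(z + Δ_g(z) a) = f(z) + ∂_y f(z) Δ_g(z) a + ∂_y f(z) Δ_g(z) p(z, a)` for all `z, a ∈ 𝒜_∘^ι`. -/
structure IsDivisionRemainder [Fintype ι] (Q : Quality k) (f : κ → Series k ι)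
    (g : ι → Series k ι) (p : ι → Series k (ι ⊕ ι)) : Prop where
  quality : ∀ i, Q.Has (p i)
  order_two : ∀ i (α : Option (ι ⊕ ι) →₀ ℕ), coeff α (p i) ≠ 0 →
    2 ≤ ∑ j, α (some (Sum.inr j))
  expansion : ∀ z ∈ arcs ι Q, ∀ a ∈ arcs ι Q,
    (fun i => evalAt (f i) (z + diagMul g z a)) =
      (fun i => evalAt (f i) z) + (jacobianAt f z).mulVec (diagMul g z a) +
        (jacobianAt f z).mulVec (diagMul g z (substPair p z a))

/-- `⟨g_1⟩ × … × ⟨g_m⟩` is a division module for `f`. -/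
structure IsDivisionModule [Fintype ι] (Q : Quality k) (f : κ → Series k ι)
    (g : ι → Series k ι) : Prop where
  quality : ∀ i, Q.Has (g i)
  ne_zero : ∀ i, g i ≠ 0
  stable : ∀ z ∈ arcs ι Q, ∀ v ∈ moduleAt Q g z, moduleAt Q g z = moduleAt Q g (z + v)
  exists_remainder : ∃ p, IsDivisionRemainder Q f g p

end

end Arquile

open Arquile

/-! Put z = `remainder d y` and v = y - z. On a stratum each g_i(z) has order exactly d_i, so it is
t^{d_i} times a unit; multiplication by Δ_g(z) therefore identifies the vectors a of arcs with 𝒱_d,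
a module that does not depend on z. The expansion of a division module reads f(z + Δ_g(z)a) = f(z) +
∂_y f(z)·Δ_g(z)(a + p(z,a)). Thus f becomes affine in v as soon as Δ_g(z)(a + p(z,a)) replaces
Δ_g(z)a as coordinate in the fibre over z. This replacement is invertible: (t,z,a) ↦ (t,z,a + p) is
tangent to the identity, so the inverse mapping theorem for the chosen quality gives an inverse
series, which again fixes t and z. Splitting y and then changing the fibre coordinate is the inverse
of χ (`IsLinearizable.exists_chart`).

For a minor g, the Taylor remainder of f along g(z)a is g(z)² times a series
(`exists_taylor_quotient`), and M·adj(M) = g·1 writes g(z)² R as ∂_y f(z)·g(z)·adj(M)R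
(`exists_minor_remainder`). So both cases satisfy `IsLinearizable`: strata of a minor are stable
under 𝒱_d because g(y) modulo t^{d+1} depends only on y modulo t^{d+1}, those of a division module
because 𝒢(y) = 𝒢(y + v) fixes the orders of the g_i.

Textility comes from `evalAt_mem_coeffSubalgebra`: a coefficient of h(y) sees only a polynomial
truncation of h. Denominators arise only on inverting g_i(z)/t^{d_i}, and are built from its
constant term, a polynomial in the coefficients of z.

The work specific to a quality is closure under substitution, division by a variable and inversion
of coordinate changes: by weighted ℓ¹-norms for convergent series, by transcendence arguments for
algebraic ones. Derivatives, units and Taylor quotients then follow uniformly. Density rests on the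
existence, for h ≠ 0, of monomial arcs y_i = t^{N_i} with h(y) ≠ 0. -/

namespace Arquile

open MvPowerSeries

noncomputable section

/-! ### Formal series: order filtration, Taylor expansion, inverse mapping theorem. -/

section Formal

variable {k : Type*} [Field k] {σ τ : Type*}

/-! ### Monomial ideals and substitution -/

/-- The series without coefficients at the exponents of a lower set. -/
def coeffIdeal (k : Type*) [Field k] (E : LowerSet (τ →₀ ℕ)) : Ideal (MvPowerSeries τ k) where
  carrier := {h | ∀ e ∈ E, coeff e h = 0}
  add_mem' ha hb e he := by simp [ha e he, hb e he]
  zero_mem' e _ := by simp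
  smul_mem' c h hh e he := by
    classical
    rw [smul_eq_mul, coeff_mul]
    refine Finset.sum_eq_zero fun x hx => ?_
    rw [hh x.2 (E.lower ?_ he), mul_zero]
    rw [← Finset.HasAntidiagonal.mem_antidiagonal.1 hx]
    exact le_add_self

/-- Exponents of total degree less than `n`. -/
def degreeBelow (τ : Type*) (n : ℕ) : LowerSet (τ →₀ ℕ) where
  carrier := {e | e.degree < n}
  lower' _ _ hab ha := lt_of_le_of_lt (Finsupp.degree_mono hab) ha

/-- The series of order at least `n`. -/
abbrev orderIdeal (k : Type*) [Field k] (τ : Type*) (n : ℕ) : Ideal (MvPowerSeries τ k) :=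
  coeffIdeal k (degreeBelow τ n)

theorem mem_orderIdeal {n : ℕ} {h : MvPowerSeries τ k} :
    h ∈ orderIdeal k τ n ↔ ∀ e : τ →₀ ℕ, e.degree < n → coeff e h = 0 := Iff.rfl

theorem mem_orderIdeal_one {h : MvPowerSeries τ k} :
    h ∈ orderIdeal k τ 1 ↔ constantCoeff h = 0 := by
  rw [mem_orderIdeal]
  constructor
  · intro h'
    simpa using h' 0 (by simp)
  · intro h' e he
    have : e = 0 := (Finsupp.degree_eq_zero_iff e).1 (Nat.lt_one_iff.1 he)
    simpa [this] using h'

theorem orderIdeal_anti {m n : ℕ} (hmn : m ≤ n) : orderIdeal k τ n ≤ orderIdeal k τ m :=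
  fun _ hh e he => hh e (lt_of_lt_of_le he hmn)

theorem mul_mem_orderIdeal {m n : ℕ} {f g : MvPowerSeries τ k} (hf : f ∈ orderIdeal k τ m)
    (hg : g ∈ orderIdeal k τ n) : f * g ∈ orderIdeal k τ (m + n) := by
  classical
  intro e he
  rw [coeff_mul]
  refine Finset.sum_eq_zero fun x hx => ?_
  have hx' := Finset.HasAntidiagonal.mem_antidiagonal.1 hx
  have he' : e.degree < m + n := he
  rw [← hx', map_add] at he'
  rcases lt_or_ge x.1.degree m with h1 | h1
  · rw [hf _ h1, zero_mul]
  · rw [hg _ (show x.2.degree < n by omega), mul_zero]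

theorem eq_zero_of_forall_mem_orderIdeal {h : MvPowerSeries τ k}
    (hh : ∀ n, h ∈ orderIdeal k τ n) : h = 0 := by
  ext e
  simpa using hh (e.degree + 1) e (Nat.lt_succ_self _)

theorem X_mem_orderIdeal (s : τ) : (X s : MvPowerSeries τ k) ∈ orderIdeal k τ 1 := by
  rw [mem_orderIdeal_one]; simp

theorem hasSubst_of_mem [Finite σ] {a : σ → MvPowerSeries τ k}
    (ha : ∀ s, a s ∈ orderIdeal k τ 1) : HasSubst a :=
  hasSubst_of_constantCoeff_zero fun s => mem_orderIdeal_one.1 (ha s)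

/-- Each coefficient of a substituted series is a finite sum over the monomials of `f`, so
membership in a monomial ideal can be tested one monomial at a time. -/
theorem subst_sub_subst_mem {a b : σ → MvPowerSeries τ k} (ha : HasSubst a) (hb : HasSubst b)
    {E : LowerSet (τ →₀ ℕ)} {f : MvPowerSeries σ k}
    (h : ∀ d, coeff d f ≠ 0 →
      d.prod (fun s e => a s ^ e) - d.prod (fun s e => b s ^ e) ∈ coeffIdeal k E) :
    subst a f - subst b f ∈ coeffIdeal k E := by
  intro e he
  rw [map_sub, coeff_subst ha, coeff_subst hb,
    ← finsum_sub_distrib (coeff_subst_finite ha f e) (coeff_subst_finite hb f e)]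
  refine finsum_eq_zero_of_forall_eq_zero fun d => ?_
  rw [← smul_sub, ← map_sub]
  by_cases hd : coeff d f = 0
  · rw [hd, zero_smul]
  · rw [h d hd e he, smul_zero]

theorem subst_mem {a : σ → MvPowerSeries τ k} (ha : HasSubst a)
    {E : LowerSet (τ →₀ ℕ)} {f : MvPowerSeries σ k}
    (h : ∀ d, coeff d f ≠ 0 → d.prod (fun s e => a s ^ e) ∈ coeffIdeal k E) :
    subst a f ∈ coeffIdeal k E := by
  intro e he
  rw [coeff_subst ha]
  refine finsum_eq_zero_of_forall_eq_zero fun d => ?_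
  by_cases hd : coeff d f = 0
  · rw [hd, zero_smul]
  · rw [h d hd e he, smul_zero]

theorem exists_single_add {d : σ →₀ ℕ} {n : ℕ} (hd : d.degree = n + 1) :
    ∃ s d', d = Finsupp.single s 1 + d' ∧ Finsupp.degree d' = n := by
  obtain ⟨s, hs⟩ : ∃ s, d s ≠ 0 := by
    by_contra! h
    have : d = 0 := Finsupp.ext h
    simp [this] at hd
  have h1 : d = Finsupp.single s 1 + (d - Finsupp.single s 1) := by
    rw [add_tsub_cancel_of_le]
    simpa using Nat.one_le_iff_ne_zero.2 hs
  refine ⟨s, _, h1, ?_⟩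
  have h2 := congrArg Finsupp.degree h1
  rw [map_add, hd, Finsupp.degree_single] at h2
  omega

theorem prod_single_add {A : Type*} [CommMonoid A] (a : σ → A) (s : σ) (d : σ →₀ ℕ) :
    (Finsupp.single s 1 + d).prod (fun s e => a s ^ e) = a s * d.prod (fun s e => a s ^ e) := by
  classical
  rw [Finsupp.prod_add_index' (by simp) (by simp [pow_add]), Finsupp.prod_single_index (by simp),
    pow_one]

theorem prod_pow_mem_orderIdeal {a : σ → MvPowerSeries τ k} (ha : ∀ s, a s ∈ orderIdeal k τ 1)
    (d : σ →₀ ℕ) : d.prod (fun s e => a s ^ e) ∈ orderIdeal k τ d.degree := by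
  induction hn : d.degree generalizing d with
  | zero => intro e he; exact absurd he (Nat.not_lt_zero _)
  | succ n ih =>
    obtain ⟨s, d', rfl, hd'⟩ := exists_single_add hn
    rw [prod_single_add, add_comm n 1]
    exact mul_mem_orderIdeal (ha s) (ih d' hd')

/-- Telescoping: aA - bB = (a - b)A + b(A - B). Each of the n factors other than the difference
itself contributes one to the order. -/
theorem prod_pow_sub_mem_orderIdeal {a b : σ → MvPowerSeries τ k}
    (ha : ∀ s, a s ∈ orderIdeal k τ 1) (hb : ∀ s, b s ∈ orderIdeal k τ 1) {N : ℕ}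
    (hab : ∀ s, a s - b s ∈ orderIdeal k τ N) {n : ℕ} (d : σ →₀ ℕ) (hd : d.degree = n + 1) :
    d.prod (fun s e => a s ^ e) - d.prod (fun s e => b s ^ e) ∈ orderIdeal k τ (N + n) := by
  induction n generalizing d with
  | zero =>
    obtain ⟨s, d', rfl, hd'⟩ := exists_single_add hd
    rw [Finsupp.degree_eq_zero_iff] at hd'
    subst hd'
    simpa using hab s
  | succ n ih =>
    obtain ⟨s, d', rfl, hd'⟩ := exists_single_add hd
    rw [prod_single_add, prod_single_add]
    have h1 := mul_mem_orderIdeal (hab s) (prod_pow_mem_orderIdeal ha d')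
    have h2 := mul_mem_orderIdeal (hb s) (ih d' hd')
    rw [hd'] at h1
    convert Ideal.add_mem _ h1 (orderIdeal_anti (by omega) h2) using 1
    ring

/-- Substitution is continuous for the order filtration, with a gain of `n` for series of order
at least `n + 1`. -/
theorem subst_sub_subst_mem_orderIdeal [Finite σ] {a b : σ → MvPowerSeries τ k}
    (ha : ∀ s, a s ∈ orderIdeal k τ 1) (hb : ∀ s, b s ∈ orderIdeal k τ 1) {N n : ℕ}
    (hab : ∀ s, a s - b s ∈ orderIdeal k τ N) {f : MvPowerSeries σ k}
    (hf : f ∈ orderIdeal k σ (n + 1)) :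
    subst a f - subst b f ∈ orderIdeal k τ (N + n) := by
  refine subst_sub_subst_mem (hasSubst_of_mem ha) (hasSubst_of_mem hb) fun d hd => ?_
  have hn : n + 1 ≤ d.degree := by
    by_contra! h
    exact hd (hf d h)
  obtain ⟨m, hm⟩ := Nat.exists_eq_add_of_le hn
  exact orderIdeal_anti (by omega)
    (prod_pow_sub_mem_orderIdeal ha hb hab d (n := n + m) (by omega))

theorem subst_mem_orderIdeal [Finite σ] {a : σ → MvPowerSeries τ k}
    (ha : ∀ s, a s ∈ orderIdeal k τ 1) {n : ℕ} {f : MvPowerSeries σ k}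
    (hf : f ∈ orderIdeal k σ n) : subst a f ∈ orderIdeal k τ n := by
  refine subst_mem (hasSubst_of_mem ha) fun d hd => ?_
  refine orderIdeal_anti ?_ (prod_pow_mem_orderIdeal ha d)
  by_contra! h
  exact hd (hf d h)

theorem subst_C_eq {a : σ → MvPowerSeries τ k} (ha : HasSubst a) (c : k) :
    subst a (C c : MvPowerSeries σ k) = C c := by
  rw [← substAlgHom_apply ha]
  exact (substAlgHom ha).commutes c

theorem subst_sub_subst_mem_orderIdeal' [Finite σ] {a b : σ → MvPowerSeries τ k}
    (ha : ∀ s, a s ∈ orderIdeal k τ 1) (hb : ∀ s, b s ∈ orderIdeal k τ 1) {N : ℕ}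
    (hab : ∀ s, a s - b s ∈ orderIdeal k τ N) (f : MvPowerSeries σ k) :
    subst a f - subst b f ∈ orderIdeal k τ N := by
  -- The constant term cancels in the difference; removing it brings `f` to order at least one.
  have h := subst_sub_subst_mem_orderIdeal ha hb hab (n := 0) (f := f - C (constantCoeff f))
    (by simp [mem_orderIdeal_one])
  simpa [subst_sub, hasSubst_of_mem ha, hasSubst_of_mem hb, subst_C_eq] using h

/-! ### First order Taylor expansion -/

theorem pderiv_mem_orderIdeal {n : ℕ} {f : MvPowerSeries σ k} (hf : f ∈ orderIdeal k σ (n + 1))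
    (s : σ) : pderiv k s f ∈ orderIdeal k σ n := by
  intro e he
  have he' : e.degree < n := he
  rw [coeff_pderiv, hf _ (show (e + Finsupp.single s 1).degree < n + 1 by simpa using he'),
    zero_mul]

/-- Induction over polynomials: if E(p) is the error, the product rule gives E(p·X_i) = (x_i +
δ_i)E(p) + δ_i·∑ δ_s ∂_s p(x), and the last term contains only products of two increments. -/
theorem aeval_add_sub_mem [Fintype σ] {A : Type*} [CommRing A] [Algebra k A] (x δ : σ → A)
    (K : Ideal A) (hδ : ∀ i j, δ i * δ j ∈ K) (p : MvPolynomial σ k) :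
    MvPolynomial.aeval (x + δ) p - MvPolynomial.aeval x p -
      ∑ s, δ s * MvPolynomial.aeval x (MvPolynomial.pderiv s p) ∈ K := by
  classical
  induction p using MvPolynomial.induction_on with
  | C c => simp
  | add p q hp hq =>
    convert K.add_mem hp hq using 1
    simp only [map_add, mul_add, Finset.sum_add_distrib]
    ring
  | mul_X p i hp =>
    have h2 : δ i * ∑ s, δ s * MvPolynomial.aeval x (MvPolynomial.pderiv s p) ∈ K := by
      rw [Finset.mul_sum]
      refine K.sum_mem fun s _ => ?_
      rw [← mul_assoc]
      exact K.mul_mem_right _ (hδ i s)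
    convert K.add_mem (K.mul_mem_left (x i + δ i) hp) h2 using 1
    simp only [map_mul, MvPolynomial.aeval_X, Derivation.leibniz, MvPolynomial.pderiv_X, map_add,
      smul_eq_mul, Pi.add_apply, mul_add, Finset.sum_add_distrib, Pi.single_apply, apply_ite,
      map_zero, mul_one, mul_zero, Finset.sum_ite_eq, Finset.mem_univ]
    have : ∑ s, δ s * (x i * MvPolynomial.aeval x (MvPolynomial.pderiv s p)) =
      x i * ∑ s, δ s * MvPolynomial.aeval x (MvPolynomial.pderiv s p) := by
      rw [Finset.mul_sum]; exact Finset.sum_congr rfl fun _ _ => by ring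
    simp [this]
    ring

theorem exists_polynomial_sub_mem [Finite σ] (f : MvPowerSeries σ k) (n : ℕ) :
    ∃ p : MvPolynomial σ k, f - (p : MvPowerSeries σ k) ∈ orderIdeal k σ n := by
  refine ⟨truncTotal n f, fun e he => ?_⟩
  have he' : e.degree < n := he
  rw [map_sub, MvPolynomial.coeff_coe, coeff_truncTotal _ he', sub_self]

theorem subst_add_sub_mem [Fintype σ] {x δ : σ → MvPowerSeries τ k}
    (hx : ∀ s, x s ∈ orderIdeal k τ 1) (hδ : ∀ s, δ s ∈ orderIdeal k τ 1)
    {E : LowerSet (τ →₀ ℕ)} (hδE : ∀ i j, δ i * δ j ∈ coeffIdeal k E) (f : MvPowerSeries σ k) :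
    subst (x + δ) f - subst x f - ∑ s, δ s * subst x (pderiv k s f) ∈ coeffIdeal k E := by
  have hxδ : ∀ s, (x + δ) s ∈ orderIdeal k τ 1 := fun s => Ideal.add_mem _ (hx s) (hδ s)
  have sx := hasSubst_of_mem hx
  have sxδ := hasSubst_of_mem hxδ
  intro e he
  -- Differentiation lowers the order by one, so the tail must start at degree + 2 for its
  -- derivatives not to reach the coefficient at `e`.
  obtain ⟨p, hp⟩ := exists_polynomial_sub_mem f (e.degree + 2)
  obtain ⟨h, rfl⟩ : ∃ h, f = p + h := ⟨f - p, by ring⟩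
  rw [add_sub_cancel_left] at hp
  have key : subst (x + δ) (p + h : MvPowerSeries σ k) - subst x (p + h : MvPowerSeries σ k) -
      ∑ s, δ s * subst x (pderiv k s (p + h : MvPowerSeries σ k)) =
      (MvPolynomial.aeval (x + δ) p - MvPolynomial.aeval x p -
      ∑ s, δ s * MvPolynomial.aeval x (MvPolynomial.pderiv s p)) +
      (subst (x + δ) h - subst x h - ∑ s, δ s * subst x (pderiv k s h)) := by
    simp only [subst_add sx, subst_add sxδ, subst_coe, map_add, pderiv_coe, mul_add,
      Finset.sum_add_distrib]
    ring
  rw [key, map_add, aeval_add_sub_mem x δ _ hδE p e he, zero_add]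
  have h3 : subst (x + δ) h - subst x h - ∑ s, δ s * subst x (pderiv k s h) ∈
      orderIdeal k τ (e.degree + 1) :=
    Ideal.sub_mem _ (Ideal.sub_mem _ (orderIdeal_anti (by omega) (subst_mem_orderIdeal hxδ hp))
      (orderIdeal_anti (by omega) (subst_mem_orderIdeal hx hp)))
      (Ideal.sum_mem _ fun s _ => Ideal.mul_mem_left _ _
        (subst_mem_orderIdeal hx (pderiv_mem_orderIdeal hp s)))
  exact h3 e (Nat.lt_succ_self _)

/-! ### Formal inverse mapping theorem -/

theorem subst_X_eq (f : MvPowerSeries σ k) : subst (X : σ → MvPowerSeries σ k) f = f := by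
  rw [subst_self]; rfl

/-- Neumann series: with D = 1 - P^*, where P^* is substitution of P, the inverse of P^* is ∑ D^n.
It converges because P - X has order two, which makes D raise the order by one. -/
theorem exists_subst_eq_X [Finite σ] {P : σ → MvPowerSeries σ k}
    (hP : ∀ s, P s - X s ∈ orderIdeal k σ 2) :
    ∃ Q : σ → MvPowerSeries σ k, (∀ s, Q s - X s ∈ orderIdeal k σ 2) ∧
      ∀ s, subst P (Q s) = X s := by
  have hP1 : ∀ s, P s ∈ orderIdeal k σ 1 := fun s => by
    simpa using Ideal.add_mem _ (orderIdeal_anti one_le_two (hP s)) (X_mem_orderIdeal s)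
  have sP := hasSubst_of_mem hP1
  let D : MvPowerSeries σ k → MvPowerSeries σ k := fun f => f - subst P f
  have hD : ∀ n f, f ∈ orderIdeal k σ (n + 1) → D f ∈ orderIdeal k σ (n + 2) := fun n f hf => by
    have h := subst_sub_subst_mem_orderIdeal X_mem_orderIdeal hP1
      (fun s => by rw [← neg_sub]; exact (Ideal.neg_mem_iff _).2 (hP s)) hf
    rw [subst_X_eq, add_comm] at h
    exact h
  let u : σ → ℕ → MvPowerSeries σ k := fun s n => D^[n] (X s)
  have hu : ∀ s n, u s n ∈ orderIdeal k σ (n + 1) := fun s n => by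
    induction n with
    | zero => exact X_mem_orderIdeal s
    | succ n ih =>
      simp only [u, Function.iterate_succ_apply']
      exact hD n _ ih
  -- D^n X_s has order at least n + 1, so only the terms with n ≤ |e| can contribute to the
  -- coefficient at `e`.
  let Q : σ → MvPowerSeries σ k := fun s e => ∑ n ∈ Finset.range (e.degree + 1), coeff e (u s n)
  have hQ : ∀ s N, Q s - ∑ n ∈ Finset.range N, u s n ∈ orderIdeal k σ N := fun s N e he => by
    have he' : e.degree < N := he
    have h1 : coeff e (Q s) = ∑ n ∈ Finset.range (e.degree + 1), coeff e (u s n) := rfl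
    rw [map_sub, map_sum, h1, sub_eq_zero]
    refine Finset.sum_subset (Finset.range_mono he') fun n _ hn => ?_
    refine hu s n e (show e.degree < n + 1 from ?_)
    simp at hn
    omega
  refine ⟨Q, fun s => ?_, fun s => ?_⟩
  · have h1 := Ideal.add_mem _ (hQ s 2) (hu s 1)
    simpa [Finset.sum_range_succ, u, sub_add_eq_sub_sub] using h1
  · rw [← sub_eq_zero]
    refine eq_zero_of_forall_mem_orderIdeal fun N => ?_
    have h1 := subst_mem_orderIdeal hP1 (hQ s N)
    have h2 : subst P (∑ n ∈ Finset.range N, u s n) = X s - u s N := by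
      rw [← substAlgHom_apply sP, map_sum]
      have : ∀ n, substAlgHom sP (u s n) = u s n - u s (n + 1) := fun n => by
        simp only [u, Function.iterate_succ_apply', D, substAlgHom_apply]
        ring
      simp only [this]
      rw [Finset.sum_range_sub']
      rfl
    rw [subst_sub sP, h2] at h1
    convert Ideal.sub_mem _ h1 (orderIdeal_anti (Nat.le_succ N) (hu s N)) using 1
    ring

theorem exists_inverse [Finite σ] {P : σ → MvPowerSeries σ k}
    (hP : ∀ s, P s - X s ∈ orderIdeal k σ 2) :
    ∃ Q : σ → MvPowerSeries σ k, (∀ s, Q s - X s ∈ orderIdeal k σ 2) ∧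
      (∀ s, subst P (Q s) = X s) ∧ ∀ s, subst Q (P s) = X s := by
  have h1 : ∀ P : σ → MvPowerSeries σ k, (∀ s, P s - X s ∈ orderIdeal k σ 2) → HasSubst P :=
    fun P hP => hasSubst_of_mem fun s => by
      simpa using Ideal.add_mem _ (orderIdeal_anti one_le_two (hP s)) (X_mem_orderIdeal s)
  obtain ⟨Q, hQ, hPQ⟩ := exists_subst_eq_X hP
  obtain ⟨R, hR, hQR⟩ := exists_subst_eq_X hQ
  -- Substitution by P inverts substitution by Q on one side, that by Q inverts the one by R on the
  -- same side; hence R = P.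
  have hRP : R = P := by
    funext s
    have := subst_comp_subst_apply (h1 Q hQ) (h1 P hP) (R s)
    rw [hQR, subst_X (h1 P hP), funext hPQ, subst_X_eq] at this
    exact this.symm
  exact ⟨Q, hQ, hPQ, fun s => hRP ▸ hQR s⟩

end Formal

/-! ### Convergent series: weighted ℓ¹-norms. -/

section Convergent

open scoped ENNReal NNReal

variable {k : Type*} [Field k] {σ τ : Type*}

/-! ### Convergent series -/

/-- The weighted `ℓ¹`-norm `∑ |c_α| r^|α|`. -/
def absNorm (v : AbsoluteValue k ℝ) (r : ℝ≥0∞) (h : MvPowerSeries σ k) : ℝ≥0∞ :=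
  ∑' α : σ →₀ ℕ, ENNReal.ofReal (v (coeff α h)) * r ^ α.degree

variable (v : AbsoluteValue k ℝ)

theorem has_convergent_iff {h : MvPowerSeries σ k} :
    (Quality.convergent v).Has h ↔ ∃ r : ℝ≥0, 0 < r ∧ absNorm v r h ≠ ⊤ := by
  have key : ∀ r : ℝ≥0, absNorm v r h =
      ∑' α : σ →₀ ℕ, ENNReal.ofReal (v (coeff α h) * (r : ℝ) ^ α.degree) := fun r => by
    refine tsum_congr fun α => ?_
    rw [ENNReal.ofReal_mul (v.nonneg _), ENNReal.ofReal_pow (NNReal.coe_nonneg r),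
      ENNReal.ofReal_coe_nnreal]
  constructor
  · rintro ⟨s, hs, hsum⟩
    lift s to ℝ≥0 using hs.le
    refine ⟨s, hs, ?_⟩
    rw [key]
    exact hsum.tsum_ofReal_ne_top
  · rintro ⟨r, hr, hsum⟩
    refine ⟨r, hr, ?_⟩
    rw [key] at hsum
    refine (ENNReal.summable_toReal hsum).congr fun α => ?_
    exact ENNReal.toReal_ofReal (mul_nonneg (v.nonneg _) (pow_nonneg (NNReal.coe_nonneg r) _))

theorem absNorm_mono_left {r s : ℝ≥0∞} (hrs : r ≤ s) (h : MvPowerSeries σ k) :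
    absNorm v r h ≤ absNorm v s h :=
  ENNReal.tsum_le_tsum fun α => by gcongr

theorem ofReal_add_le (x y : k) :
    ENNReal.ofReal (v (x + y)) ≤ ENNReal.ofReal (v x) + ENNReal.ofReal (v y) := by
  rw [← ENNReal.ofReal_add (v.nonneg _) (v.nonneg _)]
  exact ENNReal.ofReal_le_ofReal (v.add_le x y)

theorem ofReal_sum_le {ι : Type*} (s : Finset ι) (f : ι → k) :
    ENNReal.ofReal (v (∑ i ∈ s, f i)) ≤ ∑ i ∈ s, ENNReal.ofReal (v (f i)) := by
  classical
  induction s using Finset.induction_on with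
  | empty => simp
  | insert a s ha ih =>
    rw [Finset.sum_insert ha, Finset.sum_insert ha]
    exact (ofReal_add_le v _ _).trans (by gcongr)

theorem absNorm_add_le (r : ℝ≥0∞) (f g : MvPowerSeries σ k) :
    absNorm v r (f + g) ≤ absNorm v r f + absNorm v r g := by
  rw [absNorm, absNorm, absNorm, ← ENNReal.tsum_add]
  refine ENNReal.tsum_le_tsum fun α => ?_
  rw [← add_mul, map_add]
  gcongr
  exact ofReal_add_le v _ _

theorem absNorm_neg (r : ℝ≥0∞) (f : MvPowerSeries σ k) :
    absNorm v r (-f) = absNorm v r f := by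
  simp [absNorm]

theorem absNorm_sub_le (r : ℝ≥0∞) (f g : MvPowerSeries σ k) :
    absNorm v r (f - g) ≤ absNorm v r f + absNorm v r g := by
  rw [sub_eq_add_neg, ← absNorm_neg v r g]
  exact absNorm_add_le v r f (-g)

theorem absNorm_monomial (r : ℝ≥0∞) (d : σ →₀ ℕ) (c : k) :
    absNorm v r (monomial d c) = ENNReal.ofReal (v c) * r ^ d.degree := by
  classical
  rw [absNorm, tsum_eq_single d]
  · rw [coeff_monomial_same]
  · intro e he
    rw [coeff_monomial_ne he]
    simp

theorem absNorm_mul_le (r : ℝ≥0∞) (f g : MvPowerSeries σ k) :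
    absNorm v r (f * g) ≤ absNorm v r f * absNorm v r g := by
  classical
  let F : (σ →₀ ℕ) → ℝ≥0∞ := fun α => ENNReal.ofReal (v (coeff α f)) * r ^ α.degree
  let G : (σ →₀ ℕ) → ℝ≥0∞ := fun α => ENNReal.ofReal (v (coeff α g)) * r ^ α.degree
  calc absNorm v r (f * g)
      ≤ ∑' e : σ →₀ ℕ, ∑ x ∈ Finset.HasAntidiagonal.antidiagonal e, F x.1 * G x.2 := by
        refine ENNReal.tsum_le_tsum fun e => ?_
        rw [coeff_mul]
        refine (mul_le_mul_left (ofReal_sum_le v _ _) _).trans ?_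
        rw [Finset.sum_mul]
        refine Finset.sum_le_sum fun x hx => ?_
        rw [← Finset.HasAntidiagonal.mem_antidiagonal.1 hx, map_mul,
          ENNReal.ofReal_mul (v.nonneg _), map_add, pow_add]
        exact le_of_eq (by ring)
    _ = ∑' x : (σ →₀ ℕ) × (σ →₀ ℕ), F x.1 * G x.2 := by
        rw [← Finset.HasAntidiagonal.sigmaAntidiagonalEquivProd.tsum_eq, ENNReal.tsum_sigma']
        refine tsum_congr fun e => ?_
        rw [tsum_fintype, ← Finset.sum_coe_sort]
        rfl
    _ = absNorm v r f * absNorm v r g := by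
        rw [ENNReal.tsum_prod']
        simp_rw [ENNReal.tsum_mul_left, ENNReal.tsum_mul_right]
        rfl

theorem absNorm_prod_pow_le {r R : ℝ≥0∞} {a : σ → MvPowerSeries τ k}
    (ha : ∀ s, absNorm v r (a s) ≤ R) (d : σ →₀ ℕ) :
    absNorm v r (d.prod fun s e => a s ^ e) ≤ R ^ d.degree := by
  induction hn : d.degree generalizing d with
  | zero =>
    rw [Finsupp.degree_eq_zero_iff] at hn
    subst hn
    rw [Finsupp.prod_zero_index, ← monomial_zero_one, absNorm_monomial]
    simp
  | succ n ih =>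
    obtain ⟨s, d', rfl, hd'⟩ := exists_single_add hn
    rw [prod_single_add, pow_succ']
    exact (absNorm_mul_le v r _ _).trans (mul_le_mul' (ha s) (ih d' hd'))

/-- Submultiplicativity bounds a monomial of degree |d| in the `a s` by R^|d|; exchanging the two
sums is free in [0,∞]. -/
theorem absNorm_subst_le {r R : ℝ≥0∞} {a : σ → MvPowerSeries τ k} (ha : HasSubst a)
    (har : ∀ s, absNorm v r (a s) ≤ R) (f : MvPowerSeries σ k) :
    absNorm v r (subst a f) ≤ absNorm v R f := by
  have h1 : ∀ e, ENNReal.ofReal (v (coeff e (subst a f))) ≤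
      ∑' d : σ →₀ ℕ, ENNReal.ofReal (v (coeff d f)) *
        ENNReal.ofReal (v (coeff e (d.prod fun s e => a s ^ e))) := fun e => by
    rw [coeff_subst ha, finsum_eq_sum _ (coeff_subst_finite ha f e)]
    refine (ofReal_sum_le v _ _).trans ((Finset.sum_le_sum fun d _ => ?_).trans
      (ENNReal.sum_le_tsum _))
    rw [smul_eq_mul, map_mul, ENNReal.ofReal_mul (v.nonneg _)]
  calc absNorm v r (subst a f)
      ≤ ∑' e : τ →₀ ℕ, ∑' d : σ →₀ ℕ, ENNReal.ofReal (v (coeff d f)) *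
        (ENNReal.ofReal (v (coeff e (d.prod fun s e => a s ^ e))) * r ^ e.degree) := by
        refine ENNReal.tsum_le_tsum fun e => ?_
        simp_rw [← mul_assoc]
        rw [ENNReal.tsum_mul_right]
        exact mul_le_mul_left (h1 e) _
    _ = ∑' d : σ →₀ ℕ, ENNReal.ofReal (v (coeff d f)) *
          absNorm v r (d.prod fun s e => a s ^ e) := by
        rw [ENNReal.tsum_comm]
        simp_rw [ENNReal.tsum_mul_left]
        rfl
    _ ≤ absNorm v R f :=
        ENNReal.tsum_le_tsum fun d => mul_le_mul_right (absNorm_prod_pow_le v har d) _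

theorem absNorm_mul_le_of_mem {c r : ℝ≥0∞} (hc : c ≤ 1) {n : ℕ} {h : MvPowerSeries σ k}
    (hh : h ∈ orderIdeal k σ n) : absNorm v (c * r) h ≤ c ^ n * absNorm v r h := by
  rw [absNorm, absNorm, ← ENNReal.tsum_mul_left]
  refine ENNReal.tsum_le_tsum fun α => ?_
  rcases lt_or_ge α.degree n with h1 | h1
  · rw [hh α h1]; simp
  · rw [mul_pow, mul_left_comm]
    exact mul_le_mul_left (pow_le_pow_right_of_le_one' hc h1) _

theorem absNorm_truncTotal_le [Finite σ] (r : ℝ≥0∞) (n : ℕ) (h : MvPowerSeries σ k) :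
    absNorm v r (truncTotal n h : MvPowerSeries σ k) ≤ absNorm v r h := by
  refine ENNReal.tsum_le_tsum fun α => ?_
  rw [MvPolynomial.coeff_coe, coeff_truncTotal_eq_ite]
  split_ifs <;> simp

/-- Every finite partial sum of the norm already occurs in some truncation, so a bound uniform in
the truncation passes to the series. -/
theorem absNorm_le_of_truncTotal_le [Finite σ] {r C : ℝ≥0∞} {h : MvPowerSeries σ k}
    (hC : ∀ n, absNorm v r (truncTotal n h : MvPowerSeries σ k) ≤ C) : absNorm v r h ≤ C := by
  rw [absNorm, ENNReal.tsum_eq_iSup_sum]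
  refine iSup_le fun s => ?_
  refine le_trans (le_of_eq ?_) ((ENNReal.sum_le_tsum s).trans
    (hC ((s.sup fun α => α.degree) + 1)))
  refine Finset.sum_congr rfl fun α hα => ?_
  rw [MvPolynomial.coeff_coe, coeff_truncTotal _
    (Nat.lt_succ_of_le (Finset.le_sup (f := fun α : σ →₀ ℕ => α.degree) hα))]

theorem exists_common_radius [Finite σ] {a : σ → MvPowerSeries τ k}
    (ha : ∀ s, (Quality.convergent v).Has (a s)) :
    ∃ r : ℝ≥0, 0 < r ∧ ∃ C : ℝ≥0, ∀ s, absNorm v r (a s) ≤ C := by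
  classical
  have := Fintype.ofFinite σ
  choose R hR hRa using fun s => (has_convergent_iff v).1 (ha s)
  obtain ⟨r, hr, hrR⟩ : ∃ r : ℝ≥0, 0 < r ∧ ∀ s, r ≤ R s := by
    rcases isEmpty_or_nonempty σ with h | h
    · exact ⟨1, one_pos, fun s => h.elim s⟩
    · refine ⟨Finset.univ.inf' Finset.univ_nonempty R, ?_, fun s =>
        Finset.inf'_le _ (Finset.mem_univ s)⟩
      rw [Finset.lt_inf'_iff]
      exact fun s _ => hR s
  refine ⟨r, hr, ∑ s, (absNorm v (R s) (a s)).toNNReal, fun s => ?_⟩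
  refine (absNorm_mono_left v (ENNReal.coe_le_coe.2 (hrR s)) _).trans ?_
  rw [← ENNReal.coe_toNNReal (hRa s), ENNReal.coe_le_coe]
  exact Finset.single_le_sum (f := fun s => (absNorm v (R s) (a s)).toNNReal)
    (fun _ _ => zero_le) (Finset.mem_univ s)

theorem exists_absNorm_le [Finite σ] {a : σ → MvPowerSeries τ k}
    (ha : ∀ s, (Quality.convergent v).Has (a s)) {n : ℕ}
    (ha1 : ∀ s, a s ∈ orderIdeal k τ (n + 1)) {ε : ℝ≥0} (hε : 0 < ε) :
    ∃ r : ℝ≥0, 0 < r ∧ ∀ s, absNorm v r (a s) ≤ ε * r ^ n := by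
  obtain ⟨r, hr, C, hC⟩ := exists_common_radius v ha
  have hC1 : 0 < C + 1 := by positivity
  -- Scaling the radius by c ≤ 1 multiplies the norm by at most c^{n+1}, while the target ε·(c r)^n
  -- shrinks only by c^n. It remains to have c·C ≤ ε·r^n; `C + 1` avoids division by zero.
  let c : ℝ≥0 := min 1 (ε * r ^ n / (C + 1))
  have hc : 0 < c := lt_min one_pos (by positivity)
  refine ⟨c * r, mul_pos hc hr, fun s => ?_⟩
  rw [ENNReal.coe_mul]
  refine (absNorm_mul_le_of_mem v (ENNReal.coe_le_one_iff.2 (min_le_left _ _)) (ha1 s)).trans ?_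
  refine (mul_le_mul_right (hC s) _).trans ?_
  norm_cast
  rw [mul_pow, pow_succ, mul_assoc, mul_left_comm ε]
  refine mul_le_mul_right ?_ _
  calc c * C ≤ c * (C + 1) := by gcongr; exact le_self_add
    _ ≤ ε * r ^ n / (C + 1) * (C + 1) := by gcongr; exact min_le_right _ _
    _ = ε * r ^ n := by field_simp

theorem has_convergent_subst [Finite σ] {a : σ → MvPowerSeries τ k}
    (ha : ∀ s, (Quality.convergent v).Has (a s)) (ha1 : ∀ s, a s ∈ orderIdeal k τ 1)
    {f : MvPowerSeries σ k} (hf : (Quality.convergent v).Has f) :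
    (Quality.convergent v).Has (subst a f) := by
  obtain ⟨R, hR, hRf⟩ := (has_convergent_iff v).1 hf
  obtain ⟨r, hr, hra⟩ := exists_absNorm_le v ha (n := 0) ha1 hR
  refine (has_convergent_iff v).2 ⟨r, hr, ne_top_of_le_ne_top hRf ?_⟩
  exact absNorm_subst_le v (hasSubst_of_mem ha1) (fun s => by simpa using hra s) f

theorem has_convergent_X (s : σ) : (Quality.convergent v).Has (X s : MvPowerSeries σ k) := by
  refine (has_convergent_iff v).2 ⟨1, one_pos, ?_⟩
  rw [X, absNorm_monomial]
  simp

theorem has_convergent_C (c : k) : (Quality.convergent v).Has (C c : MvPowerSeries σ k) := by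
  refine (has_convergent_iff v).2 ⟨1, one_pos, ?_⟩
  rw [← monomial_zero_eq_C_apply, absNorm_monomial]
  simp

theorem exists_radius_two {f g : MvPowerSeries σ k} (hf : (Quality.convergent v).Has f)
    (hg : (Quality.convergent v).Has g) :
    ∃ r : ℝ≥0, 0 < r ∧ absNorm v r f ≠ ⊤ ∧ absNorm v r g ≠ ⊤ := by
  obtain ⟨r, hr, hrf⟩ := (has_convergent_iff v).1 hf
  obtain ⟨s, hs, hsg⟩ := (has_convergent_iff v).1 hg
  exact ⟨min r s, lt_min hr hs,
    ne_top_of_le_ne_top hrf (absNorm_mono_left v (ENNReal.coe_le_coe.2 (min_le_left r s)) _),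
    ne_top_of_le_ne_top hsg (absNorm_mono_left v (ENNReal.coe_le_coe.2 (min_le_right r s)) _)⟩

theorem has_convergent_add {f g : MvPowerSeries σ k} (hf : (Quality.convergent v).Has f)
    (hg : (Quality.convergent v).Has g) : (Quality.convergent v).Has (f + g) := by
  obtain ⟨r, hr, h1, h2⟩ := exists_radius_two v hf hg
  exact (has_convergent_iff v).2 ⟨r, hr,
    ne_top_of_le_ne_top (ENNReal.add_ne_top.2 ⟨h1, h2⟩) (absNorm_add_le v r f g)⟩

theorem has_convergent_mul {f g : MvPowerSeries σ k} (hf : (Quality.convergent v).Has f)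
    (hg : (Quality.convergent v).Has g) : (Quality.convergent v).Has (f * g) := by
  obtain ⟨r, hr, h1, h2⟩ := exists_radius_two v hf hg
  exact (has_convergent_iff v).2 ⟨r, hr,
    ne_top_of_le_ne_top (ENNReal.mul_ne_top h1 h2) (absNorm_mul_le v r f g)⟩

theorem has_convergent_of_X_mul {s : σ} {h : MvPowerSeries σ k}
    (hh : (Quality.convergent v).Has (X s * h)) : (Quality.convergent v).Has h := by
  obtain ⟨r, hr, hrh⟩ := (has_convergent_iff v).1 hh
  refine (has_convergent_iff v).2 ⟨r, hr, fun htop => hrh ?_⟩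
  rw [eq_top_iff]
  have h0 : (r : ℝ≥0∞) * absNorm v r h = ⊤ := by
    rw [htop, ENNReal.mul_top]
    simpa using hr.ne'
  -- Multiplication by the variable shifts exponents by one, so r‖h‖ is a partial sum of ‖X h‖.
  rw [← h0, absNorm, ← ENNReal.tsum_mul_left]
  refine le_trans (ENNReal.tsum_le_tsum fun α => ?_) (ENNReal.tsum_comp_le_tsum_of_injective
    (add_right_injective (Finsupp.single s 1)) _)
  rw [X, coeff_add_monomial_mul, map_add, Finsupp.degree_single, pow_add, one_mul, pow_one]
  exact le_of_eq (by ring)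

/-- The inverse of a convergent coordinate change is convergent. -/
theorem has_convergent_of_inverse [Finite σ] {P Q : σ → MvPowerSeries σ k}
    (hP : ∀ s, P s - X s ∈ orderIdeal k σ 2) (hQ : ∀ s, Q s - X s ∈ orderIdeal k σ 2)
    (hQP : ∀ s, subst Q (P s) = X s) (hPc : ∀ s, (Quality.convergent v).Has (P s - X s)) (s : σ) :
    (Quality.convergent v).Has (Q s) := by
  obtain ⟨R, hR, hRP⟩ := exists_absNorm_le v hPc (n := 1) hP (ε := 1 / 2) (by norm_num)
  have hQ1 : ∀ s, Q s ∈ orderIdeal k σ 1 := fun s => by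
    simpa using Ideal.add_mem _ (orderIdeal_anti one_le_two (hQ s)) (X_mem_orderIdeal s)
  have sQ := hasSubst_of_mem hQ1
  have hR2 : ((R / 2 : ℝ≥0) : ℝ≥0∞) + (R / 2 : ℝ≥0) = R := by
    rw [← ENNReal.coe_add, add_halves]
  -- Q solves Q = X - (P - X)(Q). As P - X has order two, the part of the right side in degrees
  -- below N + 1 depends only on the part of Q in degrees below N. At radius R/2 the truncations
  -- thus stay bounded by R: one half comes from X, the other from ‖P - X‖_R ≤ R/2.
  have key : ∀ N s, absNorm v (R / 2 : ℝ≥0) (truncTotal N (Q s) : MvPowerSeries σ k) ≤ R := by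
    intro N
    induction N with
    | zero =>
      intro s
      have : ((truncTotal 0 (Q s) : MvPolynomial σ k) : MvPowerSeries σ k) = 0 := by
        ext e
        rw [MvPolynomial.coeff_coe, coeff_truncTotal_eq_zero _ (Nat.zero_le _), map_zero]
      rw [this]
      simp [absNorm]
    | succ N ih =>
      intro s
      let T : σ → MvPowerSeries σ k := fun s => (truncTotal N (Q s) : MvPolynomial σ k)
      have hT1 : ∀ s, T s ∈ orderIdeal k σ 1 := fun s e he => by
        simp only [T]
        rw [MvPolynomial.coeff_coe, coeff_truncTotal_eq_ite, hQ1 s e he, ite_self]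
      have hQT : ∀ s, Q s - T s ∈ orderIdeal k σ N := fun s e he => by
        simp only [T]
        rw [map_sub, MvPolynomial.coeff_coe, coeff_truncTotal _ he, sub_self]
      have h1 := subst_sub_subst_mem_orderIdeal hQ1 hT1 hQT (n := 1) (hP s)
      have h2 : Q s = X s - subst Q (P s - X s) := by
        rw [subst_sub sQ, hQP, subst_X sQ, sub_sub_cancel]
      have h3 : truncTotal (N + 1) (Q s) = truncTotal (N + 1) (X s - subst T (P s - X s)) := by
        ext e
        rw [coeff_truncTotal_eq_ite, coeff_truncTotal_eq_ite]
        split_ifs with he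
        · have := h1 e he
          rw [map_sub, sub_eq_zero] at this
          rw [h2, map_sub, map_sub, this]
        · rfl
      rw [h3]
      refine (absNorm_truncTotal_le v _ _ _).trans ((absNorm_sub_le v _ _ _).trans ?_)
      rw [← hR2]
      refine add_le_add ?_ ?_
      · rw [X, absNorm_monomial]
        simp
      · refine (absNorm_subst_le v (hasSubst_of_mem hT1) ih _).trans ((hRP s).trans (le_of_eq ?_))
        norm_cast
        rw [pow_one, div_mul_eq_mul_div, one_mul]
  exact (has_convergent_iff v).2 ⟨R / 2, by positivity,
    ne_top_of_le_ne_top ENNReal.coe_ne_top (absNorm_le_of_truncTotal_le v fun n => key n s)⟩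

variable (k) in
/-- The geometric series `∑ t^n`. -/
def geomSeries : MvPowerSeries Unit k := fun _ => 1

theorem has_convergent_geom : (Quality.convergent v).Has (geomSeries k) := by
  refine (has_convergent_iff v).2 ⟨1 / 2, by norm_num, ?_⟩
  let e : ℕ ≃ (Unit →₀ ℕ) :=
    { toFun := Finsupp.single ()
      invFun := fun f => f ()
      left_inv := fun n => by simp
      right_inv := fun f => by ext; simp }
  have he : ∀ n, (e n).degree = n := fun n => by
    simp [e]
  have : absNorm v ((1 / 2 : ℝ≥0) : ℝ≥0∞) (geomSeries k) =
      ∑' n : ℕ, ((1 / 2 : ℝ≥0) : ℝ≥0∞) ^ n := by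
    unfold absNorm
    rw [← e.tsum_eq]
    refine tsum_congr fun n => ?_
    rw [he]
    change ENNReal.ofReal (v 1) * _ = _
    rw [map_one, ENNReal.ofReal_one, one_mul]
  rw [this, ENNReal.tsum_geometric]
  simp

end Convergent

/-! ### Algebraic series: specialization, substitution, transcendence bases. -/

section Algebraic

variable {k : Type*} [Field k] {σ τ : Type*}

/-! ### Algebraic series -/

theorem algebraMap_eq_coe (p : MvPolynomial σ k) :
    algebraMap (MvPolynomial σ k) (MvPowerSeries σ k) p = p := by
  rw [algebraMap_apply', Algebra.algebraMap_self, map_id, RingHom.id_apply]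

instance : IsScalarTower k (MvPolynomial σ k) (MvPowerSeries σ k) :=
  IsScalarTower.of_algebraMap_eq fun c => by
    rw [algebraMap_eq_coe, MvPolynomial.algebraMap_eq, MvPolynomial.coe_C]
    rfl

theorem isAlgebraic_coe (p : MvPolynomial σ k) :
    IsAlgebraic (MvPolynomial σ k) (p : MvPowerSeries σ k) := by
  rw [← algebraMap_eq_coe]
  exact isAlgebraic_algebraMap p

theorem isAlgebraic_X (s : σ) : IsAlgebraic (MvPolynomial σ k) (X s : MvPowerSeries σ k) := by
  rw [← MvPolynomial.coe_X]
  exact isAlgebraic_coe _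

theorem X_series_ne_zero (s : σ) : (X s : MvPowerSeries σ k) ≠ 0 := fun h => by
  have := congrArg (coeff (Finsupp.single s 1)) h
  simp at this

theorem isAlgebraic_of_mul {f h : MvPowerSeries σ k} (hf0 : f ≠ 0)
    (hf : IsAlgebraic (MvPolynomial σ k) f) (hfh : IsAlgebraic (MvPolynomial σ k) (f * h)) :
    IsAlgebraic (MvPolynomial σ k) h :=
  IsAlgebraic.of_mul (mem_nonZeroDivisors_of_ne_zero hf0) hf hfh

theorem isAlgebraic_rename [Finite σ] {e : σ → τ} (he : Function.Injective e)
    {f : MvPowerSeries σ k} (hf : IsAlgebraic (MvPolynomial σ k) f) :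
    IsAlgebraic (MvPolynomial τ k) (subst (fun s => (X (e s) : MvPowerSeries τ k)) f) := by
  have sX : HasSubst (fun s => (X (e s) : MvPowerSeries τ k)) :=
    hasSubst_of_mem fun s => X_mem_orderIdeal (e s)
  rw [← substAlgHom_apply sX]
  refine hf.ringHom_of_comp_eq (MvPolynomial.rename e : MvPolynomial σ k →ₐ[k] _) (substAlgHom sX)
    (MvPolynomial.rename_injective e he) (RingHom.ext fun p => ?_)
  simp only [RingHom.comp_apply, RingHom.coe_coe, algebraMap_eq_coe]
  rw [substAlgHom_coe sX]
  induction p using MvPolynomial.induction_on with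
  | C c => simp [MvPowerSeries.algebraMap_apply]
  | add p q hp hq => simp [hp, hq]
  | mul_X p i hp => simp [hp]

theorem X_dvd_sub_aeval (p : MvPolynomial (Option τ) k) :
    (MvPolynomial.X none : MvPolynomial (Option τ) k) ∣ p - MvPolynomial.rename some
      (MvPolynomial.aeval (fun o : Option τ => o.elim 0 MvPolynomial.X) p) := by
  induction p using MvPolynomial.induction_on with
  | C c => simp
  | add p q hp hq =>
    convert dvd_add hp hq using 1
    simp only [map_add]
    ring
  | mul_X p i hp =>
    cases i with
    | none => simp
    | some i =>
      convert hp.mul_right (MvPolynomial.X (some i)) using 1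
      simp only [map_mul, MvPolynomial.aeval_X, Option.elim_some, MvPolynomial.rename_X]
      ring

/-- Setting a variable to zero could annihilate the polynomial relation. The highest power of that
variable dividing the relation is cancelled beforehand; what remains is not divisible by it and
specializes to a nonzero relation. -/
theorem isAlgebraic_subst_none_zero [Finite τ] {h : MvPowerSeries (Option τ) k}
    (hh : IsAlgebraic (MvPolynomial (Option τ) k) h) :
    IsAlgebraic (MvPolynomial τ k)
      (subst (fun o : Option τ => o.elim (0 : MvPowerSeries τ k) X) h) := by
  have sz : HasSubst (fun o : Option τ => o.elim (0 : MvPowerSeries τ k) X) :=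
    hasSubst_of_mem fun o => by
      cases o with
      | none => exact Ideal.zero_mem _
      | some t => exact X_mem_orderIdeal t
  let π : MvPolynomial (Option τ) k →ₐ[k] MvPolynomial τ k :=
    MvPolynomial.aeval (fun o : Option τ => o.elim 0 MvPolynomial.X)
  obtain ⟨P, hP0, hP⟩ := hh
  let x : Polynomial (MvPolynomial (Option τ) k) := Polynomial.C (MvPolynomial.X none)
  have hx : FiniteMultiplicity x P := by
    refine FiniteMultiplicity.of_not_isUnit (fun h => ?_) hP0
    have := (Polynomial.isUnit_C.1 h).map π
    simp [π] at this
  obtain ⟨P', hPP', hxP'⟩ := hx.exists_eq_pow_mul_and_not_dvd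
  have hP' : Polynomial.aeval h P' = 0 := by
    rw [hPP', map_mul, map_pow, Polynomial.aeval_C, algebraMap_eq_coe, MvPolynomial.coe_X] at hP
    exact (mul_eq_zero.1 hP).resolve_left (pow_ne_zero _ (X_series_ne_zero none))
  refine ⟨P'.map (π : MvPolynomial (Option τ) k →+* _), fun h0 => hxP' ?_, ?_⟩
  · rw [Polynomial.C_dvd_iff_dvd_coeff]
    intro i
    have h1 := X_dvd_sub_aeval (P'.coeff i)
    have h2 : π (P'.coeff i) = 0 := by
      have := congrArg (fun q => Polynomial.coeff q i) h0
      simpa [Polynomial.coeff_map] using this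
    change _ ∣ _ - MvPolynomial.rename some (π (P'.coeff i)) at h1
    rwa [h2, map_zero, sub_zero] at h1
  · rw [← substAlgHom_apply sz]
    have hc : RingHom.comp (algebraMap (MvPolynomial τ k) (MvPowerSeries τ k))
        (π : MvPolynomial (Option τ) k →+* _) =
        RingHom.comp (substAlgHom (R := k) sz : MvPowerSeries (Option τ) k →+* MvPowerSeries τ k)
          (algebraMap _ _) := by
      refine RingHom.ext fun p => ?_
      simp only [RingHom.comp_apply, RingHom.coe_coe, algebraMap_eq_coe]
      rw [substAlgHom_coe sz]
      induction p using MvPolynomial.induction_on with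
      | C c => simp [MvPowerSeries.algebraMap_apply]
      | add p q hp hq => simp [hp, hq]
      | mul_X p i hp =>
        have hπ : (π (MvPolynomial.X i) : MvPowerSeries τ k) = i.elim 0 X := by
          simp only [π, MvPolynomial.aeval_X]
          cases i <;> simp
        rw [map_mul, MvPolynomial.coe_mul, hp, hπ, map_mul, MvPolynomial.aeval_X]
    have := Polynomial.map_aeval_eq_aeval_map hc P' h
    rw [hP', map_zero] at this
    exact this.symm

theorem isAlgebraic_subst_inl_zero [Finite σ] [Finite τ] {h : MvPowerSeries (σ ⊕ τ) k}
    (hh : IsAlgebraic (MvPolynomial (σ ⊕ τ) k) h) :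
    IsAlgebraic (MvPolynomial τ k)
      (subst (Sum.elim (fun _ => 0) X : σ ⊕ τ → MvPowerSeries τ k) h) := by
  have sz : ∀ σ' : Type _, [Finite σ'] →
      HasSubst (Sum.elim (fun _ => 0) X : σ' ⊕ τ → MvPowerSeries τ k) := fun σ' _ =>
    hasSubst_of_mem fun o => by
      cases o with
      | inl s => exact Ideal.zero_mem _
      | inr t => exact X_mem_orderIdeal t
  revert h
  -- The variables are set to zero one at a time; the three goals are transport along a bijection,
  -- no variable, and one more variable.
  refine Finite.induction_empty_option (P := fun σ' => Finite σ' →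
    ∀ {h : MvPowerSeries (σ' ⊕ τ) k}, IsAlgebraic (MvPolynomial (σ' ⊕ τ) k) h →
    IsAlgebraic (MvPolynomial τ k)
      (subst (Sum.elim (fun _ => 0) X : σ' ⊕ τ → MvPowerSeries τ k) h)) ?_ ?_ ?_ σ ‹_›
  · intro α β e ih hβ h hh
    have hα : Finite α := Finite.of_equiv β e.symm
    have h1 := ih hα (isAlgebraic_rename (Equiv.sumCongr e (Equiv.refl τ)).symm.injective hh)
    rw [subst_comp_subst_apply (hasSubst_of_mem fun s => X_mem_orderIdeal _) (sz α)] at h1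
    convert h1 using 2
    funext o
    rw [subst_X (sz α)]
    cases o <;> simp
  · intro _ h hh
    have h1 := isAlgebraic_rename (Equiv.emptySum PEmpty τ).injective hh
    convert h1 using 2
    funext o
    cases o with
    | inl s => exact s.elim
    | inr t => simp
  · intro α _ ih hα' h hh
    have hα : Finite α := inferInstance
    let e : Option α ⊕ τ → Option (α ⊕ τ) := Sum.elim (Option.map Sum.inl) (some ∘ Sum.inr)
    have he : Function.Injective e := by
      rintro ((_ | a) | t) ((_ | b) | s) hab <;> simp_all [e]
    have h1 := ih hα (isAlgebraic_subst_none_zero (isAlgebraic_rename he hh))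
    have sz' : HasSubst
        (fun o : Option (α ⊕ τ) => o.elim (0 : MvPowerSeries (α ⊕ τ) k) X) :=
      hasSubst_of_mem fun o => by
        cases o with
        | none => exact Ideal.zero_mem _
        | some t => exact X_mem_orderIdeal t
    have sX : HasSubst (fun s => (X (e s) : MvPowerSeries (Option (α ⊕ τ)) k)) :=
      hasSubst_of_mem fun s => X_mem_orderIdeal _
    have sY : HasSubst (fun s => subst (fun o : Option (α ⊕ τ) =>
        o.elim (0 : MvPowerSeries (α ⊕ τ) k) X) (X (e s) : MvPowerSeries (Option (α ⊕ τ)) k)) :=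
      by simpa only [substAlgHom_apply] using sX.comp sz'
    rw [subst_comp_subst_apply sX sz', subst_comp_subst_apply sY (sz α)] at h1
    convert h1 using 2
    funext o
    rw [subst_X sz']
    rcases o with (_ | a) | t
    · simp only [Sum.elim_inl, e, Option.map_none, Option.elim_none]
      rw [← substAlgHom_apply (sz α), map_zero]
    · simp only [Sum.elim_inl, e, Option.map_some, Option.elim_some]
      rw [subst_X (sz α), Sum.elim_inl]
    · simp only [Sum.elim_inr, e, Function.comp, Option.elim_some]
      rw [subst_X (sz α), Sum.elim_inr]

/-- Injectivity on polynomials keeps the relation for `f` nonzero. Its coefficients become algebraic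
series, and algebraicity is transitive. -/
theorem isAlgebraic_of_aeval_injective {x : σ → MvPowerSeries τ k}
    (hx : ∀ s, IsAlgebraic (MvPolynomial τ k) (x s))
    (hinj : Function.Injective (MvPolynomial.aeval x : MvPolynomial σ k →ₐ[k] MvPowerSeries τ k))
    (g : MvPowerSeries σ k →+* MvPowerSeries τ k)
    (hg : ∀ p : MvPolynomial σ k, g p = MvPolynomial.aeval x p)
    {f : MvPowerSeries σ k} (hf : IsAlgebraic (MvPolynomial σ k) f) :
    IsAlgebraic (MvPolynomial τ k) (g f) := by
  let A := Subalgebra.algebraicClosure (MvPolynomial τ k) (MvPowerSeries τ k)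
  let φ : MvPolynomial σ k →+* A :=
    (MvPolynomial.aeval x : MvPolynomial σ k →ₐ[k] MvPowerSeries τ k).toRingHom.codRestrict
      A.toSubring fun p => by
        induction p using MvPolynomial.induction_on with
        | C c =>
          have h := isAlgebraic_coe (MvPolynomial.C c : MvPolynomial τ k)
          rw [MvPolynomial.coe_C] at h
          change IsAlgebraic _ (MvPolynomial.aeval x (MvPolynomial.C c))
          rw [MvPolynomial.aeval_C]
          exact h
        | add p q hp hq => rw [map_add]; exact add_mem hp hq
        | mul_X p i hp =>
          rw [map_mul]
          refine mul_mem hp ?_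
          change IsAlgebraic _ (MvPolynomial.aeval x (MvPolynomial.X i))
          rw [MvPolynomial.aeval_X]
          exact hx i
  have hφ : Function.Injective φ := fun p q h => hinj (congrArg Subtype.val h)
  have hc : RingHom.comp (algebraMap A (MvPowerSeries τ k)) φ =
      RingHom.comp g (algebraMap (MvPolynomial σ k) (MvPowerSeries σ k)) :=
    RingHom.ext fun p => by
      rw [RingHom.comp_apply, RingHom.comp_apply, algebraMap_eq_coe, hg]
      rfl
  have hfA : IsAlgebraic A (g f) := hf.ringHom_of_comp_eq φ g hφ hc
  exact hfA.restrictScalars (MvPolynomial τ k)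

/-- The series `a s` may be algebraically dependent, and substituting them could annihilate a
relation for `f`. Adding a fresh variable to each makes them independent; the fresh variables are
set to zero at the end. -/
theorem isAlgebraic_subst [Finite σ] [Finite τ] {a : σ → MvPowerSeries τ k}
    (ha : ∀ s, IsAlgebraic (MvPolynomial τ k) (a s)) (ha1 : ∀ s, a s ∈ orderIdeal k τ 1)
    {f : MvPowerSeries σ k} (hf : IsAlgebraic (MvPolynomial σ k) f) :
    IsAlgebraic (MvPolynomial τ k) (subst a f) := by
  let x : σ → MvPowerSeries (σ ⊕ τ) k := fun s =>
    X (Sum.inl s) + subst (fun t => X (Sum.inr t)) (a s)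
  have sr : HasSubst (fun t : τ => (X (Sum.inr t) : MvPowerSeries (σ ⊕ τ) k)) :=
    hasSubst_of_mem fun s => X_mem_orderIdeal _
  have hx1 : ∀ s, x s ∈ orderIdeal k (σ ⊕ τ) 1 := fun s =>
    Ideal.add_mem _ (X_mem_orderIdeal _)
      (subst_mem_orderIdeal (fun t => X_mem_orderIdeal _) (ha1 s))
  have sx := hasSubst_of_mem hx1
  have sl : HasSubst (Sum.elim X (fun _ => 0) : σ ⊕ τ → MvPowerSeries σ k) :=
    hasSubst_of_mem fun o => by
      cases o with
      | inl s => exact X_mem_orderIdeal s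
      | inr t => exact Ideal.zero_mem _
  have sz : HasSubst (Sum.elim (fun _ => 0) X : σ ⊕ τ → MvPowerSeries τ k) :=
    hasSubst_of_mem fun o => by
      cases o with
      | inl s => exact Ideal.zero_mem _
      | inr t => exact X_mem_orderIdeal t
  have hxA : ∀ s, IsAlgebraic (MvPolynomial (σ ⊕ τ) k) (x s) := fun s => by
    have h1 := isAlgebraic_X (k := k) (Sum.inl s : σ ⊕ τ)
    have h2 := isAlgebraic_rename (Sum.inr_injective (α := σ)) (ha s)
    exact h1.add h2
  have hinj : Function.Injective
      (MvPolynomial.aeval x : MvPolynomial σ k →ₐ[k] MvPowerSeries (σ ⊕ τ) k) := by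
    -- Independence: setting the variables of τ to zero removes `a s`, which has no constant term,
    -- and returns `p` itself.
    have h1 : ∀ p : MvPolynomial σ k,
        subst (Sum.elim X (fun _ => 0) : σ ⊕ τ → MvPowerSeries σ k)
          (MvPolynomial.aeval x p) = p := fun p => by
      rw [← subst_coe, subst_comp_subst_apply sx sl]
      convert subst_X_eq (p : MvPowerSeries σ k) using 2
      funext s
      simp only [x]
      rw [subst_add sl, subst_X sl, Sum.elim_inl, subst_comp_subst_apply sr sl]
      simp only [subst_X sl, Sum.elim_inr]
      have h0 := subst_zero_of_constantCoeff_zero (R := k) (S := k) (τ := σ)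
        (mem_orderIdeal_one.1 (ha1 s))
      change X s + subst (0 : τ → MvPowerSeries σ k) (a s) = X s
      rw [h0, add_zero]
    intro p q hpq
    have := h1 p
    rw [hpq, h1 q] at this
    exact (MvPolynomial.coe_injective σ k this).symm
  have h2 := isAlgebraic_subst_inl_zero (isAlgebraic_of_aeval_injective hxA hinj
    (substAlgHom (R := k) sx : MvPowerSeries σ k →+* MvPowerSeries (σ ⊕ τ) k)
    (fun p => substAlgHom_coe sx p) hf)
  rw [RingHom.coe_coe, substAlgHom_apply, subst_comp_subst_apply sx sz] at h2
  convert h2 using 2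
  funext s
  simp only [x]
  rw [subst_add sz, subst_X sz, Sum.elim_inl, zero_add, subst_comp_subst_apply sr sz]
  simp only [subst_X sz, Sum.elim_inr]
  exact (subst_X_eq _).symm

/-- The inverse of an algebraic coordinate change is algebraic. -/
theorem isAlgebraic_of_inverse [Finite σ] {P Q : σ → MvPowerSeries σ k}
    (hP1 : ∀ s, P s ∈ orderIdeal k σ 1) (hQ1 : ∀ s, Q s ∈ orderIdeal k σ 1)
    (hQP : ∀ s, subst Q (P s) = X s)
    (hP : ∀ s, IsAlgebraic (MvPolynomial σ k) (P s)) (s : σ) :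
    IsAlgebraic (MvPolynomial σ k) (Q s) := by
  have sP := hasSubst_of_mem hP1
  have sQ := hasSubst_of_mem hQ1
  let A := Subalgebra.algebraicClosure (MvPolynomial σ k) (MvPowerSeries σ k)
  let x : σ → A := fun s => ⟨X s, isAlgebraic_X s⟩
  let y : σ → A := fun s => ⟨P s, hP s⟩
  have hx : ∀ p : MvPolynomial σ k,
      ((MvPolynomial.aeval x p : A) : MvPowerSeries σ k) = p := fun p => by
    induction p using MvPolynomial.induction_on with
    | C c => simp; rfl
    | add p q hp hq => simp [hp, hq]
    | mul_X p i hp => simp [hp, x]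
  have hy : ∀ p : MvPolynomial σ k,
      subst Q ((MvPolynomial.aeval y p : A) : MvPowerSeries σ k) = p := fun p => by
    rw [← substAlgHom_apply sQ]
    induction p using MvPolynomial.induction_on with
    | C c => simp; rfl
    | add p q hp hq => rw [map_add, Subalgebra.coe_add, map_add, hp, hq, MvPolynomial.coe_add]
    | mul_X p i hp =>
      rw [map_mul, Subalgebra.coe_mul, map_mul, hp, MvPolynomial.aeval_X, MvPolynomial.coe_mul,
        MvPolynomial.coe_X, substAlgHom_apply, hQP]
  have hxi : AlgebraicIndependent k x := fun p q h => by
    have := congrArg (Subtype.val) h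
    change ((MvPolynomial.aeval x p : A) : MvPowerSeries σ k) =
      ((MvPolynomial.aeval x q : A) : MvPowerSeries σ k) at this
    rw [hx, hx] at this
    exact MvPolynomial.coe_injective σ k this
  have hyi : AlgebraicIndependent k y := fun p q h => by
    have := congrArg (fun z : A => subst Q (z : MvPowerSeries σ k)) h
    change subst Q ((MvPolynomial.aeval y p : A) : MvPowerSeries σ k) =
      subst Q ((MvPolynomial.aeval y q : A) : MvPowerSeries σ k) at this
    rw [hy, hy] at this
    exact MvPolynomial.coe_injective σ k this
  -- The variables form a transcendence basis of the ring A of algebraic series. The P_s are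
  -- algebraically independent, since substitution of Q maps them to the variables, and they are
  -- equally many; so they form a basis too, and X_s is algebraic over k[P].
  have hxb : IsTranscendenceBasis k x := by
    rw [hxi.isTranscendenceBasis_iff_isAlgebraic]
    refine ⟨fun z => ?_⟩
    have hz : IsAlgebraic (MvPolynomial σ k) z := Algebra.IsAlgebraic.isAlgebraic z
    refine hz.ringHom_of_comp_eq hxi.aevalEquiv (RingHom.id A) hxi.aevalEquiv.injective
      (RingHom.ext fun p => Subtype.ext ?_)
    simp only [RingHom.comp_apply, RingHom.coe_coe, RingHom.id_apply]
    rw [hxi.algebraMap_aevalEquiv, hx]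
    exact (algebraMap_eq_coe p).symm
  have hyb : IsTranscendenceBasis k y := by
    refine hyi.isTranscendenceBasis_of_lift_trdeg_le_of_finite ?_
    rw [← hxb.lift_cardinalMk_eq_trdeg]
  have halg := hyb.isAlgebraic
  have h1 : IsAlgebraic (Algebra.adjoin k (Set.range y)) (x s) :=
    Algebra.IsAlgebraic.isAlgebraic _
  -- Substitution of Q carries k[P] isomorphically to k[X] and X_s to Q_s, so it turns the relation
  -- of X_s over k[P] into one of Q_s over k[X].
  let g : A →+* MvPowerSeries σ k :=
    (substAlgHom (R := k) sQ : MvPowerSeries σ k →+* MvPowerSeries σ k).comp (A.subtype : A →+* _)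
  have hg : ∀ z, g z = subst Q (z : MvPowerSeries σ k) := fun z => substAlgHom_apply sQ _
  have h2 := h1.ringHom_of_comp_eq (S := MvPolynomial σ k) (B := MvPowerSeries σ k)
    hyi.aevalEquiv.symm g hyi.aevalEquiv.symm.injective (RingHom.ext fun z => by
      obtain ⟨p, rfl⟩ := hyi.aevalEquiv.surjective z
      simp only [RingHom.comp_apply, RingHom.coe_coe, AlgEquiv.symm_apply_apply, algebraMap_eq_coe]
      rw [hyi.algebraMap_aevalEquiv, hg]
      exact (hy p).symm)
  rwa [hg, subst_X sQ] at h2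

end Algebraic

/-! ### Operations preserving each of the three qualities. -/

section QualityClosure

variable {k : Type*} [Field k] {σ τ : Type*} (Q : Quality k)

/-! ### Closure properties of the three qualities -/

/-- The ring of series of a given quality. -/
def Quality.subring (Q : Quality k) (σ : Type*) : Subring (MvPowerSeries σ k) where
  carrier := {h | Q.Has h}
  add_mem' {f g} hf hg := by
    cases Q with
    | formal => trivial
    | convergent v => exact has_convergent_add v hf hg
    | algebraic => exact IsAlgebraic.add hf hg
  mul_mem' {f g} hf hg := by
    cases Q with
    | formal => trivial
    | convergent v => exact has_convergent_mul v hf hg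
    | algebraic => exact IsAlgebraic.mul hf hg
  zero_mem' := by
    cases Q with
    | formal => trivial
    | convergent v => simpa using has_convergent_C v (0 : k) (σ := σ)
    | algebraic => exact isAlgebraic_zero
  one_mem' := by
    cases Q with
    | formal => trivial
    | convergent v => simpa using has_convergent_C v (1 : k) (σ := σ)
    | algebraic => exact isAlgebraic_one
  neg_mem' {f} hf := by
    cases Q with
    | formal => trivial
    | convergent v =>
      have := has_convergent_mul v (has_convergent_C v (-1 : k)) hf
      simpa using this
    | algebraic => exact IsAlgebraic.neg hf

theorem mem_qualitySubring {h : MvPowerSeries σ k} : h ∈ Q.subring σ ↔ Q.Has h := Iff.rfl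

theorem C_mem_qualitySubring (c : k) : (C c : MvPowerSeries σ k) ∈ Q.subring σ := by
  rw [mem_qualitySubring]
  cases Q with
  | formal => trivial
  | convergent v => exact has_convergent_C v c
  | algebraic =>
    change IsAlgebraic _ _
    rw [← MvPolynomial.coe_C]
    exact isAlgebraic_coe _

theorem X_mem_qualitySubring (s : σ) : (X s : MvPowerSeries σ k) ∈ Q.subring σ := by
  rw [mem_qualitySubring]
  cases Q with
  | formal => trivial
  | convergent v => exact has_convergent_X v s
  | algebraic => exact isAlgebraic_X s

theorem subst_mem_qualitySubring [Finite σ] [Finite τ] {a : σ → MvPowerSeries τ k}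
    (ha : ∀ s, a s ∈ Q.subring τ) (ha1 : ∀ s, a s ∈ orderIdeal k τ 1) {f : MvPowerSeries σ k}
    (hf : f ∈ Q.subring σ) : subst a f ∈ Q.subring τ := by
  simp only [mem_qualitySubring] at *
  cases Q with
  | formal => trivial
  | convergent v => exact has_convergent_subst v ha ha1 hf
  | algebraic => exact isAlgebraic_subst ha ha1 hf

theorem mem_qualitySubring_of_X_mul {s : σ} {h : MvPowerSeries σ k}
    (hh : X s * h ∈ Q.subring σ) : h ∈ Q.subring σ := by
  rw [mem_qualitySubring] at *
  cases Q with
  | formal => trivial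
  | convergent v => exact has_convergent_of_X_mul v hh
  | algebraic => exact isAlgebraic_of_mul (X_series_ne_zero s) (isAlgebraic_X s) hh

theorem mem_qualitySubring_of_X_pow_mul {s : σ} {h : MvPowerSeries σ k} {n : ℕ}
    (hh : X s ^ n * h ∈ Q.subring σ) : h ∈ Q.subring σ := by
  induction n with
  | zero => simpa using hh
  | succ n ih =>
    rw [pow_succ', mul_assoc] at hh
    exact ih (mem_qualitySubring_of_X_mul Q hh)

/-- The geometric series is the inverse of `1 - X`. -/
theorem one_sub_X_mul_geom : ((1 : MvPowerSeries Unit k) - X ()) * geomSeries k = 1 := by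
  have h : geomSeries k = (PowerSeries.mk 1 : PowerSeries k) := by
    ext e
    rfl
  rw [h]
  have h2 := PowerSeries.mk_one_mul_one_sub_eq_one k
  rw [mul_comm] at h2
  exact h2

theorem geom_mem_qualitySubring : geomSeries k ∈ Q.subring Unit := by
  rw [mem_qualitySubring]
  cases Q with
  | formal => trivial
  | convergent v => exact has_convergent_geom v
  | algebraic =>
    have h := one_sub_X_mul_geom (k := k)
    refine isAlgebraic_of_mul (f := 1 - X ()) (fun h0 => ?_)
      (isAlgebraic_one.sub (isAlgebraic_X _)) ?_
    · rw [h0, zero_mul] at h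
      exact zero_ne_one h
    · rw [h]
      exact isAlgebraic_one

/-- With c the constant term, 1/h is c⁻¹ times the geometric series at 1 - h/c, so closure under
substitution suffices. -/
theorem inv_mem_qualitySubring [Finite σ] {h : MvPowerSeries σ k} (hh : h ∈ Q.subring σ)
    (h0 : constantCoeff h ≠ 0) : h⁻¹ ∈ Q.subring σ := by
  let c := constantCoeff h
  let x : MvPowerSeries σ k := 1 - C c⁻¹ * h
  have hx : x ∈ Q.subring σ :=
    sub_mem (one_mem _) (mul_mem (C_mem_qualitySubring Q _) hh)
  have hx1 : x ∈ orderIdeal k σ 1 := by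
    rw [mem_orderIdeal_one]
    simp [x, c, inv_mul_cancel₀ h0]
  have sx : HasSubst (fun _ : Unit => x) := hasSubst_of_mem fun _ => hx1
  have h1 := congrArg (substAlgHom (R := k) sx) (one_sub_X_mul_geom (k := k))
  rw [map_mul, map_sub, map_one, substAlgHom_X, substAlgHom_apply] at h1
  have h2 : h⁻¹ = C c⁻¹ * subst (fun _ : Unit => x) (geomSeries k) := by
    rw [MvPowerSeries.inv_eq_iff_mul_eq_one h0, ← h1]
    simp only [x]
    ring
  rw [h2]
  exact mul_mem (C_mem_qualitySubring Q _)
    (subst_mem_qualitySubring Q (fun _ => hx) (fun _ => hx1) (geom_mem_qualitySubring Q))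

/-- Exponents in which the variable `s` occurs to a power less than `n`. -/
def exponentBelow (s : τ) (n : ℕ) : LowerSet (τ →₀ ℕ) where
  carrier := {e | e s < n}
  lower' _ _ hab ha := lt_of_le_of_lt (hab s) ha

theorem mem_coeffIdeal_exponentBelow {s : τ} {n : ℕ} {h : MvPowerSeries τ k} :
    h ∈ coeffIdeal k (exponentBelow s n) ↔ X s ^ n ∣ h := by
  rw [X_pow_dvd_iff]
  rfl

/-- The derivative is the difference quotient (f(X + T e_j) - f(X))/T at T = 0. This uses only
substitution and division by a variable, hence is uniform in the quality. -/
theorem pderiv_mem_qualitySubring [Finite σ] {f : MvPowerSeries σ k} (hf : f ∈ Q.subring σ)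
    (j : σ) : pderiv k j f ∈ Q.subring σ := by
  classical
  have := Fintype.ofFinite σ
  let x : σ → MvPowerSeries (Option σ) k := fun i => X (some i)
  let δ : σ → MvPowerSeries (Option σ) k := fun i => if i = j then X none else 0
  have hx1 : ∀ i, x i ∈ orderIdeal k (Option σ) 1 := fun i => X_mem_orderIdeal _
  have hδ1 : ∀ i, δ i ∈ orderIdeal k (Option σ) 1 := fun i => by
    simp only [δ]
    split_ifs
    · exact X_mem_orderIdeal _
    · exact Ideal.zero_mem _
  have hxδ1 : ∀ i, (x + δ) i ∈ orderIdeal k (Option σ) 1 := fun i => Ideal.add_mem _ (hx1 i) (hδ1 i)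
  have hx : ∀ i, x i ∈ Q.subring (Option σ) := fun i => X_mem_qualitySubring Q _
  have hδ : ∀ i, δ i ∈ Q.subring (Option σ) := fun i => by
    simp only [δ]
    split_ifs
    · exact X_mem_qualitySubring Q _
    · exact zero_mem _
  have hT := subst_add_sub_mem hx1 hδ1 (E := exponentBelow none 2) (fun i i' => by
    rw [mem_coeffIdeal_exponentBelow, pow_two]
    refine mul_dvd_mul ?_ ?_ <;> simp only [δ] <;> split_ifs <;> simp) f
  rw [mem_coeffIdeal_exponentBelow] at hT
  obtain ⟨H, hH⟩ := hT
  have hsum : ∑ s, δ s * subst x (pderiv k s f) = X none * subst x (pderiv k j f) := by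
    simp [δ]
  have h1 : X none * (subst x (pderiv k j f) + X none * H) ∈ Q.subring (Option σ) := by
    have : X none * (subst x (pderiv k j f) + X none * H) = subst (x + δ) f - subst x f := by
      rw [hsum] at hH
      linear_combination -hH
    rw [this]
    exact sub_mem (subst_mem_qualitySubring Q (fun i => add_mem (hx i) (hδ i)) hxδ1 hf)
      (subst_mem_qualitySubring Q hx hx1 hf)
  have hz1 : ∀ o : Option σ, o.elim (0 : MvPowerSeries σ k) X ∈ orderIdeal k σ 1 := fun o => by
    cases o with
    | none => exact Ideal.zero_mem _
    | some t => exact X_mem_orderIdeal t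
  have h2 := subst_mem_qualitySubring Q (a := fun o : Option σ => o.elim (0 : MvPowerSeries σ k) X)
    (fun o => by
      cases o with
      | none => exact zero_mem _
      | some t => exact X_mem_qualitySubring Q t) hz1 (mem_qualitySubring_of_X_mul Q h1)
  have sz := hasSubst_of_mem hz1
  rw [subst_add sz, subst_mul sz, subst_X sz, Option.elim_none, zero_mul, add_zero,
    subst_comp_subst_apply (hasSubst_of_mem hx1) sz] at h2
  convert h2 using 1
  simp only [x, subst_X sz, Option.elim_some]
  exact (subst_X_eq _).symm

/-- Inverse mapping theorem for series of a given quality. -/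
theorem exists_inverse_of_quality [Finite σ] {P : σ → MvPowerSeries σ k}
    (hPq : ∀ s, P s ∈ Q.subring σ) (hP : ∀ s, P s - X s ∈ orderIdeal k σ 2) :
    ∃ R : σ → MvPowerSeries σ k, (∀ s, R s ∈ Q.subring σ) ∧
      (∀ s, R s - X s ∈ orderIdeal k σ 2) ∧
      (∀ s, subst P (R s) = X s) ∧ ∀ s, subst R (P s) = X s := by
  obtain ⟨R, hR, hPR, hRP⟩ := exists_inverse hP
  refine ⟨R, fun s => ?_, hR, hPR, hRP⟩
  have h1 : ∀ P : σ → MvPowerSeries σ k, (∀ s, P s - X s ∈ orderIdeal k σ 2) →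
      ∀ s, P s ∈ orderIdeal k σ 1 := fun P hP s => by
    simpa using Ideal.add_mem _ (orderIdeal_anti one_le_two (hP s)) (X_mem_orderIdeal s)
  have h2 : ∀ s, P s - X s ∈ Q.subring σ := fun s => sub_mem (hPq s) (X_mem_qualitySubring Q s)
  simp only [mem_qualitySubring] at *
  cases Q with
  | formal => trivial
  | convergent v => exact has_convergent_of_inverse v hP hR hRP h2 s
  | algebraic => exact isAlgebraic_of_inverse (h1 P hP) (h1 R hR) hRP hPq s

theorem det_mem_of_forall_mem {A n : Type*} [CommRing A] [Fintype n] [DecidableEq n]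
    (S : Subring A) {M : Matrix n n A} (hM : ∀ i j, M i j ∈ S) : M.det ∈ S := by
  have h : M = (Matrix.of fun i j => (⟨M i j, hM i j⟩ : S)).map S.subtype := by
    ext i j
    rfl
  rw [h, ← RingHom.mapMatrix_apply, ← RingHom.map_det]
  exact SetLike.coe_mem _

theorem adjugate_mem_of_forall_mem {A n : Type*} [CommRing A] [Fintype n] [DecidableEq n]
    (S : Subring A) {M : Matrix n n A} (hM : ∀ i j, M i j ∈ S) (i j : n) :
    M.adjugate i j ∈ S := by
  have h : M = (Matrix.of fun i j => (⟨M i j, hM i j⟩ : S)).map S.subtype := by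
    ext i j
    rfl
  rw [h, ← RingHom.mapMatrix_apply, ← RingHom.map_adjugate]
  exact SetLike.coe_mem _

end QualityClosure

/-! ### Evaluation at arcs and the dependence on coefficients. -/

section Evaluation

variable {k : Type*} [Field k] {ι κ : Type*}

/-! ### Evaluation at arcs -/

/-- Vectors of series without constant term. -/
def IsCentred (y : ι → PowerSeries k) : Prop := ∀ i, PowerSeries.constantCoeff (y i) = 0

theorem isCentred_of_mem_arcs {Q : Quality k} {y : ι → PowerSeries k} (hy : y ∈ arcs ι Q) :
    IsCentred y := fun i => (hy i).2

theorem mem_arcs_iff {Q : Quality k} {y : ι → PowerSeries k} :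
    y ∈ arcs ι Q ↔ (∀ i, (y i : MvPowerSeries Unit k) ∈ Q.subring Unit) ∧ IsCentred y :=
  forall_and

theorem mem_orderIdeal_unit {n : ℕ} {h : PowerSeries k} :
    h ∈ orderIdeal k Unit n ↔ PowerSeries.X ^ n ∣ h := by
  rw [PowerSeries.X_pow_dvd_iff, mem_orderIdeal]
  constructor
  · intro H m hm
    exact H (Finsupp.single () m) (by simpa using hm)
  · intro H e he
    have h1 : e = Finsupp.single () (e ()) := by ext; simp
    rw [h1] at he ⊢
    exact H _ (by simpa using he)

theorem arcVec_mem_orderIdeal {y : ι → PowerSeries k} (hy : IsCentred y) (o : Option ι) :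
    (o.elim PowerSeries.X y : MvPowerSeries Unit k) ∈ orderIdeal k Unit 1 := by
  cases o with
  | none => exact X_mem_orderIdeal ()
  | some i => exact mem_orderIdeal_one.2 (hy i)

theorem hasSubst_arcVec [Finite ι] {y : ι → PowerSeries k} (hy : IsCentred y) :
    HasSubst (fun o : Option ι => (o.elim PowerSeries.X y : MvPowerSeries Unit k)) :=
  hasSubst_of_mem (arcVec_mem_orderIdeal hy)

/-- Evaluation at a centred vector as a homomorphism of algebras. -/
def evalHom [Finite ι] {y : ι → PowerSeries k} (hy : IsCentred y) :
    Series k ι →ₐ[k] PowerSeries k :=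
  substAlgHom (R := k) (hasSubst_arcVec hy)

theorem evalHom_apply [Finite ι] {y : ι → PowerSeries k} (hy : IsCentred y) (f : Series k ι) :
    evalHom hy f = evalAt f y := substAlgHom_apply _ _

theorem evalAt_X_none [Finite ι] {y : ι → PowerSeries k} (hy : IsCentred y) :
    evalAt (X none) y = PowerSeries.X := subst_X (hasSubst_arcVec hy) none

theorem evalAt_X_some [Finite ι] {y : ι → PowerSeries k} (hy : IsCentred y) (i : ι) :
    evalAt (X (some i)) y = y i := subst_X (hasSubst_arcVec hy) (some i)

theorem evalAt_subst [Finite ι] [Finite κ] {y : ι → PowerSeries k} (hy : IsCentred y)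
    {a : Option κ → Series k ι} (ha : ∀ o, a o ∈ orderIdeal k _ 1) (ha0 : a none = X none)
    (f : Series k κ) :
    evalAt (subst a f) y = evalAt f fun i => evalAt (a (some i)) y := by
  unfold evalAt
  rw [subst_comp_subst_apply (hasSubst_of_mem ha) (hasSubst_arcVec hy)]
  congr 1
  funext o
  cases o with
  | none => rw [ha0, subst_X (hasSubst_arcVec hy)]; rfl
  | some i => rfl

theorem isCentred_evalAt [Finite ι] {y : ι → PowerSeries k} (hy : IsCentred y)
    {a : κ → Series k ι} (ha : ∀ i, a i ∈ orderIdeal k _ 1) :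
    IsCentred fun i => evalAt (a i) y := fun i =>
  mem_orderIdeal_one.1 (subst_mem_orderIdeal (arcVec_mem_orderIdeal hy) (ha i))

theorem evalAt_mem_qualitySubring [Finite ι] {Q : Quality k} {y : ι → PowerSeries k}
    (hy : y ∈ arcs ι Q) {f : Series k ι} (hf : Q.Has f) :
    evalAt f y ∈ Q.subring Unit := by
  refine subst_mem_qualitySubring Q (fun o => ?_)
    (arcVec_mem_orderIdeal (isCentred_of_mem_arcs hy)) hf
  cases o with
  | none => exact X_mem_qualitySubring Q ()
  | some i => exact (hy i).1

theorem evalAt_mem_arcs [Finite ι] {Q : Quality k} {y : ι → PowerSeries k}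
    (hy : y ∈ arcs ι Q) {a : κ → Series k ι} (ha : ∀ i, Q.Has (a i))
    (ha1 : ∀ i, a i ∈ orderIdeal k _ 1) : (fun i => evalAt (a i) y) ∈ arcs κ Q :=
  mem_arcs_iff.2 ⟨fun i => evalAt_mem_qualitySubring hy (ha i),
    isCentred_evalAt (isCentred_of_mem_arcs hy) ha1⟩

theorem X_pow_dvd_evalAt_sub [Finite ι] {y y' : ι → PowerSeries k} (hy : IsCentred y)
    (hy' : IsCentred y') {n : ℕ} (h : ∀ i, PowerSeries.X ^ n ∣ y i - y' i) (f : Series k ι) :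
    PowerSeries.X ^ n ∣ evalAt f y - evalAt f y' := by
  rw [← mem_orderIdeal_unit]
  refine subst_sub_subst_mem_orderIdeal' (arcVec_mem_orderIdeal hy)
    (arcVec_mem_orderIdeal hy') (fun o => ?_) f
  cases o with
  | none => simp
  | some i => exact mem_orderIdeal_unit.2 (h i)

/-! ### Coefficients in an algebra of functions -/

/-- Families of series whose coefficients lie in a given algebra of functions. -/
def coeffSubalgebra {U : Type*} (A : Subalgebra k (U → k)) : Subalgebra k (U → PowerSeries k) where
  carrier := {F | ∀ l, (fun u => PowerSeries.coeff l (F u)) ∈ A}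
  mul_mem' {F G} hF hG l := by
    have h : (fun u => PowerSeries.coeff l ((F * G) u)) =
        ∑ x ∈ Finset.HasAntidiagonal.antidiagonal l, (fun u => PowerSeries.coeff x.1 (F u)) *
          fun u => PowerSeries.coeff x.2 (G u) := by
      funext u
      simp [PowerSeries.coeff_mul]
    rw [h]
    exact A.sum_mem fun x _ => A.mul_mem (hF x.1) (hG x.2)
  add_mem' {F G} hF hG l := A.add_mem (hF l) (hG l)
  algebraMap_mem' c l := by
    have h : (fun u => PowerSeries.coeff l (algebraMap k (U → PowerSeries k) c u)) =
        algebraMap k (U → k) (PowerSeries.coeff l (PowerSeries.C c)) := by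
      funext u
      rfl
    rw [h]
    exact A.algebraMap_mem _

theorem coeffSubalgebra_mono {U : Type*} {A B : Subalgebra k (U → k)} (h : A ≤ B) :
    coeffSubalgebra A ≤ coeffSubalgebra B := fun _ hF l => h (hF l)

theorem const_mem_coeffSubalgebra {U : Type*} (A : Subalgebra k (U → k)) (a : PowerSeries k) :
    (fun _ => a) ∈ coeffSubalgebra A := fun l => A.algebraMap_mem (PowerSeries.coeff l a)

/-- The arcs have no constant term, so the coefficient at t^l is unaffected by terms of `f` of
degree above l. What remains is a polynomial in t and the y_i, and the families with coefficients in
`A` form an algebra. -/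
theorem evalAt_mem_coeffSubalgebra [Finite ι] {U : Type*} {A : Subalgebra k (U → k)}
    {y : U → ι → PowerSeries k} (hy : ∀ u, IsCentred (y u))
    (hyA : ∀ i, (fun u => y u i) ∈ coeffSubalgebra A) (f : Series k ι) :
    (fun u => evalAt f (y u)) ∈ coeffSubalgebra A := by
  intro l
  obtain ⟨p, hp⟩ := exists_polynomial_sub_mem f (l + 1)
  have h1 : ∀ u, PowerSeries.coeff l (evalAt f (y u)) =
      PowerSeries.coeff l (evalAt (p : Series k ι) (y u)) := fun u => by
    have h2 := subst_mem_orderIdeal (arcVec_mem_orderIdeal (hy u)) hp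
    rw [subst_sub (hasSubst_arcVec (hy u))] at h2
    have h3 := PowerSeries.X_pow_dvd_iff.1 (mem_orderIdeal_unit.1 h2) l (Nat.lt_succ_self l)
    rw [map_sub, sub_eq_zero] at h3
    exact h3
  suffices h : (fun u => evalAt (p : Series k ι) (y u)) ∈ coeffSubalgebra A by
    simp only [h1]
    exact h l
  clear h1 hp
  induction p using MvPolynomial.induction_on with
  | C c =>
    have h2 : (fun u => evalAt ((MvPolynomial.C c : MvPolynomial (Option ι) k) : Series k ι) (y u)) =
        fun _ => PowerSeries.C c := by
      funext u
      rw [MvPolynomial.coe_C]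
      exact subst_C_eq (hasSubst_arcVec (hy u)) c
    rw [h2]
    exact const_mem_coeffSubalgebra A _
  | add p q hp hq =>
    have h2 : (fun u => evalAt ((p + q : MvPolynomial (Option ι) k) : Series k ι) (y u)) =
        (fun u => evalAt (p : Series k ι) (y u)) + fun u => evalAt (q : Series k ι) (y u) := by
      funext u
      rw [MvPolynomial.coe_add]
      exact subst_add (hasSubst_arcVec (hy u)) _ _
    rw [h2]
    exact add_mem hp hq
  | mul_X p o hp =>
    have h2 : (fun u => evalAt ((p * MvPolynomial.X o : MvPolynomial (Option ι) k) : Series k ι)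
        (y u)) = (fun u => evalAt (p : Series k ι) (y u)) * fun u => evalAt (X o) (y u) := by
      funext u
      rw [MvPolynomial.coe_mul, MvPolynomial.coe_X]
      exact subst_mul (hasSubst_arcVec (hy u)) _ _
    rw [h2]
    refine mul_mem hp ?_
    cases o with
    | none =>
      simp only [evalAt_X_none (hy _)]
      exact const_mem_coeffSubalgebra A _
    | some i =>
      simp only [evalAt_X_some (hy _)]
      exact hyA i

/-- Division by `t^d`, discarding the lower coefficients. -/
def shift (d : ℕ) (h : PowerSeries k) : PowerSeries k :=
  PowerSeries.mk fun n => PowerSeries.coeff (n + d) h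

theorem X_pow_mul_shift {d : ℕ} {h : PowerSeries k} (hd : PowerSeries.X ^ d ∣ h) :
    PowerSeries.X ^ d * shift d h = h := by
  obtain ⟨h, rfl⟩ := hd
  congr 1
  ext n
  rw [shift, PowerSeries.coeff_mk, PowerSeries.coeff_X_pow_mul]

theorem shift_mem_coeffSubalgebra {U : Type*} {A : Subalgebra k (U → k)} {F : U → PowerSeries k}
    (hF : F ∈ coeffSubalgebra A) (d : ℕ) : (fun u => shift d (F u)) ∈ coeffSubalgebra A :=
  fun l => by
    simp only [shift, PowerSeries.coeff_mk]
    exact hF (l + d)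

/-- The recursion for the coefficients of an inverse series divides only by the constant term; this
is the sole source of denominators. -/
theorem inv_mem_coeffSubalgebra {U : Type*} {A : Subalgebra k (U → k)} {F : U → PowerSeries k}
    (hF : F ∈ coeffSubalgebra A) (h0 : (fun u => (PowerSeries.constantCoeff (F u))⁻¹) ∈ A) :
    (fun u => (F u)⁻¹) ∈ coeffSubalgebra A := by
  intro l
  induction l using Nat.strong_induction_on with
  | _ l ih =>
    rcases Nat.eq_zero_or_pos l with rfl | hl
    · simpa using h0
    · have h : (fun u => PowerSeries.coeff l (F u)⁻¹) =
          -(fun u => (PowerSeries.constantCoeff (F u))⁻¹) *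
          ∑ x ∈ Finset.HasAntidiagonal.antidiagonal l, if x.2 < l then
            (fun u => PowerSeries.coeff x.1 (F u)) * fun u => PowerSeries.coeff x.2 (F u)⁻¹
            else 0 := by
        funext u
        rw [PowerSeries.coeff_inv, if_neg hl.ne']
        simp only [Pi.mul_apply, Pi.neg_apply, Finset.sum_apply]
        congr 1
        refine Finset.sum_congr rfl fun x _ => ?_
        split_ifs <;> rfl
      rw [h]
      refine A.mul_mem (A.neg_mem h0) (A.sum_mem fun x _ => ?_)
      split_ifs with hx
      · exact A.mul_mem (hF x.1) (ih x.2 hx)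
      · exact A.zero_mem

/-! ### Polynomial and rational functions of the coefficients -/

/-- Functions on `U` that are polynomials in the coordinates in `J`. -/
def polyFun (J : Set (ι × ℕ)) (U : Set (ι → PowerSeries k)) : Subalgebra k (U → k) :=
  (MvPolynomial.supported k J).map
    (MvPolynomial.aeval fun c (u : U) => coords u.1 c : MvPolynomial (ι × ℕ) k →ₐ[k] U → k)

theorem aeval_coords_apply {U : Set (ι → PowerSeries k)} (P : MvPolynomial (ι × ℕ) k) (u : U) :
    (MvPolynomial.aeval (fun c (u : U) => coords u.1 c) P : U → k) u =
      MvPolynomial.eval (coords u.1) P := by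
  induction P using MvPolynomial.induction_on with
  | C c => simp
  | add p q hp hq => simp [hp, hq]
  | mul_X p i hp => simp [hp]

theorem mem_polyFun {J : Set (ι × ℕ)} {U : Set (ι → PowerSeries k)} {F : U → k} :
    F ∈ polyFun J U ↔ ∃ P ∈ MvPolynomial.supported k J,
      ∀ u, F u = MvPolynomial.eval (coords u.1) P := by
  rw [polyFun, Subalgebra.mem_map]
  refine exists_congr fun P => and_congr_right fun _ => ?_
  rw [funext_iff]
  refine forall_congr' fun u => ?_
  rw [← aeval_coords_apply]
  exact eq_comm

theorem coord_mem_polyFun {J : Set (ι × ℕ)} {U : Set (ι → PowerSeries k)} {c : ι × ℕ}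
    (hc : c ∈ J) : (fun u : U => PowerSeries.coeff c.2 (u.1 c.1)) ∈ polyFun J U :=
  mem_polyFun.2 ⟨MvPolynomial.X c, by
    rw [MvPolynomial.X]
    exact Algebra.subset_adjoin ⟨c, hc, rfl⟩, fun u => by simp [coords]⟩

/-- Functions on `U` that are quotients of polynomials in the coordinates, with a denominator that
does not vanish on `U` and involves only the coordinates in `J`. -/
def ratFun (J : Set (ι × ℕ)) (U : Set (ι → PowerSeries k)) : Subalgebra k (U → k) where
  carrier := {F | ∃ P, ∃ D ∈ MvPolynomial.supported k J, ∀ u : U,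
    MvPolynomial.eval (coords u.1) D ≠ 0 ∧
      F u = MvPolynomial.eval (coords u.1) P / MvPolynomial.eval (coords u.1) D}
  mul_mem' := by
    rintro F G ⟨P, D, hD, hF⟩ ⟨P', D', hD', hG⟩
    refine ⟨P * P', D * D', mul_mem hD hD', fun u => ⟨?_, ?_⟩⟩
    · rw [map_mul]
      exact mul_ne_zero (hF u).1 (hG u).1
    · rw [Pi.mul_apply, (hF u).2, (hG u).2, map_mul, map_mul, div_mul_div_comm]
  add_mem' := by
    rintro F G ⟨P, D, hD, hF⟩ ⟨P', D', hD', hG⟩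
    refine ⟨P * D' + D * P', D * D', mul_mem hD hD', fun u => ⟨?_, ?_⟩⟩
    · rw [map_mul]
      exact mul_ne_zero (hF u).1 (hG u).1
    · rw [Pi.add_apply, (hF u).2, (hG u).2, map_add, map_mul, map_mul, map_mul,
        div_add_div _ _ (hF u).1 (hG u).1]
  algebraMap_mem' c := ⟨MvPolynomial.C c, 1, one_mem _, fun u => by simp⟩

theorem polyFun_le_ratFun (J J' : Set (ι × ℕ)) (U : Set (ι → PowerSeries k)) :
    polyFun J U ≤ ratFun J' U := by
  intro F hF
  obtain ⟨P, -, hP⟩ := mem_polyFun.1 hF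
  exact ⟨P, 1, one_mem _, fun u => by simp [hP]⟩

theorem inv_mem_ratFun {J : Set (ι × ℕ)} {U : Set (ι → PowerSeries k)} {F : U → k}
    (hF : F ∈ polyFun J U) (h0 : ∀ u, F u ≠ 0) : (fun u => (F u)⁻¹) ∈ ratFun J U := by
  obtain ⟨P, hPJ, hP⟩ := mem_polyFun.1 hF
  exact ⟨1, P, hPJ, fun u => ⟨hP u ▸ h0 u, by simp [hP]⟩⟩

theorem isRationallyTextile_of_mem {J : Set (ι × ℕ)} {U : Set (ι → PowerSeries k)}
    {F : U → κ → PowerSeries k}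
    (hF : ∀ i, (fun u => F u i) ∈ coeffSubalgebra (ratFun J U)) :
    IsRationallyTextile J F := fun i l => by
  obtain ⟨P, D, hD, h⟩ := hF i l
  exact ⟨P, D, fun c hc => MvPolynomial.mem_supported.1 hD hc, h⟩

theorem isTextile_of_mem {U : Set (ι → PowerSeries k)}
    {F : U → κ → PowerSeries k}
    (hF : ∀ i, (fun u => F u i) ∈ coeffSubalgebra (polyFun Set.univ U)) :
    IsTextile F := fun i l => by
  obtain ⟨P, -, h⟩ := mem_polyFun.1 (hF i l)
  exact ⟨P, h⟩

theorem coord_mem_coeffSubalgebra {U : Set (ι → PowerSeries k)} {J : Set (ι × ℕ)} {i : ι}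
    (hJ : ∀ l, (i, l) ∈ J) : (fun u : U => u.1 i) ∈ coeffSubalgebra (polyFun J U) :=
  fun l => coord_mem_polyFun (hJ l)

theorem coeff_remainder (d : ι → ℕ) (y : ι → PowerSeries k) (i : ι) (l : ℕ) :
    PowerSeries.coeff l (remainder d y i) = if l ≤ d i then PowerSeries.coeff l (y i) else 0 := by
  rw [remainder, Polynomial.coeff_coe, PowerSeries.coeff_trunc]
  simp only [Nat.lt_succ_iff]

theorem remainder_mem_coeffSubalgebra {U : Set (ι → PowerSeries k)} (d : ι → ℕ) (i : ι) :
    (fun u : U => remainder d u.1 i) ∈ coeffSubalgebra (polyFun (lowCoords d) U) := fun l => by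
  simp only [coeff_remainder]
  split_ifs with h
  · exact coord_mem_polyFun (c := (i, l)) h
  · exact (polyFun (lowCoords d) U).zero_mem

end Evaluation

/-! ### Remainders, tails, and the coordinate change in the fibres. -/

section Linearization

variable {k : Type*} [Field k] {ι κ : Type*}

/-! ### Remainders and tails -/

theorem X_pow_mul_mem_qualitySubring_iff {Q : Quality k} {n : ℕ} {a : PowerSeries k} :
    PowerSeries.X ^ n * a ∈ Q.subring Unit ↔ a ∈ Q.subring Unit :=
  ⟨fun h => mem_qualitySubring_of_X_pow_mul Q (s := ()) h,
    fun h => mul_mem (pow_mem (X_mem_qualitySubring Q ()) n) h⟩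

/-- The exponent is d_i + 1 because elements of 𝒜_∘ have no constant term. Conversely, the quality
survives division by a power of t. -/
theorem mem_tailModule_iff {Q : Quality k} {d : ι → ℕ} {v : ι → PowerSeries k} :
    v ∈ tailModule Q d ↔ (∀ i, v i ∈ Q.subring Unit) ∧ ∀ i, PowerSeries.X ^ (d i + 1) ∣ v i := by
  constructor
  · rintro ⟨a, ha, rfl⟩
    refine ⟨fun i => X_pow_mul_mem_qualitySubring_iff.2 (ha i).1, fun i => ?_⟩
    rw [pow_succ]
    exact mul_dvd_mul_left _ (PowerSeries.X_dvd_iff.2 (ha i).2)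
  · rintro ⟨hq, hv⟩
    have h1 : ∀ i, PowerSeries.X ^ d i * shift (d i) (v i) = v i := fun i =>
      X_pow_mul_shift ((pow_dvd_pow _ (Nat.le_succ _)).trans (hv i))
    refine ⟨fun i => shift (d i) (v i), mem_arcs_iff.2 ⟨fun i => ?_, fun i => ?_⟩,
      funext fun i => (h1 i).symm⟩
    · have := hq i
      rw [← h1 i] at this
      exact X_pow_mul_mem_qualitySubring_iff.1 this
    · have := hv i
      rw [← h1 i, pow_succ] at this
      exact PowerSeries.X_dvd_iff.1
        ((mul_dvd_mul_iff_left (pow_ne_zero _ PowerSeries.X_ne_zero)).1 this)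

theorem isCentred_of_dvd {d : ι → ℕ} {v : ι → PowerSeries k}
    (hv : ∀ i, PowerSeries.X ^ (d i + 1) ∣ v i) : IsCentred v := fun i =>
  PowerSeries.X_dvd_iff.1 ((dvd_pow_self _ (Nat.succ_ne_zero _)).trans (hv i))

theorem tailModule_subset_arcs (Q : Quality k) (d : ι → ℕ) : tailModule Q d ⊆ arcs ι Q :=
  fun _ hv => mem_arcs_iff.2 ⟨(mem_tailModule_iff.1 hv).1,
    isCentred_of_dvd (mem_tailModule_iff.1 hv).2⟩

theorem neg_mem_tailModule {Q : Quality k} {d : ι → ℕ} {v : ι → PowerSeries k}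
    (hv : v ∈ tailModule Q d) : -v ∈ tailModule Q d := by
  rw [mem_tailModule_iff] at *
  exact ⟨fun i => neg_mem (hv.1 i), fun i => (dvd_neg).2 (hv.2 i)⟩

theorem isFreeSubmodule_tailModule [Finite ι] (Q : Quality k) (d : ι → ℕ) :
    IsFreeSubmodule Q (tailModule Q d) := by
  classical
  have := Fintype.ofFinite ι
  let E := Fintype.equivFin ι
  have hsum : ∀ (a : Fin (Fintype.card ι) → PowerSeries k) (i : ι),
      ∑ j, a j * (if E.symm j = i then PowerSeries.X ^ d i else 0) =
        PowerSeries.X ^ d i * a (E i) := fun a i => by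
    rw [Finset.sum_eq_single (E i)]
    · simp [mul_comm]
    · intro j _ hj
      rw [if_neg, mul_zero]
      rintro rfl
      exact hj (E.apply_symm_apply j).symm
    · simp
  refine ⟨tailModule_subset_arcs Q d, Fintype.card ι,
    -- The basis consists of t^{d_i} times the i-th unit vector.
    fun j i => if E.symm j = i then PowerSeries.X ^ d i else 0, fun j i => ?_, ?_, ?_, ?_⟩
  · change (if E.symm j = i then PowerSeries.X ^ d i else 0 : PowerSeries k) ∈ Q.subring Unit
    split_ifs
    · exact pow_mem (X_mem_qualitySubring Q ()) _
    · exact zero_mem _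
  · intro a ha
    exact ⟨fun i => a (E i), fun i => ha _, funext fun i => hsum a i⟩
  · intro a _ b _ hab
    funext j
    have h1 := congrFun hab (E.symm j)
    simp only [hsum, E.apply_symm_apply] at h1
    exact mul_left_cancel₀ (pow_ne_zero _ PowerSeries.X_ne_zero) h1
  · rintro v ⟨a, ha, rfl⟩
    refine ⟨fun j => a (E.symm j), fun j => ha _, funext fun i => ?_⟩
    simp only [hsum, E.symm_apply_apply]

theorem coe_polynomial_mem_qualitySubring (Q : Quality k) (p : Polynomial k) :
    (p : PowerSeries k) ∈ Q.subring Unit := by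
  induction p using Polynomial.induction_on' with
  | add p q hp hq =>
    rw [Polynomial.coe_add]
    exact add_mem hp hq
  | monomial n c =>
    rw [← Polynomial.C_mul_X_pow_eq_monomial, Polynomial.coe_mul, Polynomial.coe_pow,
      Polynomial.coe_C, Polynomial.coe_X]
    exact mul_mem (C_mem_qualitySubring Q c) (pow_mem (X_mem_qualitySubring Q ()) n)

theorem remainder_mem_polyVectors {d : ι → ℕ} {y : ι → PowerSeries k} (hy : IsCentred y) :
    remainder d y ∈ polyVectors k d := fun i => by
  constructor
  · rw [← PowerSeries.coeff_zero_eq_constantCoeff_apply, coeff_remainder, if_pos (Nat.zero_le _),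
      PowerSeries.coeff_zero_eq_constantCoeff_apply, hy i]
  · intro j hj
    rw [coeff_remainder, if_neg (not_le.2 hj)]

theorem X_pow_dvd_sub_remainder (d : ι → ℕ) (y : ι → PowerSeries k) (i : ι) :
    PowerSeries.X ^ (d i + 1) ∣ y i - remainder d y i := by
  rw [PowerSeries.X_pow_dvd_iff]
  intro m hm
  rw [map_sub, coeff_remainder, if_pos (Nat.lt_succ_iff.1 hm), sub_self]

theorem remainder_add {d : ι → ℕ} {z v : ι → PowerSeries k} (hz : z ∈ polyVectors k d)
    (hv : ∀ i, PowerSeries.X ^ (d i + 1) ∣ v i) : remainder d (z + v) = z := by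
  funext i
  ext l
  rw [coeff_remainder]
  split_ifs with h
  · rw [Pi.add_apply, map_add, PowerSeries.X_pow_dvd_iff.1 (hv i) l (Nat.lt_succ_of_le h), add_zero]
  · exact ((hz i).2 l (not_le.1 h)).symm

theorem polyVectors_subset_arcs (Q : Quality k) (d : ι → ℕ) : polyVectors k d ⊆ arcs ι Q := by
  intro z hz
  refine mem_arcs_iff.2 ⟨fun i => ?_, fun i => (hz i).1⟩
  -- An element of ℛ_d is its own remainder, hence a polynomial, and polynomials have every quality.
  have h := congrFun (remainder_add hz (v := 0) fun i => dvd_zero _) i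
  rw [add_zero] at h
  rw [← h]
  exact coe_polynomial_mem_qualitySubring Q _

theorem sub_remainder_mem_tailModule {Q : Quality k} (d : ι → ℕ) {y : ι → PowerSeries k}
    (hy : y ∈ arcs ι Q) : y - remainder d y ∈ tailModule Q d :=
  mem_tailModule_iff.2 ⟨fun i => sub_mem (hy i).1 (polyVectors_subset_arcs Q d
    (remainder_mem_polyVectors (isCentred_of_mem_arcs hy)) i).1, X_pow_dvd_sub_remainder d y⟩

/-! ### Division by a series of known order -/

/-- The quotient `V / G` when `G` has order `d` and `t^d` divides `V`. -/
def quot (d : ℕ) (G V : PowerSeries k) : PowerSeries k := shift d V * (shift d G)⁻¹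

theorem X_pow_dvd_of_order_eq {d : ℕ} {G : PowerSeries k} (hG : G.order = d) :
    PowerSeries.X ^ d ∣ G :=
  PowerSeries.X_pow_dvd_iff.2 (PowerSeries.order_eq_nat.1 hG).2

theorem constantCoeff_shift (d : ℕ) (G : PowerSeries k) :
    PowerSeries.constantCoeff (shift d G) = PowerSeries.coeff d G := by
  rw [← PowerSeries.coeff_zero_eq_constantCoeff_apply, shift, PowerSeries.coeff_mk, zero_add]

theorem constantCoeff_shift_ne_zero {d : ℕ} {G : PowerSeries k} (hG : G.order = d) :
    PowerSeries.constantCoeff (shift d G) ≠ 0 := by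
  rw [constantCoeff_shift]
  exact (PowerSeries.order_eq_nat.1 hG).1

theorem ne_zero_of_order_eq {d : ℕ} {G : PowerSeries k} (hG : G.order = d) : G ≠ 0 := by
  rintro rfl
  simp at hG

theorem mul_quot {d : ℕ} {G V : PowerSeries k} (hG : G.order = d) (hV : PowerSeries.X ^ d ∣ V) :
    G * quot d G V = V := by
  have h1 := PowerSeries.mul_inv_cancel _ (constantCoeff_shift_ne_zero hG)
  have h2 := X_pow_mul_shift (X_pow_dvd_of_order_eq hG)
  have h3 := X_pow_mul_shift hV
  rw [quot]
  linear_combination (-shift d V * (shift d G)⁻¹) * h2 + PowerSeries.X ^ d * shift d V * h1 + h3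

theorem quot_mul {d : ℕ} {G : PowerSeries k} (hG : G.order = d) (b : PowerSeries k) :
    quot d G (G * b) = b :=
  mul_left_cancel₀ (ne_zero_of_order_eq hG)
    (mul_quot hG ((X_pow_dvd_of_order_eq hG).mul_right b))

/-- The vector `a` with `v = Δ_g(z) a`. -/
def quotVec (g : ι → Series k ι) (d : ι → ℕ) (z v : ι → PowerSeries k) : ι → PowerSeries k :=
  fun i => quot (d i) (evalAt (g i) z) (v i)

section

variable {g : ι → Series k ι} {d : ι → ℕ} {z : ι → PowerSeries k}
  (hz : ∀ i, (evalAt (g i) z).order = d i)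

include hz

theorem diagMul_quotVec {v : ι → PowerSeries k} (hv : ∀ i, PowerSeries.X ^ (d i + 1) ∣ v i) :
    diagMul g z (quotVec g d z v) = v :=
  funext fun i => mul_quot (hz i) ((pow_dvd_pow _ (Nat.le_succ _)).trans (hv i))

theorem quotVec_diagMul (a : ι → PowerSeries k) : quotVec g d z (diagMul g z a) = a :=
  funext fun i => quot_mul (hz i) (a i)

/-- Since g_i(z) is t^{d_i} times a unit, Δ_g(z) maps the centred vectors onto those divisible by
t^{d_i + 1}: the module 𝒢(z) is 𝒱_d for every z in the stratum. -/
theorem X_pow_dvd_diagMul_iff {a : ι → PowerSeries k} :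
    (∀ i, PowerSeries.X ^ (d i + 1) ∣ diagMul g z a i) ↔ IsCentred a := by
  refine forall_congr' fun i => ?_
  have h2 := X_pow_mul_shift (X_pow_dvd_of_order_eq (hz i))
  have h3 : diagMul g z a i = PowerSeries.X ^ d i * (shift (d i) (evalAt (g i) z) * a i) := by
    rw [← mul_assoc, h2]
    rfl
  rw [h3, pow_succ, mul_dvd_mul_iff_left (pow_ne_zero _ PowerSeries.X_ne_zero),
    PowerSeries.X_dvd_iff, map_mul, mul_eq_zero,
    or_iff_right (constantCoeff_shift_ne_zero (hz i))]

theorem isCentred_quotVec {v : ι → PowerSeries k} (hv : ∀ i, PowerSeries.X ^ (d i + 1) ∣ v i) :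
    IsCentred (quotVec g d z v) := by
  rw [← X_pow_dvd_diagMul_iff hz, diagMul_quotVec hz hv]
  exact hv

theorem quotVec_mem_arcs [Finite ι] {Q : Quality k} (hg : ∀ i, Q.Has (g i)) (hza : z ∈ arcs ι Q)
    {v : ι → PowerSeries k} (hv : v ∈ tailModule Q d) : quotVec g d z v ∈ arcs ι Q := by
  have hv' := mem_tailModule_iff.1 hv
  have key : ∀ (n : ℕ) {h : PowerSeries k}, PowerSeries.X ^ n ∣ h → h ∈ Q.subring Unit →
      shift n h ∈ Q.subring Unit := fun n h hd hh => by
    rw [← X_pow_mul_shift hd] at hh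
    exact X_pow_mul_mem_qualitySubring_iff.1 hh
  refine mem_arcs_iff.2 ⟨fun i => ?_, isCentred_quotVec hz hv'.2⟩
  exact mul_mem (key _ ((pow_dvd_pow _ (Nat.le_succ _)).trans (hv'.2 i)) (hv'.1 i))
    (inv_mem_qualitySubring Q (key _ (X_pow_dvd_of_order_eq (hz i))
      (evalAt_mem_qualitySubring hza (hg i))) (constantCoeff_shift_ne_zero (hz i)))

theorem diagMul_mem_tailModule [Finite ι] {Q : Quality k} (hg : ∀ i, Q.Has (g i))
    (hza : z ∈ arcs ι Q) {a : ι → PowerSeries k} (ha : a ∈ arcs ι Q) :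
    diagMul g z a ∈ tailModule Q d :=
  mem_tailModule_iff.2 ⟨fun i => mul_mem (evalAt_mem_qualitySubring hza (hg i)) (ha i).1,
    (X_pow_dvd_diagMul_iff hz).2 (isCentred_of_mem_arcs ha)⟩

end

/-! ### The fibrewise coordinate change -/

theorem isCentred_sumElim {z a : ι → PowerSeries k} (hz : IsCentred z) (ha : IsCentred a) :
    IsCentred (Sum.elim z a) := fun j => by
  cases j with
  | inl i => exact hz i
  | inr i => exact ha i

theorem sumElim_mem_arcs {Q : Quality k} {z a : ι → PowerSeries k} (hz : z ∈ arcs ι Q)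
    (ha : a ∈ arcs ι Q) : Sum.elim z a ∈ arcs (ι ⊕ ι) Q := fun j => by
  cases j with
  | inl i => exact hz i
  | inr i => exact ha i

/-- The series `a_i + p_i(t, z, a)`. -/
def addVar (p : ι → Series k (ι ⊕ ι)) : ι → Series k (ι ⊕ ι) := fun i => X (some (Sum.inr i)) + p i

theorem substPair_addVar [Finite ι] (p : ι → Series k (ι ⊕ ι)) {z a : ι → PowerSeries k}
    (hz : IsCentred z) (ha : IsCentred a) :
    substPair (addVar p) z a = a + substPair p z a := by
  funext i
  have h := isCentred_sumElim hz ha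
  simp only [substPair, addVar, Pi.add_apply]
  rw [← evalHom_apply h, map_add, evalHom_apply h, evalHom_apply h, evalAt_X_some h]
  rfl

/-- The inverse mapping theorem is applied in all the variables t, z, a to (t, z, a + p). That map
fixes t and z, hence so does its inverse, which therefore inverts a ↦ a + p(z,a) for each z. -/
theorem exists_fibre_inverse [Finite ι] {Q : Quality k} {p : ι → Series k (ι ⊕ ι)}
    (hpQ : ∀ i, Q.Has (p i)) (hp : ∀ i, p i ∈ orderIdeal k _ 2) :
    ∃ q : ι → Series k (ι ⊕ ι), (∀ i, Q.Has (q i)) ∧ (∀ i, q i ∈ orderIdeal k _ 1) ∧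
      ∀ z a, IsCentred z → IsCentred a →
        substPair q z (substPair (addVar p) z a) = a ∧
          substPair (addVar p) z (substPair q z a) = a := by
  let P : Option (ι ⊕ ι) → Series k (ι ⊕ ι) := fun o =>
    X o + o.elim 0 (Sum.elim (fun _ => 0) p)
  have hP : ∀ o, P o - X o ∈ orderIdeal k _ 2 := by
    rintro (_ | i | i) <;> simp only [P, add_sub_cancel_left]
    · exact Ideal.zero_mem _
    · exact Ideal.zero_mem _
    · exact hp i
  have hPQ : ∀ o, P o ∈ Q.subring _ := by
    rintro (_ | i | i) <;> refine add_mem (X_mem_qualitySubring Q _) ?_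
    · exact zero_mem _
    · exact zero_mem _
    · exact hpQ i
  have hP0 : ∀ o : Option (ι ⊕ ι), (∀ i, o ≠ some (Sum.inr i)) → P o = X o := by
    rintro (_ | i | i) h
    · exact add_zero _
    · exact add_zero _
    · exact absurd rfl (h i)
  have h1 : ∀ P : Option (ι ⊕ ι) → Series k (ι ⊕ ι),
      (∀ s, P s - X s ∈ orderIdeal k _ 2) → ∀ s, P s ∈ orderIdeal k _ 1 := fun P hP s => by
    simpa using Ideal.add_mem _ (orderIdeal_anti one_le_two (hP s)) (X_mem_orderIdeal s)
  obtain ⟨R, hRQ, hR, hPR, hRP⟩ := exists_inverse_of_quality Q hPQ hP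
  have hR0 : ∀ o : Option (ι ⊕ ι), (∀ i, o ≠ some (Sum.inr i)) → R o = X o := fun o ho => by
    have h2 := hRP o
    rwa [hP0 o ho, subst_X (hasSubst_of_mem (h1 R hR))] at h2
  -- Stated symmetrically in P and R, so that it yields both compositions.
  have key : ∀ P R : Option (ι ⊕ ι) → Series k (ι ⊕ ι), (∀ o, P o ∈ orderIdeal k _ 1) →
      (∀ o : Option (ι ⊕ ι), (∀ i, o ≠ some (Sum.inr i)) → P o = X o) →
      (∀ o, subst P (R o) = X o) → ∀ z a, IsCentred z → IsCentred a →
      substPair (fun i => R (some (Sum.inr i))) z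
        (substPair (fun i => P (some (Sum.inr i))) z a) = a := by
    intro P R hP hP0 hPR z a hz ha
    have hc := isCentred_sumElim hz ha
    funext i
    have h2 := evalAt_subst hc hP (hP0 none (by simp)) (R (some (Sum.inr i)))
    rw [hPR, evalAt_X_some hc] at h2
    change a i = _ at h2
    rw [h2, substPair]
    congr 1
    funext j
    cases j with
    | inl j => rw [hP0 _ (by simp), evalAt_X_some hc]; rfl
    | inr j => rfl
  exact ⟨fun i => R (some (Sum.inr i)), fun i => hRQ _, fun i => h1 R hR _, fun z a hz ha =>
    ⟨key P R (h1 P hP) hP0 hPR z a hz ha, key R P (h1 R hR) hR0 hRP z a hz ha⟩⟩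

/-- The map `Δ_g(z) a ↦ Δ_g(z) p(z, a)`. -/
def fibreMap (g : ι → Series k ι) (d : ι → ℕ) (p : ι → Series k (ι ⊕ ι))
    (z v : ι → PowerSeries k) : ι → PowerSeries k :=
  diagMul g z (substPair p z (quotVec g d z v))

theorem fibreMap_mem_tailModule [Finite ι] {Q : Quality k} {g : ι → Series k ι} {d : ι → ℕ}
    {p : ι → Series k (ι ⊕ ι)} (hg : ∀ i, Q.Has (g i)) (hp : ∀ i, Q.Has (p i))
    (hp1 : ∀ i, p i ∈ orderIdeal k _ 1) {z v : ι → PowerSeries k} (hz : z ∈ arcs ι Q)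
    (hzd : ∀ i, (evalAt (g i) z).order = d i) (hv : v ∈ tailModule Q d) :
    fibreMap g d p z v ∈ tailModule Q d :=
  diagMul_mem_tailModule hzd hg hz
    (evalAt_mem_arcs (sumElim_mem_arcs hz (quotVec_mem_arcs hzd hg hz hv)) hp hp1)

theorem fibreMap_fibreMap [Finite ι] {g : ι → Series k ι} {d : ι → ℕ}
    {p q : ι → Series k (ι ⊕ ι)} {z v : ι → PowerSeries k} (hz : IsCentred z)
    (hzd : ∀ i, (evalAt (g i) z).order = d i)
    (hv : ∀ i, PowerSeries.X ^ (d i + 1) ∣ v i)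
    (hqp : ∀ z a, IsCentred z → IsCentred a → substPair q z (substPair p z a) = a) :
    fibreMap g d q z (fibreMap g d p z v) = v := by
  rw [fibreMap, fibreMap, quotVec_diagMul hzd, hqp _ _ hz (isCentred_quotVec hzd hv),
    diagMul_quotVec hzd hv]

/-- Only g_i(z)/t^{d_i} is inverted, with constant term polynomial in the coordinates of z in `J`.
Hence z must depend polynomially on coordinates in `J`, whereas v may have any coordinates in its
numerators. -/
theorem fibreMap_mem_coeffSubalgebra {α : Type*} [Finite ι] {g : ι → Series k ι} {d : ι → ℕ}
    (p : ι → Series k (ι ⊕ ι)) {U : Set (α → PowerSeries k)} {J : Set (α × ℕ)}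
    {z v : U → ι → PowerSeries k} (hz : ∀ u, IsCentred (z u))
    (hzd : ∀ u i, (evalAt (g i) (z u)).order = d i)
    (hv : ∀ u i, PowerSeries.X ^ (d i + 1) ∣ v u i)
    (hzJ : ∀ i, (fun u => z u i) ∈ coeffSubalgebra (polyFun J U))
    (hvJ : ∀ i, (fun u => v u i) ∈ coeffSubalgebra (ratFun J U)) (i : ι) :
    (fun u => fibreMap g d p (z u) (v u) i) ∈ coeffSubalgebra (ratFun J U) := by
  have hle := coeffSubalgebra_mono (polyFun_le_ratFun J J U)
  have hg : ∀ i, (fun u => evalAt (g i) (z u)) ∈ coeffSubalgebra (polyFun J U) :=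
    fun i => evalAt_mem_coeffSubalgebra hz hzJ (g i)
  have hinv : ∀ i, (fun u => (shift (d i) (evalAt (g i) (z u)))⁻¹) ∈
      coeffSubalgebra (ratFun J U) := fun i => by
    refine inv_mem_coeffSubalgebra (hle (shift_mem_coeffSubalgebra (hg i) (d i))) ?_
    simp only [constantCoeff_shift]
    exact inv_mem_ratFun (hg i (d i)) fun u => (PowerSeries.order_eq_nat.1 (hzd u i)).1
  refine mul_mem (hle (hg i)) (evalAt_mem_coeffSubalgebra
    (fun u => isCentred_sumElim (hz u) (isCentred_quotVec (hzd u) (hv u))) (fun j => ?_) (p i))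
  cases j with
  | inl j => exact hle (hzJ j)
  | inr j => exact mul_mem (shift_mem_coeffSubalgebra (hvJ j) (d j)) (hinv j)

end Linearization

/-! ### Charts on strata, local closedness, strata of division modules. -/

section Charts

variable {k : Type*} [Field k] {ι κ : Type*}

/-! ### Affine coordinates -/

/-- The vector of polynomials with given affine coordinates. -/
def ofAffineCoords (d : ι → ℕ) (x : (Σ i, Fin (d i)) → k) : ι → PowerSeries k := fun i =>
  PowerSeries.mk fun n => if h : 1 ≤ n ∧ n ≤ d i then x ⟨i, ⟨n - 1, by omega⟩⟩ else 0

theorem ofAffineCoords_mem_polyVectors (d : ι → ℕ) (x : (Σ i, Fin (d i)) → k) :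
    ofAffineCoords d x ∈ polyVectors k d := fun i => by
  refine ⟨?_, fun j hj => ?_⟩
  · rw [← PowerSeries.coeff_zero_eq_constantCoeff_apply, ofAffineCoords, PowerSeries.coeff_mk,
      dif_neg (by omega)]
  · rw [ofAffineCoords, PowerSeries.coeff_mk, dif_neg (by omega)]

theorem affineCoords_ofAffineCoords (d : ι → ℕ) (x : (Σ i, Fin (d i)) → k) :
    affineCoords d (ofAffineCoords d x) = x := by
  funext ⟨i, n⟩
  rw [affineCoords, ofAffineCoords, PowerSeries.coeff_mk, dif_pos ⟨by omega, n.2⟩]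
  rfl

theorem ofAffineCoords_affineCoords {d : ι → ℕ} {z : ι → PowerSeries k}
    (hz : z ∈ polyVectors k d) : ofAffineCoords d (affineCoords d z) = z := by
  funext i
  ext n
  rw [ofAffineCoords, PowerSeries.coeff_mk]
  split_ifs with h
  · simp only [affineCoords]
    rw [Nat.sub_add_cancel h.1]
  · rcases Nat.eq_zero_or_pos n with rfl | hn
    · exact (PowerSeries.coeff_zero_eq_constantCoeff_apply (z i)).trans (hz i).1 |>.symm
    · exact ((hz i).2 n (by omega)).symm

/-! ### Linearization of strata -/

/-- The hypotheses under which `f` is linearized on the set `S`: a division module `⟨g_i⟩` with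
remainder `p` such that `g_i` has order `d_i` on `S`, and `S` is stable under `𝒱_d`. -/
structure IsLinearizable [Fintype ι] (Q : Quality k) (f : κ → Series k ι) (g : ι → Series k ι)
    (p : ι → Series k (ι ⊕ ι)) (d : ι → ℕ) (S : Set (ι → PowerSeries k)) : Prop where
  quality_left : ∀ i, Q.Has (g i)
  quality_right : ∀ i, Q.Has (p i)
  order_two : ∀ i, p i ∈ orderIdeal k _ 2
  expansion : ∀ z ∈ arcs ι Q, ∀ a ∈ arcs ι Q,
    (fun i => evalAt (f i) (z + diagMul g z a)) =
      (fun i => evalAt (f i) z) + (jacobianAt f z).mulVec (diagMul g z a) +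
        (jacobianAt f z).mulVec (diagMul g z (substPair p z a))
  subset_arcs : S ⊆ arcs ι Q
  order_eq : ∀ y ∈ S, ∀ i, (evalAt (g i) y).order = d i
  stable : ∀ y ∈ S, ∀ v ∈ tailModule Q d, y + v ∈ S

theorem fst_mem_coeffSubalgebra {Q : Quality k} {d : ι → ℕ} {S : Set (ι → PowerSeries k)}
    (J : Set ((ι ⊕ ι) × ℕ)) (i : ι) :
    (fun w : pairs (S ∩ polyVectors k d) (tailModule Q d) => fst w i) ∈
      coeffSubalgebra (ratFun J _) :=
  coeffSubalgebra_mono (polyFun_le_ratFun Set.univ _ _)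
    (coord_mem_coeffSubalgebra (i := Sum.inl i) fun _ => Set.mem_univ _)

variable [Fintype ι] {Q : Quality k} {f : κ → Series k ι} {g : ι → Series k ι}
  {p : ι → Series k (ι ⊕ ι)} {d : ι → ℕ} {S : Set (ι → PowerSeries k)}

theorem IsLinearizable.remainder_mem (h : IsLinearizable Q f g p d S) {y : ι → PowerSeries k}
    (hy : y ∈ S) : remainder d y ∈ S ∩ polyVectors k d := by
  have hya := h.subset_arcs hy
  refine ⟨?_, remainder_mem_polyVectors (isCentred_of_mem_arcs hya)⟩
  have h1 := h.stable y hy _ (neg_mem_tailModule (sub_remainder_mem_tailModule d hya))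
  rwa [neg_sub, add_sub_cancel] at h1

/-- Splitting a vector into its remainder and its tail. -/
def IsLinearizable.splitEquiv (h : IsLinearizable Q f g p d S) :
    S ≃ pairs (S ∩ polyVectors k d) (tailModule Q d) where
  toFun y := ⟨Sum.elim (remainder d y.1) (y.1 - remainder d y.1),
    h.remainder_mem y.2, sub_remainder_mem_tailModule d (h.subset_arcs y.2)⟩
  invFun w := ⟨fst w + snd w, h.stable _ w.2.1.1 _ w.2.2⟩
  left_inv y := Subtype.ext (add_sub_cancel (remainder d y.1) y.1)
  right_inv w := by
    have hr : remainder d (fst w + snd w) = fst w :=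
      remainder_add w.2.1.2 (mem_tailModule_iff.1 w.2.2).2
    refine Subtype.ext (funext fun j => ?_)
    change Sum.elim (remainder d (fst w + snd w)) (fst w + snd w - remainder d (fst w + snd w)) j = _
    rw [hr, add_sub_cancel_left]
    cases j <;> rfl

theorem IsLinearizable.isTextileIso_splitEquiv (h : IsLinearizable Q f g p d S) :
    IsTextileIso h.splitEquiv := by
  have hle : polyFun (lowCoords d) S ≤ polyFun Set.univ S :=
    Subalgebra.map_mono (MvPolynomial.supported_mono (Set.subset_univ _))
  have hrem : ∀ i, (fun u : S => remainder d u.1 i) ∈ coeffSubalgebra (polyFun Set.univ S) :=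
    fun i => coeffSubalgebra_mono hle (remainder_mem_coeffSubalgebra d i)
  refine ⟨isTextile_of_mem fun j => ?_, isTextile_of_mem fun i => ?_⟩
  · cases j with
    | inl i => exact hrem i
    | inr i => exact sub_mem (coord_mem_coeffSubalgebra fun _ => Set.mem_univ _) (hrem i)
  · exact add_mem (coord_mem_coeffSubalgebra (i := Sum.inl i) fun _ => Set.mem_univ _)
      (coord_mem_coeffSubalgebra (i := Sum.inr i) fun _ => Set.mem_univ _)

/-- The change of coordinates on the second factor given by a pair of inverse series. -/
def IsLinearizable.fibreEquiv (h : IsLinearizable Q f g p d S) {P R : ι → Series k (ι ⊕ ι)}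
    (hPQ : ∀ i, Q.Has (P i)) (hP : ∀ i, P i ∈ orderIdeal k _ 1)
    (hRQ : ∀ i, Q.Has (R i)) (hR : ∀ i, R i ∈ orderIdeal k _ 1)
    (hRP : ∀ z a, IsCentred z → IsCentred a → substPair R z (substPair P z a) = a)
    (hPR : ∀ z a, IsCentred z → IsCentred a → substPair P z (substPair R z a) = a) :
    pairs (S ∩ polyVectors k d) (tailModule Q d) ≃ pairs (S ∩ polyVectors k d) (tailModule Q d) where
  toFun w := ⟨Sum.elim (fst w) (fibreMap g d P (fst w) (snd w)), w.2.1,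
    fibreMap_mem_tailModule h.quality_left hPQ hP (h.subset_arcs w.2.1.1)
      (h.order_eq _ w.2.1.1) w.2.2⟩
  invFun w := ⟨Sum.elim (fst w) (fibreMap g d R (fst w) (snd w)), w.2.1,
    fibreMap_mem_tailModule h.quality_left hRQ hR (h.subset_arcs w.2.1.1)
      (h.order_eq _ w.2.1.1) w.2.2⟩
  left_inv w := by
    refine Subtype.ext (funext fun j => ?_)
    cases j with
    | inl i => rfl
    | inr i =>
      exact congrFun (fibreMap_fibreMap (isCentred_of_mem_arcs (h.subset_arcs w.2.1.1))
        (h.order_eq _ w.2.1.1) (mem_tailModule_iff.1 w.2.2).2 hRP) i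
  right_inv w := by
    refine Subtype.ext (funext fun j => ?_)
    cases j with
    | inl i => rfl
    | inr i =>
      exact congrFun (fibreMap_fibreMap (isCentred_of_mem_arcs (h.subset_arcs w.2.1.1))
        (h.order_eq _ w.2.1.1) (mem_tailModule_iff.1 w.2.2).2 hPR) i

theorem IsLinearizable.fibreMap_pairs_mem (h : IsLinearizable Q f g p d S)
    (P : ι → Series k (ι ⊕ ι)) (i : ι) :
    (fun w : pairs (S ∩ polyVectors k d) (tailModule Q d) =>
      fibreMap g d P (fst w) (snd w) i) ∈ coeffSubalgebra (ratFun (fstCoords ι) _) :=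
  fibreMap_mem_coeffSubalgebra P
    (fun w => isCentred_of_mem_arcs (h.subset_arcs w.2.1.1)) (fun w => h.order_eq _ w.2.1.1)
    (fun w => (mem_tailModule_iff.1 w.2.2).2)
    (fun i => coord_mem_coeffSubalgebra (i := Sum.inl i) fun _ => rfl)
    (fun i => coeffSubalgebra_mono (polyFun_le_ratFun Set.univ _ _)
      (coord_mem_coeffSubalgebra (i := Sum.inr i) fun _ => Set.mem_univ _)) i

/-- `ψ` splits y into (z, v) and `φ` adds Δ_g(z)p(z,a) to v = Δ_g(z)a. The expansion of f then says
that f composed with the inverse of `φ ∘ ψ` is affine in v. -/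
theorem IsLinearizable.exists_chart (h : IsLinearizable Q f g p d S) :
    ∃ (ψ : S ≃ pairs (S ∩ polyVectors k d) (tailModule Q d))
      (φ : pairs (S ∩ polyVectors k d) (tailModule Q d) ≃
        pairs (S ∩ polyVectors k d) (tailModule Q d))
      (χ : pairs (S ∩ polyVectors k d) (tailModule Q d) ≃ S),
      IsTextileIso ψ ∧
      (∀ y, (ψ y).1 = Sum.elim (remainder d y.1) (y.1 - remainder d y.1)) ∧
      IsRationallyTextileIso (fstCoords ι) (fstCoords ι) φ ∧
      (∀ w : pairs (S ∩ polyVectors k d) (tailModule Q d),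
        (∃! a, a ∈ arcs ι Q ∧ snd w = diagMul g (fst w) a) ∧
        ∀ a ∈ arcs ι Q, snd w = diagMul g (fst w) a →
          (φ w).1 = Sum.elim (fst w) (diagMul g (fst w) (a + substPair p (fst w) a))) ∧
      χ = (ψ.trans φ).symm ∧
      IsRationallyTextileIso (fstCoords ι) (lowCoords d) χ ∧
      (∀ w, remainder d (χ w).1 = fst w) ∧
      ∀ w, (fun i => evalAt (f i) (χ w).1) =
        (fun i => evalAt (f i) (fst w)) + (jacobianAt f (fst w)).mulVec (snd w) := by
  obtain ⟨R, hRQ, hR, hinv⟩ := exists_fibre_inverse h.quality_right h.order_two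
  have hPQ : ∀ i, Q.Has (addVar p i) := fun i =>
    add_mem (s := Q.subring _) (X_mem_qualitySubring Q _) (h.quality_right i)
  have hP : ∀ i, addVar p i ∈ orderIdeal k _ 1 := fun i =>
    Ideal.add_mem _ (X_mem_orderIdeal _) (orderIdeal_anti one_le_two (h.order_two i))
  let ψ := h.splitEquiv
  let φ := h.fibreEquiv hPQ hP hRQ hR (fun z a hz ha => (hinv z a hz ha).1)
    (fun z a hz ha => (hinv z a hz ha).2)
  have hφ : ∀ w, (φ w).1 = Sum.elim (fst w) (fibreMap g d (addVar p) (fst w) (snd w)) :=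
    fun _ => rfl
  have hord : ∀ (w : pairs (S ∩ polyVectors k d) (tailModule Q d)) i,
      (evalAt (g i) (fst w)).order = d i := fun w => h.order_eq _ w.2.1.1
  have hφa : ∀ w : pairs (S ∩ polyVectors k d) (tailModule Q d), ∀ a ∈ arcs ι Q,
      snd w = diagMul g (fst w) a →
      (φ w).1 = Sum.elim (fst w) (diagMul g (fst w) (a + substPair p (fst w) a)) := by
    intro w a ha hwa
    have hz : IsCentred (fst w) := isCentred_of_mem_arcs (h.subset_arcs w.2.1.1)
    rw [hφ, fibreMap, hwa, quotVec_diagMul (hord w),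
      substPair_addVar p hz (isCentred_of_mem_arcs ha)]
  have hquot : ∀ w : pairs (S ∩ polyVectors k d) (tailModule Q d),
      quotVec g d (fst w) (snd w) ∈ arcs ι Q ∧
        snd w = diagMul g (fst w) (quotVec g d (fst w) (snd w)) := fun w =>
    ⟨quotVec_mem_arcs (hord w) h.quality_left (h.subset_arcs w.2.1.1) w.2.2,
      (diagMul_quotVec (hord w) (mem_tailModule_iff.1 w.2.2).2).symm⟩
  have hrem : ∀ w, remainder d (((ψ.trans φ).symm w).1) = fst w := fun w =>
    remainder_add w.2.1.2 (mem_tailModule_iff.1 (φ.symm w).2.2).2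
  refine ⟨ψ, φ, (ψ.trans φ).symm, h.isTextileIso_splitEquiv, fun _ => rfl, ⟨?_, ?_⟩,
    fun w => ⟨⟨_, hquot w, fun b hb => ?_⟩, hφa w⟩, rfl, ⟨?_, ?_⟩, hrem, fun w => ?_⟩
  · refine isRationallyTextile_of_mem fun j => ?_
    cases j with
    | inl i => exact fst_mem_coeffSubalgebra _ i
    | inr i => exact h.fibreMap_pairs_mem _ i
  · refine isRationallyTextile_of_mem fun j => ?_
    cases j with
    | inl i => exact fst_mem_coeffSubalgebra _ i
    | inr i => exact h.fibreMap_pairs_mem _ i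
  · rw [hb.2, quotVec_diagMul (hord w)]
  · refine isRationallyTextile_of_mem fun i => ?_
    exact add_mem (fst_mem_coeffSubalgebra _ i) (h.fibreMap_pairs_mem R i)
  -- The inverse of `χ` is `φ ∘ ψ`: its denominators involve y only through the remainder, hence
  -- only low coefficients.
  · refine isRationallyTextile_of_mem fun j => ?_
    have hr : ∀ i, (fun u : S => remainder d u.1 i) ∈ coeffSubalgebra (polyFun (lowCoords d) S) :=
      remainder_mem_coeffSubalgebra d
    cases j with
    | inl i => exact coeffSubalgebra_mono (polyFun_le_ratFun _ _ _) (hr i)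
    | inr i =>
      refine fibreMap_mem_coeffSubalgebra (U := S) (addVar p) (z := fun y => remainder d y.1)
        (v := fun y => y.1 - remainder d y.1)
        (fun y => isCentred_of_mem_arcs (h.subset_arcs (h.remainder_mem y.2).1))
        (fun y => h.order_eq _ (h.remainder_mem y.2).1)
        (fun y => X_pow_dvd_sub_remainder d y.1) hr (fun i => ?_) i
      exact sub_mem (coeffSubalgebra_mono (polyFun_le_ratFun Set.univ _ _)
        (coord_mem_coeffSubalgebra fun _ => Set.mem_univ _))
        (coeffSubalgebra_mono (polyFun_le_ratFun _ _ _) (hr i))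
  -- Write φ⁻¹(z,v) = (z, Δ_g(z)a). Then v = Δ_g(z)(a + p(z,a)), and the expansion at (z,a) is the
  -- asserted formula.
  · let w' := φ.symm w
    let a := quotVec g d (fst w') (snd w')
    have h1 : φ w' = w := φ.apply_symm_apply w
    have h2 := hφa w' a (hquot w').1 (hquot w').2
    rw [h1] at h2
    have hf : fst w' = fst w := by rw [fst, fst, h2]; rfl
    have hs : snd w = diagMul g (fst w') (a + substPair p (fst w') a) := by rw [snd, h2]; rfl
    have h3 := h.expansion (fst w') (h.subset_arcs w'.2.1.1) a (hquot w').1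
    have h4 : (((ψ.trans φ).symm w).1 : ι → PowerSeries k) = fst w' + diagMul g (fst w') a := by
      rw [← (hquot w').2]
      rfl
    rw [h4, h3, hs, ← hf, add_assoc, ← Matrix.mulVec_add]
    congr 2
    funext i
    simp only [diagMul, Pi.add_apply]
    ring

/-! ### Strata are locally closed -/

theorem order_eq_nat_iff_forall {h : PowerSeries k} {n : ℕ} :
    h.order = n ↔ (∀ l < n, PowerSeries.coeff l h = 0) ∧ PowerSeries.coeff n h ≠ 0 := by
  rw [PowerSeries.order_eq_nat, and_comm]

/-- The set of arcs on which finitely many series have prescribed orders. -/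
def orderStratum {ν : Type*} (Q : Quality k) (G : ν → Series k ι) (e : ν → ℕ) :
    Set (ι → PowerSeries k) :=
  {y ∈ arcs ι Q | ∀ j, (evalAt (G j) y).order = e j}

theorem exists_polynomial_coeff_evalAt (Q : Quality k) (f : Series k ι) (l : ℕ) :
    ∃ P : MvPolynomial (ι × ℕ) k, ∀ y ∈ arcs ι Q,
      PowerSeries.coeff l (evalAt f y) = MvPolynomial.eval (coords y) P := by
  have h := evalAt_mem_coeffSubalgebra (A := polyFun Set.univ (arcs ι Q))
    (y := fun u : arcs ι Q => u.1) (fun u => isCentred_of_mem_arcs u.2)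
    (fun i => coord_mem_coeffSubalgebra fun _ => Set.mem_univ _) f
  obtain ⟨P, -, hP⟩ := mem_polyFun.1 (h l)
  exact ⟨P, fun y hy => hP ⟨y, hy⟩⟩

theorem exists_polynomials_orderStratum {ν : Type*} [Fintype ν] (Q : Quality k)
    (G : ν → Series k ι) (e : ν → ℕ) :
    ∃ (F : Set (MvPolynomial (ι × ℕ) k)) (D : MvPolynomial (ι × ℕ) k), ∀ y ∈ arcs ι Q,
      (y ∈ orderStratum Q G e ↔ (∀ P ∈ F, MvPolynomial.eval (coords y) P = 0) ∧
        MvPolynomial.eval (coords y) D ≠ 0) := by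
  choose P hP using fun j l => exists_polynomial_coeff_evalAt Q (G j) l
  -- Lower coefficients vanish; the finitely many leading coefficients are nonzero exactly when
  -- their product is, which leaves a single inequation.
  refine ⟨{R | ∃ j, ∃ l < e j, R = P j l}, ∏ j, P j (e j), fun y hy => ?_⟩
  have h1 : y ∈ orderStratum Q G e ↔ ∀ j, (evalAt (G j) y).order = e j := and_iff_right hy
  simp only [h1, order_eq_nat_iff_forall, hP _ _ y hy, forall_and, map_prod, Finset.prod_ne_zero_iff,
    Finset.mem_univ, true_implies]
  refine and_congr_left fun _ => ⟨?_, fun H j l hl => H _ ⟨j, l, hl, rfl⟩⟩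
  rintro H _ ⟨j, l, hl, rfl⟩
  exact H j l hl

theorem isTextileLocallyClosed_orderStratum {ν : Type*} [Fintype ν] (Q : Quality k)
    (G : ν → Series k ι) (e : ν → ℕ) : IsTextileLocallyClosed Q (orderStratum Q G e) := by
  obtain ⟨F, D, h⟩ := exists_polynomials_orderStratum Q G e
  refine ⟨F, {D}, Set.ext fun y => ?_⟩
  by_cases hy : y ∈ arcs ι Q
  · simp [h y hy, hy]
  · have : y ∉ orderStratum Q G e := fun h => hy h.1
    simp [this, hy]

theorem isQuasiAffine_orderStratum {ν : Type*} [Fintype ν] (Q : Quality k)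
    (G : ν → Series k ι) (e : ν → ℕ) (d : ι → ℕ) :
    IsQuasiAffine d (orderStratum Q G e ∩ polyVectors k d) := by
  obtain ⟨F, D, h⟩ := exists_polynomials_orderStratum Q G e
  -- Equations in all coefficients restrict to ℛ_d: the coefficients of degree 1 to d_i become
  -- affine coordinates, all others become zero.
  let c : ι × ℕ → MvPolynomial (Σ i, Fin (d i)) k := fun il =>
    if h : 1 ≤ il.2 ∧ il.2 ≤ d il.1 then MvPolynomial.X ⟨il.1, ⟨il.2 - 1, by omega⟩⟩ else 0
  have hc : ∀ x P, MvPolynomial.eval x (MvPolynomial.bind₁ c P) =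
      MvPolynomial.eval (coords (ofAffineCoords d x)) P := fun x P => by
    rw [MvPolynomial.eval, MvPolynomial.eval₂Hom_bind₁]
    congr 2
    funext il
    simp only [c, coords, ofAffineCoords, PowerSeries.coeff_mk]
    split_ifs <;> simp
  refine ⟨Set.inter_subset_right, MvPolynomial.bind₁ c '' F, {MvPolynomial.bind₁ c D},
    Set.ext fun x => ?_⟩
  have h1 : x ∈ affineCoords d '' (orderStratum Q G e ∩ polyVectors k d) ↔
      ofAffineCoords d x ∈ orderStratum Q G e := by
    constructor
    · rintro ⟨z, ⟨hz, hzp⟩, rfl⟩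
      rwa [ofAffineCoords_affineCoords hzp]
    · exact fun hx => ⟨_, ⟨hx, ofAffineCoords_mem_polyVectors d x⟩, affineCoords_ofAffineCoords d x⟩
  rw [h1, h _ (polyVectors_subset_arcs Q d (ofAffineCoords_mem_polyVectors d x))]
  simp [hc]

/-! ### Division modules -/

/-- 𝒱_d lies in 𝒢(y), so 𝒢(y) = 𝒢(y + v); equal modules force g_i(y) and g_i(y + v) to divide each
other, hence to have the same order. -/
theorem multiStratum_stable {Q : Quality k} {f : κ → Series k ι} {g : ι → Series k ι}
    (hg : IsDivisionModule Q f g) {d : ι → ℕ} {y v : ι → PowerSeries k}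
    (hy : y ∈ multiStratum Q g d) (hv : v ∈ tailModule Q d) : y + v ∈ multiStratum Q g d := by
  classical
  have hv' := mem_tailModule_iff.1 hv
  have hmod := hg.stable y hy.1 v ⟨_, quotVec_mem_arcs hy.2 hg.quality hy.1 hv,
    (diagMul_quotVec hy.2 hv'.2).symm⟩
  have key : ∀ z z', moduleAt Q g z ⊆ moduleAt Q g z' →
      ∀ i, evalAt (g i) z' ∣ evalAt (g i) z := fun z z' hzz i => by
    -- The constant 1 is not in 𝒜_∘, so the inclusion is tested on g_i(z)t = g_i(z')b_i; here t
    -- divides b_i and cancels.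
    have hX : (fun _ => PowerSeries.X) ∈ arcs ι Q :=
      mem_arcs_iff.2 ⟨fun _ => X_mem_qualitySubring Q (), fun _ => by simp⟩
    obtain ⟨b, hb, hbz⟩ := hzz ⟨_, hX, rfl⟩
    obtain ⟨c, hc⟩ := PowerSeries.X_dvd_iff.2 (hb i).2
    refine ⟨c, mul_right_cancel₀ (PowerSeries.X_ne_zero (R := k)) ?_⟩
    have := congrFun hbz i
    simp only [diagMul, hc] at this
    rw [this]
    ring
  refine ⟨fun i => ⟨add_mem (s := Q.subring Unit) (hy.1 i).1 (hv'.1 i), ?_⟩, fun i => ?_⟩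
  · rw [Pi.add_apply, map_add, (hy.1 i).2, isCentred_of_dvd hv'.2 i, add_zero]
  · rw [← hy.2 i]
    have hle : ∀ {a b : PowerSeries k}, a ∣ b → a.order ≤ b.order := by
      rintro a _ ⟨c, rfl⟩
      rw [PowerSeries.order_mul]
      exact le_self_add
    exact le_antisymm (hle (key _ _ hmod.subset i)) (hle (key _ _ hmod.symm.subset i))

theorem IsDivisionRemainder.mem_orderIdeal {Q : Quality k} {f : κ → Series k ι}
    {g : ι → Series k ι} {p : ι → Series k (ι ⊕ ι)} (hp : IsDivisionRemainder Q f g p) (i : ι) :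
    p i ∈ orderIdeal k _ 2 := by
  intro e he
  by_contra h
  have h1 := hp.order_two i e h
  have h2 : ∑ j, e (some (Sum.inr j)) ≤ e.degree := by
    rw [Finsupp.degree_eq_sum, Fintype.sum_option, Fintype.sum_sum_type]
    omega
  exact absurd he (not_lt.2 (h1.trans h2))

theorem isLinearizable_multiStratum {Q : Quality k} {f : κ → Series k ι} {g : ι → Series k ι}
    {p : ι → Series k (ι ⊕ ι)} (hg : IsDivisionModule Q f g) (hp : IsDivisionRemainder Q f g p)
    (d : ι → ℕ) : IsLinearizable Q f g p d (multiStratum Q g d) where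
  quality_left := hg.quality
  quality_right := hp.quality
  order_two := hp.mem_orderIdeal
  expansion := hp.expansion
  subset_arcs _ hy := hy.1
  order_eq _ hy := hy.2
  stable _ hy _ hv := multiStratum_stable hg hy hv

end Charts

/-! ### The Taylor remainder for a minor of the Jacobian. -/

section Minors

variable {k : Type*} [Field k] {ι : Type*}

/-! ### Second order Taylor quotients -/

/-- The variables `t, z` among `t, z, a`. -/
def baseVars (k : Type*) [Field k] (ι : Type*) : Option ι → Series k (ι ⊕ ι) :=
  fun o => X (o.map Sum.inl)

/-- The increments `0, G a`. -/
def increments (G : Series k (ι ⊕ ι)) : Option ι → Series k (ι ⊕ ι) :=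
  fun o => o.elim 0 fun j => G * X (some (Sum.inr j))

theorem baseVars_mem (o : Option ι) : baseVars k ι o ∈ orderIdeal k _ 1 := X_mem_orderIdeal _

theorem increments_mem (G : Series k (ι ⊕ ι)) (o : Option ι) :
    increments G o ∈ orderIdeal k _ 1 := by
  cases o with
  | none => exact Ideal.zero_mem _
  | some j => exact Ideal.mul_mem_left _ _ (X_mem_orderIdeal _)

theorem stratum_eq_orderStratum (Q : Quality k) (g : Series k ι) (d : ℕ) :
    stratum Q g d = orderStratum Q (fun _ : Unit => g) fun _ => d := by
  ext y
  simp [stratum, orderStratum]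

variable [Fintype ι]

/-- The increment G(z)a enters the Taylor remainder at least quadratically, so G(z)² factors out.
The quality of the quotient is seen by first taking s·a with a new variable s, dividing by s², and
then substituting s = G(z). -/
theorem exists_taylor_quotient {Q : Quality k} {f G : Series k ι} (hf : Q.Has f) (hG : Q.Has G) :
    ∃ r : Series k (ι ⊕ ι), Q.Has r ∧ r ∈ orderIdeal k _ 2 ∧
      subst (baseVars k ι + increments (subst (baseVars k ι) G)) f =
        subst (baseVars k ι) f +
          ∑ o, increments (subst (baseVars k ι) G) o * subst (baseVars k ι) (pderiv k o f) +
          subst (baseVars k ι) G ^ 2 * r := by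
  let x := baseVars k ι
  have hx1 := baseVars_mem (k := k) (ι := ι)
  have sx := hasSubst_of_mem hx1
  have hxQ : ∀ o, x o ∈ Q.subring _ := fun o => X_mem_qualitySubring Q _
  have hGx : subst x G ∈ Q.subring _ := subst_mem_qualitySubring Q hxQ hx1 hG
  by_cases h0 : constantCoeff G = 0
  · have hGx1 : subst x G ∈ orderIdeal k _ 1 :=
      subst_mem_orderIdeal hx1 (mem_orderIdeal_one.2 h0)
    let x' : Option ι → MvPowerSeries (Option (Option (ι ⊕ ι))) k :=
      fun o => X (some (o.map Sum.inl))
    let δ' : Option ι → MvPowerSeries (Option (Option (ι ⊕ ι))) k :=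
      fun o => o.elim 0 fun j => X none * X (some (some (Sum.inr j)))
    have hx'1 : ∀ o, x' o ∈ orderIdeal k _ 1 := fun o => X_mem_orderIdeal _
    have hδ'2 : ∀ o, δ' o ∈ orderIdeal k _ 2 := fun o => by
      cases o with
      | none => exact Ideal.zero_mem _
      | some j => exact mul_mem_orderIdeal (X_mem_orderIdeal _) (X_mem_orderIdeal _)
    have hδ'1 : ∀ o, δ' o ∈ orderIdeal k _ 1 := fun o => orderIdeal_anti one_le_two (hδ'2 o)
    have hx'δ'1 : ∀ o, (x' + δ') o ∈ orderIdeal k _ 1 :=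
      fun o => Ideal.add_mem _ (hx'1 o) (hδ'1 o)
    have hx'Q : ∀ o, x' o ∈ Q.subring _ := fun o => X_mem_qualitySubring Q _
    have hδ'Q : ∀ o, δ' o ∈ Q.subring _ := fun o => by
      cases o with
      | none => exact zero_mem _
      | some j => exact mul_mem (X_mem_qualitySubring Q _) (X_mem_qualitySubring Q _)
    -- The increments s·a_j have order two, so the remainder has order at least four, and dividing
    -- by s² leaves the required order two.
    have h4 := subst_add_sub_mem hx'1 hδ'1 (E := degreeBelow _ 4)
      (fun i j => mul_mem_orderIdeal (hδ'2 i) (hδ'2 j)) f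
    have hs := subst_add_sub_mem hx'1 hδ'1 (E := exponentBelow none 2) (fun i j => by
      rw [mem_coeffIdeal_exponentBelow, pow_two]
      refine mul_dvd_mul ?_ ?_
      · cases i <;> simp [δ']
      · cases j <;> simp [δ']) f
    rw [mem_coeffIdeal_exponentBelow] at hs
    obtain ⟨H, hH⟩ := hs
    rw [hH] at h4
    have hH2 : H ∈ orderIdeal k _ 2 := fun e he => by
      have he' : e.degree < 2 := he
      have h5 := h4 (Finsupp.single none 2 + e) (show Finsupp.degree _ < 4 by
        rw [map_add, Finsupp.degree_single]; omega)
      rwa [X_pow_eq, coeff_add_monomial_mul, one_mul] at h5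
    have hHQ : H ∈ Q.subring _ := by
      refine mem_qualitySubring_of_X_pow_mul Q (s := none) (n := 2) ?_
      rw [← hH]
      refine sub_mem (sub_mem ?_ ?_) (sum_mem fun o _ => mul_mem (hδ'Q o) ?_)
      · exact subst_mem_qualitySubring Q (fun o => add_mem (hx'Q o) (hδ'Q o)) hx'δ'1 hf
      · exact subst_mem_qualitySubring Q hx'Q hx'1 hf
      · exact subst_mem_qualitySubring Q hx'Q hx'1 (pderiv_mem_qualitySubring Q hf o)
    let c : Option (Option (ι ⊕ ι)) → Series k (ι ⊕ ι) := fun o => o.elim (subst x G) X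
    have hc1 : ∀ o, c o ∈ orderIdeal k _ 1 := fun o => by
      cases o with
      | none => exact hGx1
      | some o => exact X_mem_orderIdeal o
    have hcQ : ∀ o, c o ∈ Q.subring _ := fun o => by
      cases o with
      | none => exact hGx
      | some o => exact X_mem_qualitySubring Q o
    have sc := hasSubst_of_mem hc1
    refine ⟨subst c H, subst_mem_qualitySubring Q hcQ hc1 hHQ, subst_mem_orderIdeal hc1 hH2, ?_⟩
    have hcx' : ∀ o, subst c (x' o) = x o := fun o => subst_X sc _
    have hcδ' : ∀ o, subst c (δ' o) = increments (subst x G) o := fun o => by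
      cases o with
      | none =>
        change subst c (0 : MvPowerSeries _ k) = 0
        rw [← substAlgHom_apply (R := k) sc, map_zero]
      | some j =>
        change subst c (X none * X (some (some (Sum.inr j))) : MvPowerSeries _ k) = _
        rw [subst_mul sc, subst_X sc, subst_X sc]
        rfl
    have hcc : ∀ h : Series k ι, subst c (subst x' h) = subst x h := fun h => by
      rw [subst_comp_subst_apply (hasSubst_of_mem hx'1) sc, funext hcx']
    have h6 := congrArg (substAlgHom (R := k) sc) hH
    simp only [map_sub, map_sum, map_mul, map_pow, substAlgHom_apply, hcc, hcδ', subst_X sc] at h6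
    rw [subst_comp_subst_apply (hasSubst_of_mem hx'δ'1) sc] at h6
    have h7 : (fun o => subst c ((x' + δ') o)) = x + increments (subst x G) := by
      funext o
      rw [Pi.add_apply, subst_add sc, hcx', hcδ', Pi.add_apply]
    rw [h7] at h6
    change _ = (subst x G) ^ 2 * _ at h6
    linear_combination h6
  -- Substituting s = G(z) is not allowed when G has a constant term; but then G is a unit and can
  -- be divided out directly.
  · have hG0 : constantCoeff (subst x G) ≠ 0 := by
      have h1 : subst x (G - C (constantCoeff G)) ∈ orderIdeal k _ 1 :=
        subst_mem_orderIdeal hx1 (mem_orderIdeal_one.2 (by simp))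
      rw [mem_orderIdeal_one, subst_sub sx, subst_C_eq sx, map_sub, constantCoeff_C,
        sub_eq_zero] at h1
      rwa [h1]
    have hδ1 := increments_mem (subst x G)
    have hδQ : ∀ o, increments (subst x G) o ∈ Q.subring _ := fun o => by
      cases o with
      | none => exact zero_mem _
      | some j => exact mul_mem hGx (X_mem_qualitySubring Q _)
    have h2 := subst_add_sub_mem hx1 hδ1 (E := degreeBelow _ 2)
      (fun i j => mul_mem_orderIdeal (hδ1 i) (hδ1 j)) f
    refine ⟨((subst x G)⁻¹) ^ 2 * _, ?_, Ideal.mul_mem_left _ _ h2, ?_⟩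
    · refine mul_mem (pow_mem (inv_mem_qualitySubring Q hGx hG0) 2)
        (sub_mem (sub_mem ?_ ?_) (sum_mem fun o _ => mul_mem (hδQ o) ?_))
      · exact subst_mem_qualitySubring Q (fun o => add_mem (hxQ o) (hδQ o))
          (fun o => Ideal.add_mem _ (hx1 o) (hδ1 o)) hf
      · exact subst_mem_qualitySubring Q hxQ hx1 hf
      · exact subst_mem_qualitySubring Q hxQ hx1 (pderiv_mem_qualitySubring Q hf o)
    · rw [← mul_assoc, ← mul_pow, MvPowerSeries.mul_inv_cancel _ hG0]
      ring

theorem evalAt_subst_baseVars {z a : ι → PowerSeries k} (hz : IsCentred z) (ha : IsCentred a)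
    (h : Series k ι) : evalAt (subst (baseVars k ι) h) (Sum.elim z a) = evalAt h z := by
  have hc := isCentred_sumElim hz ha
  rw [evalAt_subst hc baseVars_mem rfl]
  congr 1
  funext i
  exact evalAt_X_some hc (Sum.inl i)

theorem evalAt_increments {z a : ι → PowerSeries k} (hz : IsCentred z) (ha : IsCentred a)
    (G : Series k ι) (j : ι) :
    evalAt (increments (subst (baseVars k ι) G) (some j)) (Sum.elim z a) =
      evalAt G z * a j := by
  have hc := isCentred_sumElim hz ha
  rw [← evalHom_apply hc]
  change evalHom hc (_ * X (some (Sum.inr j))) = _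
  rw [map_mul, evalHom_apply, evalHom_apply, evalAt_subst_baseVars hz ha, evalAt_X_some hc]
  rfl

theorem evalAt_taylor {f G : Series k ι} {r : Series k (ι ⊕ ι)}
    (h : subst (baseVars k ι + increments (subst (baseVars k ι) G)) f =
        subst (baseVars k ι) f +
          ∑ o, increments (subst (baseVars k ι) G) o * subst (baseVars k ι) (pderiv k o f) +
          subst (baseVars k ι) G ^ 2 * r)
    {z a : ι → PowerSeries k} (hz : IsCentred z) (ha : IsCentred a) :
    evalAt f (z + diagMul (fun _ => G) z a) = evalAt f z +
      ∑ j, evalAt (pderiv k (some j) f) z * (evalAt G z * a j) +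
      evalAt G z ^ 2 * evalAt r (Sum.elim z a) := by
  have hc := isCentred_sumElim hz ha
  have h1 := congrArg (evalHom hc) h
  simp only [map_add, map_sum, map_mul, map_pow, evalHom_apply, evalAt_subst_baseVars hz ha,
    Fintype.sum_option, evalAt_increments hz ha] at h1
  have hmem : ∀ o, (baseVars k ι + increments (subst (baseVars k ι) G)) o ∈ orderIdeal k _ 1 :=
    fun o => Ideal.add_mem _ (baseVars_mem o) (increments_mem _ o)
  have hnone : (baseVars k ι + increments (subst (baseVars k ι) G)) none = X none := add_zero _
  rw [evalAt_subst hc hmem hnone] at h1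
  have h2 : (fun i => evalAt ((baseVars k ι + increments (subst (baseVars k ι) G)) (some i))
      (Sum.elim z a)) = z + diagMul (fun _ => G) z a := by
    funext i
    rw [Pi.add_apply, ← evalHom_apply hc, map_add, evalHom_apply, evalHom_apply,
      evalAt_increments hz ha]
    congr 1
    exact evalAt_X_some hc (Sum.inl i)
  have h3 : evalAt (increments (subst (baseVars k ι) G) none) (Sum.elim z a) = 0 := by
    rw [← evalHom_apply hc]
    exact map_zero _
  rw [h2, h3, zero_mul, zero_add] at h1
  rw [h1]
  congr 2
  exact Finset.sum_congr rfl fun j _ => mul_comm _ _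

/-! ### Strata of a minor -/

theorem minor_mem_qualitySubring {Q : Quality k} {r : ℕ} {f : Fin r → Series k ι}
    (hf : ∀ i, Q.Has (f i)) (e : Fin r ↪ ι) : minor f e ∈ Q.subring _ :=
  det_mem_of_forall_mem _ fun i _ => pderiv_mem_qualitySubring Q (hf i) _

/-- With M the submatrix of columns `e` and R the vector of Taylor quotients, g²R = M·g·adj(M)R. So
p is adj(M)R placed in the rows `e`, and zero elsewhere. -/
theorem exists_minor_remainder {Q : Quality k} {r : ℕ} {f : Fin r → Series k ι}
    (hf : ∀ i, Q.Has (f i)) (e : Fin r ↪ ι) :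
    ∃ p : ι → Series k (ι ⊕ ι), (∀ i, Q.Has (p i)) ∧ (∀ i, p i ∈ orderIdeal k _ 2) ∧
      ∀ z a, IsCentred z → IsCentred a →
        (fun i => evalAt (f i) (z + diagMul (fun _ => minor f e) z a)) =
        (fun i => evalAt (f i) z) +
          (jacobianAt f z).mulVec (diagMul (fun _ => minor f e) z a) +
          (jacobianAt f z).mulVec (diagMul (fun _ => minor f e) z (substPair p z a)) := by
  classical
  let M := (jacobian f).submatrix id e
  choose R hRQ hR2 hR using fun i => exists_taylor_quotient (hf i) (minor_mem_qualitySubring hf e)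
  let p : ι → Series k (ι ⊕ ι) := fun j => ∑ c, if e c = j then
    ∑ i, subst (baseVars k ι) (M.adjugate c i) * R i else 0
  refine ⟨p, fun j => ?_, fun j => ?_, fun z a hz ha => ?_⟩
  · change _ ∈ Q.subring _
    refine sum_mem fun c _ => ?_
    split_ifs
    · refine sum_mem fun i _ => mul_mem ?_ (hRQ i)
      exact subst_mem_qualitySubring Q (fun o => X_mem_qualitySubring Q _) baseVars_mem
        (adjugate_mem_of_forall_mem _ (fun i _ => pderiv_mem_qualitySubring Q (hf i) _) c i)
    · exact zero_mem _
  · refine Ideal.sum_mem _ fun c _ => ?_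
    split_ifs
    · exact Ideal.sum_mem _ fun i _ => Ideal.mul_mem_left _ _ (hR2 i)
    · exact Ideal.zero_mem _
  · have hc := isCentred_sumElim hz ha
    have hp : ∀ j, evalAt (p j) (Sum.elim z a) = ∑ c, if e c = j then
        ∑ i, evalAt (M.adjugate c i) z * evalAt (R i) (Sum.elim z a) else 0 := fun j => by
      rw [← evalHom_apply hc, map_sum]
      refine Finset.sum_congr rfl fun c _ => ?_
      split_ifs
      · simp only [map_sum, map_mul, evalHom_apply, evalAt_subst_baseVars hz ha]
      · exact map_zero _
    have hadj : ∀ i i', ∑ c, evalAt (M i c) z * evalAt (M.adjugate c i') z =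
        if i = i' then evalAt (minor f e) z else 0 := fun i i' => by
      have h1 := congrArg (evalHom hz) (congrFun (congrFun (Matrix.mul_adjugate M) i) i')
      rw [Matrix.mul_apply, Matrix.smul_apply, Matrix.one_apply] at h1
      simp only [map_sum, map_mul, evalHom_apply, smul_eq_mul] at h1
      rw [h1]
      split_ifs
      · rw [← evalHom_apply hz 1, map_one, mul_one]; rfl
      · rw [← evalHom_apply hz 0, map_zero, mul_zero]
    funext i
    rw [evalAt_taylor (hR i) hz ha, Pi.add_apply, Pi.add_apply]
    congr 1
    have h2 : (jacobianAt f z).mulVec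
        (diagMul (fun _ => minor f e) z (substPair p z a)) i =
        evalAt (minor f e) z * ∑ c, evalAt (M i c) z *
          ∑ i', evalAt (M.adjugate c i') z * evalAt (R i') (Sum.elim z a) := by
      have h3 : ∀ j, jacobianAt f z i j * diagMul (fun _ => minor f e) z (substPair p z a) j =
          ∑ c, if e c = j then evalAt (minor f e) z * (jacobianAt f z i j *
            ∑ i', evalAt (M.adjugate c i') z * evalAt (R i') (Sum.elim z a)) else 0 := fun j => by
        rw [diagMul, substPair, hp, Finset.mul_sum, Finset.mul_sum]
        refine Finset.sum_congr rfl fun c _ => ?_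
        split_ifs
        · ring
        · ring
      rw [Matrix.mulVec, dotProduct, Finset.sum_congr rfl fun j _ => h3 j, Finset.sum_comm,
        Finset.mul_sum]
      refine Finset.sum_congr rfl fun c _ => ?_
      rw [Finset.sum_ite_eq, if_pos (Finset.mem_univ _)]
      rfl
    rw [h2]
    simp_rw [Finset.mul_sum, ← mul_assoc]
    rw [Finset.sum_comm]
    have h4 : ∀ i', ∑ c, evalAt (minor f e) z * evalAt (M i c) z * evalAt (M.adjugate c i') z *
        evalAt (R i') (Sum.elim z a) = if i = i' then
          evalAt (minor f e) z ^ 2 * evalAt (R i') (Sum.elim z a) else 0 := fun i' => by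
      rw [← Finset.sum_mul]
      simp_rw [mul_assoc]
      rw [← Finset.mul_sum, hadj]
      split_ifs <;> ring
    rw [Finset.sum_congr rfl fun i' _ => h4 i', Finset.sum_ite_eq, if_pos (Finset.mem_univ _)]

theorem isLinearizable_stratum {Q : Quality k} {r : ℕ} {f : Fin r → Series k ι}
    (hf : ∀ i, Q.Has (f i)) (e : Fin r ↪ ι) (d : ℕ) :
    ∃ p, IsLinearizable Q f (fun _ => minor f e) p (fun _ => d) (stratum Q (minor f e) d) := by
  obtain ⟨p, hpQ, hp2, hp⟩ := exists_minor_remainder hf e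
  refine ⟨p, fun _ => minor_mem_qualitySubring hf e, hpQ, hp2, fun z hz a ha =>
    hp z a (isCentred_of_mem_arcs hz) (isCentred_of_mem_arcs ha), fun y hy => hy.1,
    fun y hy _ => hy.2, fun y hy v hv => ?_⟩
  have hva := tailModule_subset_arcs Q _ hv
  have hyv : y + v ∈ arcs ι Q := mem_arcs_iff.2 ⟨fun i =>
    add_mem (s := Q.subring Unit) (hy.1 i).1 (hva i).1, fun i => by
      rw [Pi.add_apply, map_add, (hy.1 i).2, (hva i).2, add_zero]⟩
  refine ⟨hyv, ?_⟩
  -- Changing y by a multiple of t^{d+1} leaves g(y) unchanged modulo t^{d+1}, and this part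
  -- determines whether the order is d.
  have h1 := X_pow_dvd_evalAt_sub (isCentred_of_mem_arcs hyv) (isCentred_of_mem_arcs hy.1)
    (n := d + 1) (fun i => by
      rw [Pi.add_apply, add_sub_cancel_left]
      exact (mem_tailModule_iff.1 hv).2 i) (minor f e)
  have h2 : ∀ l < d + 1, PowerSeries.coeff l (evalAt (minor f e) (y + v)) =
      PowerSeries.coeff l (evalAt (minor f e) y) := fun l hl => by
    have := PowerSeries.X_pow_dvd_iff.1 h1 l hl
    rwa [map_sub, sub_eq_zero] at this
  have h3 := PowerSeries.order_eq_nat.1 hy.2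
  rw [PowerSeries.order_eq_nat]
  exact ⟨by rw [h2 d (Nat.lt_succ_self d)]; exact h3.1, fun i hi => by
    rw [h2 i (by omega)]; exact h3.2 i hi⟩

end Minors

/-! ### Arquile density and the partition into strata. -/

section Density

variable {k : Type*} [Field k]

/-! ### Arquile density -/

/-- Induction on the number of weights: among the exponents with smallest last entry a winner is
chosen by induction, then the last weight is made so large that every other exponent loses. The
weight of t stays 1. -/
theorem exists_separating_weights (m : ℕ) {T : Set (ℕ × (Fin m → ℕ))} (hT : T.Nonempty) :
    ∃ α ∈ T, ∃ N : Fin m → ℕ, (∀ i, 1 ≤ N i) ∧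
      ∀ β ∈ T, β ≠ α → α.1 + ∑ i, N i * α.2 i < β.1 + ∑ i, N i * β.2 i := by
  induction m with
  | zero =>
    obtain ⟨α, hα, hmin⟩ := WellFounded.has_min (measure fun α : ℕ × (Fin 0 → ℕ) => α.1).wf T hT
    refine ⟨α, hα, fun _ => 1, fun _ => le_rfl, fun β hβ hne => ?_⟩
    have h1 : ¬ β.1 < α.1 := hmin β hβ
    have h2 : β.1 ≠ α.1 := fun h => hne (Prod.ext h (Subsingleton.elim _ _))
    simp
    omega
  | succ m ih =>
    obtain ⟨α₁, hα₁, hmin⟩ := WellFounded.has_min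
      (measure fun α : ℕ × (Fin (m + 1) → ℕ) => α.2 (Fin.last m)).wf T hT
    let T' : Set (ℕ × (Fin m → ℕ)) :=
      {α' | ∃ α ∈ T, α.2 (Fin.last m) = α₁.2 (Fin.last m) ∧ α' = (α.1, Fin.init α.2)}
    obtain ⟨_, ⟨α, hα, hlast, rfl⟩, N, hN, hlt⟩ := ih (T := T') ⟨_, α₁, hα₁, rfl, rfl⟩
    let c := α.1 + ∑ i, N i * α.2 (Fin.castSucc i)
    -- c is the winner's weight without its last entry, so one extra unit in that entry, with weight
    -- c + 1, already exceeds it.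
    refine ⟨α, hα, Fin.snoc N (c + 1), fun i => ?_, fun β hβ hne => ?_⟩
    · refine Fin.lastCases ?_ (fun i => ?_) i
      · rw [Fin.snoc_last]; omega
      · rw [Fin.snoc_castSucc]; exact hN i
    · have h1 : ¬ β.2 (Fin.last m) < α₁.2 (Fin.last m) := hmin β hβ
      simp only [Fin.sum_univ_castSucc, Fin.snoc_castSucc, Fin.snoc_last]
      rcases eq_or_lt_of_le (not_lt.1 h1) with h2 | h2
      · have hne' : (β.1, Fin.init β.2) ≠ (α.1, Fin.init α.2) := fun h => by
          refine hne (Prod.ext (Prod.ext_iff.1 h).1 (funext fun i => ?_))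
          refine Fin.lastCases ?_ (fun i => ?_) i
          · rw [hlast, h2]
          · exact congrFun (Prod.ext_iff.1 h).2 i
        have h3 := hlt (β.1, Fin.init β.2) ⟨β, hβ, h2.symm, rfl⟩ hne'
        simp only [Fin.init] at h3
        rw [hlast, ← h2]
        omega
      · rw [hlast]
        have h3 : (c + 1) * (α₁.2 (Fin.last m) + 1) ≤ (c + 1) * β.2 (Fin.last m) :=
          Nat.mul_le_mul_left _ h2
        have h4 : c = α.1 + ∑ i, N i * α.2 (Fin.castSucc i) := rfl
        rw [mul_add] at h3
        omega

/-- On y_i = t^{N_i} every monomial becomes a power of t. Separating weights make one exponent of h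
the unique minimum, so its term cannot cancel, whatever the field. -/
theorem exists_evalAt_ne_zero (Q : Quality k) {m : ℕ} {h : Series k (Fin m)} (hh : h ≠ 0) :
    ∃ y ∈ arcs (Fin m) Q, evalAt h y ≠ 0 := by
  let T : Set (ℕ × (Fin m → ℕ)) :=
    {α | ∃ d : Option (Fin m) →₀ ℕ, coeff d h ≠ 0 ∧ α = (d none, fun i => d (some i))}
  obtain ⟨d₀, hd₀⟩ : ∃ d, coeff d h ≠ 0 := by
    by_contra! H
    exact hh (MvPowerSeries.ext H)
  obtain ⟨_, ⟨d, hd, rfl⟩, N, hN, hlt⟩ := exists_separating_weights m (T := T) ⟨_, d₀, hd₀, rfl⟩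
  let y : Fin m → PowerSeries k := fun i => PowerSeries.X ^ N i
  have hy : y ∈ arcs (Fin m) Q := mem_arcs_iff.2
    ⟨fun i => pow_mem (X_mem_qualitySubring Q ()) _, fun i => by
      simp only [y]
      rw [map_pow, PowerSeries.constantCoeff_X, zero_pow (Nat.one_le_iff_ne_zero.1 (hN i))]⟩
  refine ⟨y, hy, fun h0 => hd ?_⟩
  let w : (Option (Fin m) →₀ ℕ) → ℕ := fun e => e none + ∑ i, N i * e (some i)
  have hprod : ∀ e : Option (Fin m) →₀ ℕ,
      e.prod (fun o n => (o.elim PowerSeries.X y : MvPowerSeries Unit k) ^ n) =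
        (PowerSeries.X ^ w e : PowerSeries k) := fun e => by
    rw [Finsupp.prod_fintype _ _ fun _ => pow_zero _, Fintype.prod_option]
    simp only [Option.elim_none, Option.elim_some, w, y, ← pow_mul, Finset.prod_pow_eq_pow_sum]
    rw [pow_add]
  have h1 : MvPowerSeries.coeff (Finsupp.single () (w d)) (evalAt h y) = 0 := by
    rw [h0, map_zero]
  rw [evalAt, coeff_subst (hasSubst_arcVec (isCentred_of_mem_arcs hy)),
    finsum_eq_single _ d] at h1
  · rw [hprod] at h1
    have h2 : MvPowerSeries.coeff (Finsupp.single () (w d)) (PowerSeries.X ^ w d : PowerSeries k)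
        = 1 := PowerSeries.coeff_X_pow_self _
    rwa [h2, smul_eq_mul, mul_one] at h1
  · intro e he
    by_cases hc : coeff e h = 0
    · rw [hc, zero_smul]
    · have h2 : w d < w e := hlt _ ⟨e, hc, rfl⟩ fun h => he (Finsupp.ext fun o => by
        cases o with
        | none => exact congrArg Prod.fst h
        | some i => exact congrFun (congrArg Prod.snd h) i)
      rw [hprod]
      have h3 : MvPowerSeries.coeff (Finsupp.single () (w d))
          (PowerSeries.X ^ w e : PowerSeries k) = 0 := by
        refine (PowerSeries.coeff_X_pow (w d) (w e)).trans (if_neg h2.ne)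
      rw [h3, smul_zero]

variable {m : ℕ} {Q : Quality k} {g : Series k (Fin m)}

theorem isArquileOpen_ne_zero (hg : Q.Has g) :
    IsArquileOpen Q {y ∈ arcs (Fin m) Q | evalAt g y ≠ 0} := by
  refine ⟨fun y hy => hy.1, {g}, by simpa using hg, Set.ext fun y => ?_⟩
  simp

/-- If h vanishes wherever g does not, then gh vanishes on all arcs, so gh = 0, and h = 0 in the
domain of power series. -/
theorem isArquileDense_ne_zero (hg : g ≠ 0) :
    IsArquileDense Q {y ∈ arcs (Fin m) Q | evalAt g y ≠ 0} := by
  rintro Y ⟨F, -, rfl⟩ hS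
  refine Set.Subset.antisymm (fun y hy => hy.1) fun y hy => ⟨hy, fun h hh => ?_⟩
  suffices h0 : h = 0 by
    rw [h0, ← evalHom_apply (isCentred_of_mem_arcs hy), map_zero]
  by_contra h0
  obtain ⟨x, hx, hgx⟩ := exists_evalAt_ne_zero Q (mul_ne_zero hg h0)
  have hc := isCentred_of_mem_arcs hx
  rw [← evalHom_apply hc, map_mul, evalHom_apply, evalHom_apply] at hgx
  exact right_ne_zero_of_mul hgx ((hS ⟨hx, left_ne_zero_of_mul hgx⟩).2 h hh)

theorem ne_zero_eq_iUnion_stratum :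
    {y ∈ arcs (Fin m) Q | evalAt g y ≠ 0} = ⋃ d, stratum Q g d := by
  ext y
  simp only [Set.mem_iUnion, stratum, Set.mem_ofPred_eq, exists_and_left]
  refine and_congr_right fun _ => ⟨fun h => ?_, fun ⟨d, hd⟩ => ne_zero_of_order_eq hd⟩
  have h1 := PowerSeries.order_eq_top.not.2 h
  exact ⟨_, (ENat.natCast_toNat h1).symm⟩

theorem pairwise_disjoint_stratum :
    Pairwise (Function.onFun Disjoint (stratum Q g)) := by
  intro d d' hdd'
  refine Set.disjoint_left.2 fun y hy hy' => hdd' ?_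
  exact_mod_cast hy.2.symm.trans hy'.2

end Density

end

end Arquile

theorem mainTheorem3 {k : Type*} [Field k] [PerfectField k] (Q : Quality k) {r m : ℕ}
    (f : Fin r → Series k (Fin m)) (hf : ∀ i, Q.Has (f i)) :
    -- strata of an `r × r` minor `g` of the Jacobian: linearization with explicit factors
    (∀ (e : Fin r ↪ Fin m) (d : ℕ),
      IsTextileLocallyClosed Q (stratum Q (minor f e) d) ∧
      IsQuasiAffine (fun _ : Fin m => d) (polyStratum Q (minor f e) d) ∧
      IsFreeSubmodule Q (tailModule Q fun _ : Fin m => d) ∧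
      ∃ χ : pairs (polyStratum Q (minor f e) d) (tailModule Q fun _ => d) ≃
          stratum Q (minor f e) d,
        IsRationallyTextileIso (fstCoords (Fin m)) (lowCoords fun _ => d) χ ∧
        (∀ w, remainder (fun _ => d) (χ w).1 = fst w) ∧
        ∀ w, (fun i => evalAt (f i) (χ w).1) =
          (fun i => evalAt (f i) (fst w)) + (jacobianAt f (fst w)).mulVec (snd w)) ∧
    -- the strata of a nonzero minor partition an arquile open dense set
    (∀ e : Fin r ↪ Fin m, minor f e ≠ 0 →
      IsArquileOpen Q {y ∈ arcs (Fin m) Q | evalAt (minor f e) y ≠ 0} ∧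
      IsArquileDense Q {y ∈ arcs (Fin m) Q | evalAt (minor f e) y ≠ 0} ∧
      {y ∈ arcs (Fin m) Q | evalAt (minor f e) y ≠ 0} = ⋃ d, stratum Q (minor f e) d ∧
      Pairwise (Function.onFun Disjoint (stratum Q (minor f e)))) ∧
    -- the general case: an arbitrary division module
    (∀ g : Fin m → Series k (Fin m), IsDivisionModule Q f g →
      ∀ p, IsDivisionRemainder Q f g p → ∀ d : Fin m → ℕ,
      IsTextileLocallyClosed Q (multiStratum Q g d) ∧
      IsQuasiAffine d (multiPolyStratum Q g d) ∧
      IsFreeSubmodule Q (tailModule Q d) ∧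
      ∃ (ψ : multiStratum Q g d ≃ pairs (multiPolyStratum Q g d) (tailModule Q d))
        (φ : pairs (multiPolyStratum Q g d) (tailModule Q d) ≃
          pairs (multiPolyStratum Q g d) (tailModule Q d))
        (χ : pairs (multiPolyStratum Q g d) (tailModule Q d) ≃ multiStratum Q g d),
        IsTextileIso ψ ∧
        (∀ y, (ψ y).1 = Sum.elim (remainder d y.1) (y.1 - remainder d y.1)) ∧
        IsRationallyTextileIso (fstCoords (Fin m)) (fstCoords (Fin m)) φ ∧
        (∀ w : pairs (multiPolyStratum Q g d) (tailModule Q d),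
          (∃! a, a ∈ arcs (Fin m) Q ∧ snd w = diagMul g (fst w) a) ∧
          ∀ a ∈ arcs (Fin m) Q, snd w = diagMul g (fst w) a →
            (φ w).1 = Sum.elim (fst w) (diagMul g (fst w) (a + substPair p (fst w) a))) ∧
        χ = (ψ.trans φ).symm ∧
        IsRationallyTextileIso (fstCoords (Fin m)) (lowCoords d) χ ∧
        (∀ w, remainder d (χ w).1 = fst w) ∧
        ∀ w, (fun i => evalAt (f i) (χ w).1) =
          (fun i => evalAt (f i) (fst w)) + (jacobianAt f (fst w)).mulVec (snd w)) := by
  refine ⟨fun e d => ?_, fun e he => ⟨isArquileOpen_ne_zero (minor_mem_qualitySubring hf e),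
    isArquileDense_ne_zero he, ne_zero_eq_iUnion_stratum, pairwise_disjoint_stratum⟩,
    fun g hg p hp d => ⟨isTextileLocallyClosed_orderStratum Q g d,
      isQuasiAffine_orderStratum Q g d d, isFreeSubmodule_tailModule Q d,
      (isLinearizable_multiStratum hg hp d).exists_chart⟩⟩
  -- The minor enters as the constant vector (g,…,g) with the constant tuple (d,…,d).
  obtain ⟨p, hp⟩ := isLinearizable_stratum hf e d
  refine ⟨?_, ?_, isFreeSubmodule_tailModule Q _, ?_⟩
  · rw [stratum_eq_orderStratum]
    exact isTextileLocallyClosed_orderStratum Q _ _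
  · rw [polyStratum, stratum_eq_orderStratum]
    exact isQuasiAffine_orderStratum Q _ _ _
  · obtain ⟨_, _, χ, -, -, -, -, -, hχ, hrem, hf⟩ := hp.exists_chart
    exact ⟨χ, hχ, hrem, hf⟩
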